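/- An instance of Min-VNEP of dimension $\tau\in\mathbb N$ consists of a directed graph $G_S=(V_S,E_S)$ (the substrate) with $s$ nodes, a directed graph $G_R=(V_R,E_R)$ (the request) with $r$ nodes, demands $d_R\colon V_R\cup E_R\to\mathbb R_{\ge0}^{\tau}$, capacities $d_S\colon V_S\cup E_S\to\mathbb R_{\ge0}^{\tau}$ and costs $c_S\colon V_S\cup E_S\to\mathbb R_{\ge0}^{\tau}$. A mapping $(m_V,m_E)$ sends every request node $w$ to a substrate node $m_V(w)$ and every request edge $(u,v)$ to a directed path $m_E(u,v)$ in $G_S$ from $m_V(u)$ to $m_V(v)$. It is feasible if $\sum_{w:\,m_V(w)=v}d_R(w)\le d_S(v)$ for all $v\in V_S$ and $\sum_{e:\,e'\in m_E(e)}d_R(e)\le d_S(e')$ for all $e'\in E_S$ (componentwise). Its cost is $\sum_{w\in V_R}d_R(w)^\top c_S(m_V(w))+\sum_{e\in E_R}\sum_{e'\in m_E(e)}d_R(e)^\top c_S(e')$. To solve the instance means to output a feasible mapping of minimum cost together with its cost, or to report that there is no feasible mapping. A directed graph is called a tree if its underlying undirected graph is a tree (so not every edge need have a reverse edge). Theorem.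 There is an algorithm that solves every instance of Min-VNEP whose substrate $G_S$ is a tree in $\mathcal O(3^r(s+r^2))$ time for every fixed dimension $\tau$. More precisely, there are a single program and an absolute constant $C$ such that, for all $\tau,r,s$ and all instances of dimension $\tau$ with $r$ request nodes and $s$ substrate nodes whose substrate is a tree, the program solves the instance in at most $C\,(\tau+1)\,3^r(s+r^2)$ steps. Here time is counted on a random access machine for natural and real numbers (unit cost; addition, truncated subtraction and comparison of natural numbers; exact addition, subtraction, multiplication and comparison of real numbers; only natural numbers as constants), and both graphs are given as lists of edges in arbitrary order. -/

import Mathlib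

open scoped NNReal

namespace VNEP

/-! ### Directed graphs, paths, trees -/

/-- A finite directed graph on the node set `{0, …, n-1}` without parallel edges, whose edges are
listed in an arbitrary order: edge number `e` points from `src e` to `dst e`. -/
structure DiGraph (n : ℕ) where
  /-- the number of edges -/
  size : ℕ
  src : Fin size → Fin n
  dst : Fin size → Fin n
  simple : Function.Injective fun e => (src e, dst e)

namespace DiGraph

variable {n : ℕ} (G : DiGraph n)

/-- The list `p` of edges is a directed walk from `u` to `v`. -/
def IsWalk : Fin n → Fin n → List (Fin G.size) → Prop
  | u, v, [] => u = v
  | u, v, e :: p => G.src e = u ∧ IsWalk (G.dst e) v p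

/-- The list `p` of edges is a directed path from `u` to `v`: a walk that repeats no node. The empty
list is the path from a node to itself. -/
def IsPath (u v : Fin n) (p : List (Fin G.size)) : Prop :=
  G.IsWalk u v p ∧ (u :: p.map G.dst).Nodup

/-- The underlying undirected graph (for a directed graph without loops). -/
def underlying : SimpleGraph (Fin n) :=
  SimpleGraph.fromRel fun u v => ∃ e, G.src e = u ∧ G.dst e = v

/-- A directed graph is a tree if its underlying undirected graph is one; in particular it has no
loops. Antiparallel edges are allowed, and so are edges without a reverse edge. -/
def IsTree : Prop :=
  (∀ e, G.src e ≠ G.dst e) ∧ G.underlying.IsTree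

end DiGraph

/-! ### The problem Min-VNEP -/

/-- An instance of Min-VNEP with `τ`-dimensional demands, capacities and costs, `r` request nodes
and `s` substrate nodes. -/
structure Inst (τ r s : ℕ) where
  request : DiGraph r
  substrate : DiGraph s
  nodeDemand : Fin r → Fin τ → ℝ≥0
  edgeDemand : Fin request.size → Fin τ → ℝ≥0
  nodeCap : Fin s → Fin τ → ℝ≥0
  edgeCap : Fin substrate.size → Fin τ → ℝ≥0
  nodeCost : Fin s → Fin τ → ℝ≥0
  edgeCost : Fin substrate.size → Fin τ → ℝ≥0

namespace Inst

variable {τ r s : ℕ} (I : Inst τ r s)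

/-- A mapping of request nodes to substrate nodes and of request edges to lists of substrate
edges. -/
structure Mapping where
  node : Fin r → Fin s
  edge : Fin I.request.size → List (Fin I.substrate.size)

variable {I}

/-- Edges are mapped to paths between the images of their endpoints, and every single demand is at
most the capacity of each substrate element that it is mapped to. -/
structure Mapping.Valid (M : I.Mapping) : Prop where
  path : ∀ e, I.substrate.IsPath (M.node (I.request.src e)) (M.node (I.request.dst e)) (M.edge e)
  node_le : ∀ w, I.nodeDemand w ≤ I.nodeCap (M.node w)
  edge_le : ∀ e, ∀ e' ∈ M.edge e, I.edgeDemand e ≤ I.edgeCap e'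

/-- A valid mapping in which the total demand placed on each substrate node and each substrate edge
is at most its capacity (componentwise). -/
structure Mapping.Feasible (M : I.Mapping) : Prop where
  valid : M.Valid
  node_sum_le : ∀ v, ∑ w with M.node w = v, I.nodeDemand w ≤ I.nodeCap v
  edge_sum_le : ∀ e', ∑ e with e' ∈ M.edge e, I.edgeDemand e ≤ I.edgeCap e'

/-- The cost of a mapping. -/
noncomputable def Mapping.cost (M : I.Mapping) : ℝ≥0 :=
  ∑ w, dotProduct (I.nodeDemand w) (I.nodeCost (M.node w)) +
    ∑ e, ((M.edge e).map fun e' => dotProduct (I.edgeDemand e) (I.edgeCost e')).sum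

/-- `M` is a solution of Min-VNEP: a feasible mapping of minimum cost. -/
def Mapping.Optimal (M : I.Mapping) : Prop :=
  M.Feasible ∧ ∀ M' : I.Mapping, M'.Feasible → M.cost ≤ M'.cost

end Inst

/-! ### The machine model: a random access machine for natural and real numbers

The memory consists of arrays of natural numbers and arrays of real numbers. A program names
finitely many arrays by constants and indexes them by computed natural numbers, so that, with
interleaved addresses, it is a program for a machine with one memory for natural numbers and one for
real numbers, up to a constant factor in the time. On natural numbers there are addition, truncated
subtraction and comparison (no multiplication), on real numbers addition, subtraction,
multiplication and comparison (no rounding and no real constants but natural numbers). Every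
operation, every memory access, every constant and every branching takes one step. -/

/-- The contents of the memory: cell `i` of array `a`. -/
structure State where
  nat : ℕ → ℕ → ℕ
  real : ℕ → ℕ → ℝ

/-- Expressions for natural numbers; `get a i` reads cell `i` of array `a`. -/
inductive NExp where
  | lit (k : ℕ)
  | get (a : ℕ) (i : NExp)
  | add (x y : NExp)
  | sub (x y : NExp)

/-- Expressions for real numbers. -/
inductive RExp where
  | lit (k : ℕ)
  | get (a : ℕ) (i : NExp)
  | add (x y : RExp)
  | sub (x y : RExp)
  | mul (x y : RExp)

/-- Tests. -/
inductive BExp where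
  | natLe (x y : NExp)
  | realLe (x y : RExp)
  | not (b : BExp)
  | and (b c : BExp)

/-- Programs. -/
inductive Prog where
  | skip
  | setNat (a : ℕ) (i x : NExp)
  | setReal (a : ℕ) (i : NExp) (x : RExp)
  | seq (P Q : Prog)
  | ite (b : BExp) (P Q : Prog)
  | loop (b : BExp) (P : Prog)

namespace NExp

def eval (σ : State) : NExp → ℕ
  | lit k => k
  | get a i => σ.nat a (i.eval σ)
  | add x y => x.eval σ + y.eval σ
  | sub x y => x.eval σ - y.eval σ

/-- The number of steps of the evaluation. -/
def time : NExp → ℕ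
  | lit _ => 1
  | get _ i => i.time + 1
  | add x y => x.time + y.time + 1
  | sub x y => x.time + y.time + 1

end NExp

namespace RExp

noncomputable def eval (σ : State) : RExp → ℝ
  | lit k => (k : ℝ)
  | get a i => σ.real a (i.eval σ)
  | add x y => x.eval σ + y.eval σ
  | sub x y => x.eval σ - y.eval σ
  | mul x y => x.eval σ * y.eval σ

/-- The number of steps of the evaluation. -/
def time : RExp → ℕ
  | lit _ => 1
  | get _ i => i.time + 1
  | add x y => x.time + y.time + 1
  | sub x y => x.time + y.time + 1
  | mul x y => x.time + y.time + 1

end RExp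

namespace BExp

def Holds (σ : State) : BExp → Prop
  | natLe x y => x.eval σ ≤ y.eval σ
  | realLe x y => x.eval σ ≤ y.eval σ
  | not b => ¬ b.Holds σ
  | and b c => b.Holds σ ∧ c.Holds σ

/-- The number of steps of the evaluation. -/
def time : BExp → ℕ
  | natLe x y => x.time + y.time + 1
  | realLe x y => x.time + y.time + 1
  | not b => b.time + 1
  | and b c => b.time + c.time + 1

end BExp

namespace State

/-- Write `k` into cell `i` of the natural-number array `a`. -/
def writeNat (σ : State) (a i k : ℕ) : State :=
  { σ with nat := Function.update σ.nat a (Function.update (σ.nat a) i k) }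

/-- Write `x` into cell `i` of the real-number array `a`. -/
def writeReal (σ : State) (a i : ℕ) (x : ℝ) : State :=
  { σ with real := Function.update σ.real a (Function.update (σ.real a) i x) }

end State

/-- `Exec P σ t σ'`: the program `P`, started with memory `σ`, halts after exactly `t` steps with
memory `σ'`. -/
inductive Exec : Prog → State → ℕ → State → Prop
  | skip (σ : State) : Exec Prog.skip σ 1 σ
  | setNat (σ : State) (a : ℕ) (i x : NExp) :
      Exec (Prog.setNat a i x) σ (i.time + x.time + 1) (σ.writeNat a (i.eval σ) (x.eval σ))
  | setReal (σ : State) (a : ℕ) (i : NExp) (x : RExp) :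
      Exec (Prog.setReal a i x) σ (i.time + x.time + 1) (σ.writeReal a (i.eval σ) (x.eval σ))
  | seq {P Q : Prog} {σ σ' σ'' : State} {t t' : ℕ} (hP : Exec P σ t σ') (hQ : Exec Q σ' t' σ'') :
      Exec (Prog.seq P Q) σ (t + t') σ''
  | iteTrue {b : BExp} {P Q : Prog} {σ σ' : State} {t : ℕ} (hb : b.Holds σ) (hP : Exec P σ t σ') :
      Exec (Prog.ite b P Q) σ (b.time + 1 + t) σ'
  | iteFalse {b : BExp} {P Q : Prog} {σ σ' : State} {t : ℕ} (hb : ¬ b.Holds σ)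
      (hQ : Exec Q σ t σ') : Exec (Prog.ite b P Q) σ (b.time + 1 + t) σ'
  | loopStop {b : BExp} {P : Prog} {σ : State} (hb : ¬ b.Holds σ) :
      Exec (Prog.loop b P) σ (b.time + 1) σ
  | loopStep {b : BExp} {P : Prog} {σ σ' σ'' : State} {t t' : ℕ} (hb : b.Holds σ)
      (hP : Exec P σ t σ') (hL : Exec (Prog.loop b P) σ' t' σ'') :
      Exec (Prog.loop b P) σ (b.time + 1 + t + t') σ''

/-! ### Input and output -/

/-- An array that holds the number `f i` in cell `i < m`, and `0` beyond. -/
def natArray {m : ℕ} (f : Fin m → ℕ) (i : ℕ) : ℕ :=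
  if h : i < m then f ⟨i, h⟩ else 0

/-- An array that holds the vectors `f 0, f 1, …, f (m - 1)` one after the other (component `k` of
`f i` in cell `i * τ + k`), and `0` beyond. -/
noncomputable def vecArray {m τ : ℕ} (f : Fin m → Fin τ → ℝ≥0) (j : ℕ) : ℝ :=
  if h : j < m * τ then
    ((f (finProdFinEquiv.symm ⟨j, h⟩).1 (finProdFinEquiv.symm ⟨j, h⟩).2 : ℝ≥0) : ℝ)
  else 0

namespace Inst

variable {τ r s : ℕ} (I : Inst τ r s)

/-- The memory at the start of the computation: the instance in its natural encoding (both graphs as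
lists of edges), and `0` in all other cells. -/
noncomputable def input : State where
  nat
    | 0 => natArray ![τ, r, s, I.request.size, I.substrate.size]
    | 1 => natArray fun e => (I.request.src e : ℕ)
    | 2 => natArray fun e => (I.request.dst e : ℕ)
    | 3 => natArray fun e => (I.substrate.src e : ℕ)
    | 4 => natArray fun e => (I.substrate.dst e : ℕ)
    | _ => fun _ => 0
  real
    | 0 => vecArray I.nodeDemand
    | 1 => vecArray I.edgeDemand
    | 2 => vecArray I.nodeCap
    | 3 => vecArray I.edgeCap
    | 4 => vecArray I.nodeCost
    | 5 => vecArray I.edgeCost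
    | _ => fun _ => 0

/-- The memory `σ` displays the mapping `M`: array `6` holds the node mapping, and the edges of the
path of the request edge `e` stand, in order, in the cells of array `8` from number `σ.nat 7 e` up
to, but not including, number `σ.nat 7 (e + 1)`. -/
structure Displays (σ : State) (M : I.Mapping) : Prop where
  node : ∀ w : Fin r, σ.nat 6 w = M.node w
  length : ∀ e : Fin I.request.size, σ.nat 7 e + (M.edge e).length = σ.nat 7 (e + 1)
  edge : ∀ (e : Fin I.request.size) (j : ℕ) (hj : j < (M.edge e).length),
    σ.nat 8 (σ.nat 7 e + j) = (M.edge e)[j]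

/-- The memory `σ` shows a correct answer to the instance `I`: the flag (cell `0` of array `5`) is
`0` and there is no feasible mapping, or the flag is `1` and `σ` displays a feasible mapping of
minimum cost, together with this cost. -/
def Answered (σ : State) : Prop :=
  (σ.nat 5 0 = 0 ∧ ¬ ∃ M : I.Mapping, M.Feasible) ∨
    (σ.nat 5 0 = 1 ∧ ∃ M : I.Mapping, M.Optimal ∧ I.Displays σ M ∧ σ.real 6 0 = M.cost)

end Inst

end VNEP

/-! The substrate tree is contracted leaf by leaf. When a leaf `v` of the remaining tree is merged
into its only remaining neighbour `p`, the nodes merged with `v` so far form a part of the substrate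
whose boundary consists of edges between `v` and `p` alone (`Legal.edge`). A path crosses such a
boundary at most once, and it does so exactly if its ends lie on different sides (`IsPath.cut`). Let
`T` be the set of request nodes placed in this part. Whatever the paths are, the edge from `v` to
`p` then carries exactly the request edges that leave `T`, and the edge from `p` to `v` those that
enter `T`. Load and cost of both edges thus depend on `T` only (`cutVal`); a missing edge costs
infinity as soon as it is needed. Infeasibility is the value `⊤` in `ℝ≥0∞`.

This gives a dynamic program. For a remaining node `x` and a set `S` of request nodes, `G x S` is
the least cost of placing exactly `S` in the part merged with `x`, edges inside the part included.
Merging `v` into `p` replaces `G p S` by the minimum over `T ⊆ S` of `G p (S \ T) + G v T + cutVal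
T` (`Good.step`). At the last node, the value of the full set is the optimum, or `⊤` if nothing is
feasible, because the total over all nodes and edges is the cost of the mapping (`total_eq`,
`total_final`). Undoing the recorded minimizers `T` in reverse order gives an optimal node mapping.
The paths are found by climbing, each time from the end that was eliminated first (`Route.isPath`,
`exists_route`).

As for the time, the pairs `(T, S \ T)` are the pairs of disjoint sets, and there are `3 ^ r` of
them, so a merge takes `O(3 ^ r)` steps. The cut costs of all `T` take `O((τ + 1) * (r + 1) ^ 2 * 2
^ r)` steps, and `(r + 1) ^ 2 * 2 ^ r ≤ 5 * 3 ^ r` (`sq_mul_two_pow_le`). There are `s - 1`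
eliminations. The list of disjoint pairs is made once, within `O((r + 1) * 3 ^ r)` steps. At most `r
^ 2` paths of fewer than `s` edges are written at the end.

Leaves are found without adjacency lists. Each node keeps the number of its remaining outgoing edges
and the sum of their edge numbers, and the same for incoming edges; when a single edge remains, the
sum is its number (`Degrees.optAt_out`). One upward scan over the nodes, interrupted by moves from
an eliminated leaf to its parent, finds all leaves, since only that parent can become a new leaf
(`IsLeaf.of_erase`, `forwardLoop_run`).

The programs are verified by rules that bound time and describe the final memory together (`Run`).
Unchanged arrays are read off the program text (`Framed`). -/

namespace VNEP

/-! ### A calculus for running times -/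

/-- `P`, started in `σ`, halts within `T` steps in a state that satisfies `Q`. -/
def Run (P : Prog) (σ : State) (T : ℕ) (Q : State → Prop) : Prop :=
  ∃ t σ', Exec P σ t σ' ∧ t ≤ T ∧ Q σ'

namespace State

@[simp] theorem writeNat_nat (σ : State) (a i k b j : ℕ) :
    (σ.writeNat a i k).nat b j = if b = a ∧ j = i then k else σ.nat b j := by
  unfold writeNat
  by_cases h : b = a
  · subst h; by_cases h' : j = i <;> simp [h']
  · simp [h]

@[simp] theorem writeNat_real (σ : State) (a i k : ℕ) : (σ.writeNat a i k).real = σ.real := rfl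

@[simp] theorem writeReal_nat (σ : State) (a i : ℕ) (x : ℝ) : (σ.writeReal a i x).nat = σ.nat := rfl

@[simp] theorem writeReal_real (σ : State) (a i : ℕ) (x : ℝ) (b j : ℕ) :
    (σ.writeReal a i x).real b j = if b = a ∧ j = i then x else σ.real b j := by
  unfold writeReal
  by_cases h : b = a
  · subst h; by_cases h' : j = i <;> simp [h']
  · simp [h]

end State

namespace BExp

/-- The test `x < y`. -/
def lt (x y : NExp) : BExp := .natLe (.add x (.lit 1)) y

/-- The test `x ≠ y`. -/
def ne (x y : NExp) : BExp := .not (.and (.natLe x y) (.natLe y x))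

@[simp] theorem holds_lt (σ : State) (x y : NExp) : (lt x y).Holds σ ↔ x.eval σ < y.eval σ := by
  exact Nat.succ_le_iff

@[simp] theorem holds_ne (σ : State) (x y : NExp) : (ne x y).Holds σ ↔ x.eval σ ≠ y.eval σ := by
  change ¬(x.eval σ ≤ y.eval σ ∧ y.eval σ ≤ x.eval σ) ↔ _
  omega

@[simp] theorem holds_natLe (σ : State) (x y : NExp) :
    (natLe x y).Holds σ ↔ x.eval σ ≤ y.eval σ := Iff.rfl

@[simp] theorem holds_realLe (σ : State) (x y : RExp) :
    (realLe x y).Holds σ ↔ x.eval σ ≤ y.eval σ := Iff.rfl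

@[simp] theorem holds_not (σ : State) (b : BExp) : (not b).Holds σ ↔ ¬ b.Holds σ := Iff.rfl

@[simp] theorem holds_and (σ : State) (b c : BExp) :
    (and b c).Holds σ ↔ b.Holds σ ∧ c.Holds σ := Iff.rfl

@[simp] theorem time_lt (x y : NExp) : (lt x y).time = x.time + y.time + 3 := by
  simp [lt, time, NExp.time]; ring

end BExp

namespace Prog

/-- The program contains no loop. -/
def straight : Prog → Bool
  | seq P Q => P.straight && Q.straight
  | ite _ P Q => P.straight && Q.straight
  | loop _ _ => false
  | _ => true

/-- A bound for the running time of a program without loops. -/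
def bound : Prog → ℕ
  | skip => 1
  | setNat _ i x => i.time + x.time + 1
  | setReal _ i x => i.time + x.time + 1
  | seq P Q => P.bound + Q.bound
  | ite b P Q => b.time + 1 + max P.bound Q.bound
  | loop _ _ => 0

open Classical in
/-- The final state of a program without loops. -/
noncomputable def result : Prog → State → State
  | skip, σ => σ
  | setNat a i x, σ => σ.writeNat a (i.eval σ) (x.eval σ)
  | setReal a i x, σ => σ.writeReal a (i.eval σ) (x.eval σ)
  | seq P Q, σ => Q.result (P.result σ)
  | ite b P Q, σ => if b.Holds σ then P.result σ else Q.result σ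
  | loop _ _, σ => σ

/-- The arrays of natural numbers to which a program writes. -/
def natWrites : Prog → List ℕ
  | setNat a _ _ => [a]
  | seq P Q => P.natWrites ++ Q.natWrites
  | ite _ P Q => P.natWrites ++ Q.natWrites
  | loop _ P => P.natWrites
  | _ => []

/-- The arrays of real numbers to which a program writes. -/
def realWrites : Prog → List ℕ
  | setReal a _ _ => [a]
  | seq P Q => P.realWrites ++ Q.realWrites
  | ite _ P Q => P.realWrites ++ Q.realWrites
  | loop _ P => P.realWrites
  | _ => []

end Prog

/-- Programs name their arrays by constants, so the arrays that a run can change are visible in the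
program text. Every later correctness proof tracks only the arrays it needs and gets the others from
here. -/
theorem Exec.frame {P : Prog} {σ σ' : State} {t : ℕ} (h : Exec P σ t σ') :
    (∀ a ∉ P.natWrites, σ'.nat a = σ.nat a) ∧ ∀ a ∉ P.realWrites, σ'.real a = σ.real a := by
  induction h with
  | skip => simp
  | setNat σ a i x =>
    refine ⟨fun b hb => ?_, fun b _ => rfl⟩
    simp only [Prog.natWrites, List.mem_singleton] at hb
    funext j; simp [hb]
  | setReal σ a i x =>
    refine ⟨fun b _ => rfl, fun b hb => ?_⟩
    simp only [Prog.realWrites, List.mem_singleton] at hb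
    funext j; simp [hb]
  | seq _ _ h1 h2 =>
    simp only [Prog.natWrites, Prog.realWrites, List.mem_append, not_or]
    exact ⟨fun a ha => (h2.1 a ha.2).trans (h1.1 a ha.1),
      fun a ha => (h2.2 a ha.2).trans (h1.2 a ha.1)⟩
  | iteTrue _ _ h1 =>
    simp only [Prog.natWrites, Prog.realWrites, List.mem_append, not_or]
    exact ⟨fun a ha => h1.1 a ha.1, fun a ha => h1.2 a ha.1⟩
  | iteFalse _ _ h1 =>
    simp only [Prog.natWrites, Prog.realWrites, List.mem_append, not_or]
    exact ⟨fun a ha => h1.1 a ha.2, fun a ha => h1.2 a ha.2⟩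
  | loopStop => simp
  | loopStep _ _ _ h1 h2 =>
    exact ⟨fun a ha => (h2.1 a ha).trans (h1.1 a ha), fun a ha => (h2.2 a ha).trans (h1.2 a ha)⟩

/-- `σ'` differs from `σ` only in arrays to which `P` writes. -/
structure Framed (P : Prog) (σ σ' : State) : Prop where
  nat : ∀ a, (P.natWrites.elem a) = false → σ'.nat a = σ.nat a
  real : ∀ a, (P.realWrites.elem a) = false → σ'.real a = σ.real a

namespace Run

variable {P P' : Prog} {σ : State} {T T' : ℕ} {Q R : State → Prop}

theorem mono (h : Run P σ T Q) (hT : T ≤ T') (hQ : ∀ σ', Q σ' → R σ') : Run P σ T' R := by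
  obtain ⟨t, σ', h1, h2, h3⟩ := h
  exact ⟨t, σ', h1, h2.trans hT, hQ _ h3⟩

theorem framed (h : Run P σ T Q) : Run P σ T fun σ' => Q σ' ∧ Framed P σ σ' := by
  obtain ⟨t, σ', h1, h2, h3⟩ := h
  exact ⟨t, σ', h1, h2, h3, fun a ha => h1.frame.1 a (by simpa using ha),
    fun a ha => h1.frame.2 a (by simpa using ha)⟩

theorem conseq (h : Run P σ T Q) (hT : T ≤ T') (hQ : ∀ σ', Q σ' → Framed P σ σ' → R σ') :
    Run P σ T' R :=
  h.framed.mono hT fun _ h => hQ _ h.1 h.2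

theorem seq (h : Run P σ T fun σ' => Run P' σ' T' Q) : Run (P.seq P') σ (T + T') Q := by
  obtain ⟨t, σ', h1, h2, t', σ'', h3, h4, h5⟩ := h
  exact ⟨_, _, h1.seq h3, by omega, h5⟩

/-- Without loops the final memory is a function of the initial one, so a straight block is verified
by evaluating `Prog.result` symbolically, and its time is a fixed number, with the longer branch
charged at each test. -/
theorem straight (P : Prog) (σ : State) (h : P.straight = true) :
    Run P σ P.bound fun σ' => σ' = P.result σ := by
  suffices ∃ t, Exec P σ t (P.result σ) ∧ t ≤ P.bound from
    let ⟨t, h1, h2⟩ := this; ⟨t, _, h1, h2, rfl⟩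
  induction P generalizing σ with
  | skip => exact ⟨_, .skip σ, le_rfl⟩
  | setNat a i x => exact ⟨_, .setNat σ a i x, le_rfl⟩
  | setReal a i x => exact ⟨_, .setReal σ a i x, le_rfl⟩
  | seq P Q hP hQ =>
    simp only [Prog.straight, Bool.and_eq_true] at h
    obtain ⟨t, h1, h2⟩ := hP σ h.1
    obtain ⟨t', h1', h2'⟩ := hQ (P.result σ) h.2
    exact ⟨_, h1.seq h1', by simp only [Prog.bound]; omega⟩
  | ite b P Q hP hQ =>
    simp only [Prog.straight, Bool.and_eq_true] at h
    by_cases hb : b.Holds σ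
    · obtain ⟨t, h1, h2⟩ := hP σ h.1
      refine ⟨_, by simpa only [Prog.result, hb, if_true] using Exec.iteTrue hb h1, ?_⟩
      simp only [Prog.bound]; omega
    · obtain ⟨t, h1, h2⟩ := hQ σ h.2
      refine ⟨_, by simpa only [Prog.result, hb, if_false] using Exec.iteFalse hb h1, ?_⟩
      simp only [Prog.bound]; omega
  | loop => simp [Prog.straight] at h

theorem of_straight (h : P.straight = true) (hT : P.bound ≤ T) (hQ : Q (P.result σ)) :
    Run P σ T Q :=
  (straight P σ h).mono hT fun _ h => h ▸ hQ

theorem ite {b : BExp} (h : b.Holds σ → Run P σ T Q) (h' : ¬ b.Holds σ → Run P' σ T Q) :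
    Run (.ite b P P') σ (b.time + 1 + T) Q := by
  by_cases hb : b.Holds σ
  · obtain ⟨t, σ', h1, h2, h3⟩ := h hb
    exact ⟨_, _, .iteTrue hb h1, by omega, h3⟩
  · obtain ⟨t, σ', h1, h2, h3⟩ := h' hb
    exact ⟨_, _, .iteFalse hb h1, by omega, h3⟩

/-- A loop whose invariant has a decreasing parameter. -/
theorem loop {b : BExp} {J : ℕ → State → Prop} (m : ℕ) (hJ : J m σ)
    (hstep : ∀ n σ, J n σ → b.Holds σ → Run P σ T fun σ' => ∃ n' < n, J n' σ') :
    Run (.loop b P) σ ((m + 1) * (T + b.time + 1)) fun σ' => (∃ n, J n σ') ∧ ¬ b.Holds σ' := by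
  induction m using Nat.strong_induction_on generalizing σ with
  | _ m ih =>
    by_cases hb : b.Holds σ
    · obtain ⟨t, σ', h1, h2, n', hn, h3⟩ := hstep m σ hJ hb
      obtain ⟨t', σ'', h1', h2', h3'⟩ := ih n' hn h3
      refine ⟨_, _, .loopStep hb h1 h1', ?_, h3'⟩
      -- The round is paid for by the drop of the parameter from `m` to `n' < m`; the extra `1` in
      -- `m + 1` pays for the last, failing test.
      have : (n' + 1) * (T + b.time + 1) + (T + b.time + 1) ≤ (m + 1) * (T + b.time + 1) := by
        rw [← Nat.succ_mul]; exact Nat.mul_le_mul_right _ (by omega)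
      omega
    · refine ⟨_, _, .loopStop hb, ?_, ⟨m, hJ⟩, hb⟩
      nlinarith

end Run

namespace Prog

/-- The scalar variable kept in cell `0` of array `a`. -/
abbrev _root_.VNEP.NExp.var (a : ℕ) : NExp := .get a (.lit 0)

/-- Assignment to a scalar variable. -/
abbrev setVar (a : ℕ) (x : NExp) : Prog := .setNat a (.lit 0) x

/-- Run `P` with the variable `i` equal to `0, 1, …, n - 1`. -/
def for_ (i : ℕ) (n : NExp) (P : Prog) : Prog :=
  .seq (setVar i (.lit 0))
    (.loop (.lt (.var i) n) (.seq P (setVar i (.add (.var i) (.lit 1)))))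

end Prog

/-- The rule for `for` loops, where the loop variable is not touched by the body. -/
theorem Run.for_ {P : Prog} {σ : State} {T : ℕ} {i : ℕ} {n : NExp} {J : ℕ → State → Prop} (m : ℕ)
    (hi : P.natWrites.elem i = false)
    (hn : ∀ k σ', J k σ' → Framed (.for_ i n P) σ σ' → n.eval σ' = m)
    (h0 : J 0 (σ.writeNat i 0 0))
    (hstep : ∀ k σ', J k σ' → k < m → σ'.nat i 0 = k → Framed (.for_ i n P) σ σ' →
      Run P σ' T fun σ'' => J (k + 1) (σ''.writeNat i 0 (k + 1))) :
    Run (.for_ i n P) σ ((m + 1) * (T + n.time + 15)) (J m) := by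
  have h1 : Run (.setNat i (.lit 0) (.lit 0)) σ 3 fun σ' => σ' = σ.writeNat i 0 0 :=
    Run.of_straight rfl le_rfl rfl
  have hw : ∀ a, (Prog.for_ i n P).natWrites.elem a = false → a ≠ i ∧ P.natWrites.elem a = false := by
    intro a ha
    simp only [Prog.for_, Prog.natWrites, List.elem_eq_mem, List.mem_append, List.mem_singleton,
      decide_eq_false_iff_not, not_or] at ha ⊢
    exact ⟨ha.1, ha.2.1⟩
  have hw' : ∀ a, (Prog.for_ i n P).realWrites.elem a = false → P.realWrites.elem a = false := by
    intro a ha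
    simp only [Prog.for_, Prog.realWrites, List.elem_eq_mem, List.mem_append,
      decide_eq_false_iff_not, not_or] at ha ⊢
    exact ha.2.1
  have hwr : ∀ (σ' : State) k, Framed (.for_ i n P) σ σ' →
      Framed (.for_ i n P) σ (σ'.writeNat i 0 k) := fun σ' k hF =>
    ⟨fun a ha => by rw [← hF.nat a ha]; funext j; simp [(hw a ha).1], fun a ha => hF.real a ha⟩
  have h2 : Run (.loop (.lt (.var i) n) (.seq P (.setVar i (.add (.var i) (.lit 1)))))
      (σ.writeNat i 0 0) ((m + 1) * ((T + 6) + (NExp.time (.var i) + n.time + 3) + 1))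
      (J m) := by
    -- The decreasing parameter is `d = m - k`. Keeping `Framed` in the invariant lets the bound `n`
    -- be evaluated anew in every round with the same result.
    have := Run.loop (b := .lt (.var i) n) (P := .seq P (.setVar i (.add (.var i) (.lit 1))))
      (T := T + 6) (σ := σ.writeNat i 0 0)
      (J := fun d σ' => ∃ k, k + d = m ∧ σ'.nat i 0 = k ∧ J k σ' ∧ Framed (.for_ i n P) σ σ') m
      ⟨0, by omega, by simp, h0, hwr _ _ ⟨fun _ _ => rfl, fun _ _ => rfl⟩⟩ (by
        rintro d σ' ⟨k, hk, hik, hJ, hF'⟩ hb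
        rw [BExp.holds_lt, hn k σ' hJ hF'] at hb
        simp only [NExp.eval, hik] at hb
        refine Run.seq (((hstep k σ' hJ hb hik hF').conseq le_rfl) fun σ'' hQ hF => ?_)
        have e : σ''.nat i 0 = k := by rw [hF.nat i hi, hik]
        refine Run.of_straight rfl ?_ ⟨d - 1, by omega, k + 1, by omega, ?_, ?_, ?_⟩
        · simp [Prog.bound, NExp.time]
        · simp [Prog.result, NExp.eval, e]
        · simpa [Prog.result, NExp.eval, e] using hQ
        · exact hwr _ _ ⟨fun a ha => (hF.nat a (hw a ha).2).trans (hF'.nat a ha),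
            fun a ha => (hF.real a (hw' a ha)).trans (hF'.real a ha)⟩)
    rw [BExp.time_lt] at this
    refine this.mono le_rfl ?_
    rintro σ' ⟨⟨d, k, hk, hik, hJ, hF'⟩, hb⟩
    rw [BExp.holds_lt, hn k σ' hJ hF'] at hb
    simp only [NExp.eval, hik] at hb
    obtain rfl : k = m := by omega
    exact hJ
  unfold Prog.for_
  refine (Run.seq (h1.mono le_rfl fun σ' h => h ▸ h2)).mono ?_ fun _ h => h
  have e : T + 6 + ((NExp.var i).time + n.time + 3) + 1 = T + n.time + 12 := by
    simp only [NExp.time]; ring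
  rw [e]
  nlinarith

theorem Framed.refl (P : Prog) (σ : State) : Framed P σ σ := ⟨fun _ _ => rfl, fun _ _ => rfl⟩

/-- The rule for loops, with the information which arrays remain unchanged. -/
theorem Run.while_ {P : Prog} {σ : State} {T : ℕ} {b : BExp} {J : ℕ → State → Prop} (m : ℕ)
    (hJ : J m σ)
    (hstep : ∀ n σ', J n σ' → b.Holds σ' → Framed P σ σ' →
      Run P σ' T fun σ'' => ∃ n' < n, J n' σ'') :
    Run (.loop b P) σ ((m + 1) * (T + b.time + 1)) fun σ' => (∃ n, J n σ') ∧ ¬ b.Holds σ' := by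
  refine (Run.loop (J := fun n σ' => J n σ' ∧ Framed P σ σ') m ⟨hJ, .refl P σ⟩ ?_).mono le_rfl
    fun σ' ⟨⟨n, h, _⟩, h'⟩ => ⟨⟨n, h⟩, h'⟩
  rintro n σ' ⟨h, hF⟩ hb
  refine (hstep n σ' h hb hF).conseq le_rfl fun σ'' ⟨n', hn, h'⟩ hF' => ⟨n', hn, h', ?_, ?_⟩
  · exact fun a ha => (hF'.nat a ha).trans (hF.nat a ha)
  · exact fun a ha => (hF'.real a ha).trans (hF.real a ha)

end VNEP

namespace VNEP

/-! ### Directed paths and cuts -/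

namespace DiGraph

variable {n : ℕ} {G : DiGraph n}

theorem edge_ext {e e' : Fin G.size} (h : G.src e = G.src e') (h' : G.dst e = G.dst e') : e = e' :=
  G.simple (Prod.ext h h')

theorem IsWalk.src_mem {x y : Fin n} {q : List (Fin G.size)} (h : G.IsWalk x y q)
    {e : Fin G.size} (he : e ∈ q) : G.src e ∈ x :: q.map G.dst := by
  induction q generalizing x with
  | nil => simp at he
  | cons f q ih =>
    obtain ⟨h1, h2⟩ := h
    rcases List.mem_cons.1 he with rfl | he
    · simp [h1]
    · have := ih h2 he
      simp only [List.map_cons]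
      exact List.mem_cons_of_mem _ this

theorem dst_mem {q : List (Fin G.size)} {e : Fin G.size} (x : Fin n) (he : e ∈ q) :
    G.dst e ∈ x :: q.map G.dst :=
  List.mem_cons_of_mem _ (List.mem_map_of_mem he)

theorem IsWalk.append {x y z : Fin n} {q q' : List (Fin G.size)} (h : G.IsWalk x y q)
    (h' : G.IsWalk y z q') : G.IsWalk x z (q ++ q') := by
  induction q generalizing x with
  | nil => obtain rfl : x = y := h; exact h'
  | cons f q ih => exact ⟨h.1, ih h.2⟩

/-- If all edges between `B` and its complement join `v ∈ B` and `p ∉ B`, then a path crosses the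
boundary of `B` at most once. -/
theorem IsPath.cut {B : Fin n → Prop} {v p : Fin n} (hv : B v) (hp : ¬ B p)
    (hout : ∀ e, B (G.src e) → ¬ B (G.dst e) → G.src e = v ∧ G.dst e = p)
    (hin : ∀ e, ¬ B (G.src e) → B (G.dst e) → G.src e = p ∧ G.dst e = v)
    {x y : Fin n} {q : List (Fin G.size)} (h : G.IsPath x y q) :
    ((∃ e ∈ q, G.src e = v ∧ G.dst e = p) ↔ B x ∧ ¬ B y) ∧
      ((∃ e ∈ q, G.src e = p ∧ G.dst e = v) ↔ ¬ B x ∧ B y) := by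
  induction q generalizing x with
  | nil =>
    obtain rfl : x = y := h.1
    simp
  | cons f q ih =>
    obtain ⟨⟨h1, h2⟩, h3⟩ := h
    rw [List.map_cons, List.nodup_cons] at h3
    obtain ⟨ih1, ih2⟩ := ih ⟨h2, h3.2⟩
    -- A path repeats no node, so none of its later edges touches the start `x`.
    have hx : ∀ e ∈ q, G.src e ≠ x ∧ G.dst e ≠ x := fun e he =>
      ⟨fun h => h3.1 (h ▸ h2.src_mem he), fun h => h3.1 (h ▸ dst_mem _ he)⟩
    simp only [List.exists_mem_cons_iff, ih1, ih2, h1]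
    by_cases hBx : B x <;> by_cases hBd : B (G.dst f)
    · have e1 : ¬ (x = v ∧ G.dst f = p) := fun h => hp (h.2 ▸ hBd)
      have e2 : ¬ (x = p ∧ G.dst f = v) := fun h => hp (h.1 ▸ hBx)
      simp [e1, e2, hBx, hBd]
    · obtain ⟨a1, a2⟩ := hout f (h1.symm ▸ hBx) hBd
      rw [h1] at a1
      have e2 : ¬ (x = p ∧ G.dst f = v) := fun h => hp (h.1 ▸ hBx)
      -- To come back into `B`, the rest of the path would have to end an edge in `v`, which is the
      -- start `x`.
      have e3 : ¬ B y := fun hy => by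
        obtain ⟨e, he, _, he'⟩ := ih2.2 ⟨hBd, hy⟩
        exact (hx e he).2 (he'.trans a1.symm)
      simp [a1, a2, e3, hv, hp, show v ≠ p from fun h => hp (h ▸ hv)]
    · obtain ⟨a1, a2⟩ := hin f (h1.symm ▸ hBx) hBd
      rw [h1] at a1
      have e3 : B y := by
        by_contra hy
        obtain ⟨e, he, _, he'⟩ := ih1.2 ⟨hBd, hy⟩
        exact (hx e he).2 (he'.trans a1.symm)
      simp [a1, a2, e3, hv, hp, show p ≠ v from fun h => hp (h ▸ hv)]
    · have e1 : ¬ (x = v ∧ G.dst f = p) := fun h => hBx (h.1 ▸ hv)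
      have e2 : ¬ (x = p ∧ G.dst f = v) := fun h => hBd (h.2 ▸ hv)
      simp [e1, e2, hBx, hBd]

end DiGraph

/-! ### Elimination of leaves -/

/-- The elimination of the leaf `v` with neighbour `p`. The edges from `v` to `p` and back are `up`
and `down`. Of a set `S` of request nodes for `p`, the part `ch S` is to be handed over to `v`. -/
structure Elim (r s m : ℕ) where
  v : Fin s
  p : Fin s
  up : Option (Fin m)
  down : Option (Fin m)
  ch : Finset (Fin r) → Finset (Fin r)

namespace Elim

variable {r s m : ℕ}

/-- The node with which a given node has been merged (the last elimination comes first). -/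
def rep : List (Elim r s m) → Fin s → Fin s
  | [], x => x
  | ε :: h, x => if rep h x = ε.v then ε.p else rep h x

/-- The nodes that have not been eliminated. -/
def alive : List (Elim r s m) → Finset (Fin s)
  | [] => Finset.univ
  | ε :: h => (alive h).erase ε.v

end Elim

open Elim

namespace DiGraph

variable {r s : ℕ} (G : DiGraph s)

/-- The elimination `ε` is possible after the eliminations `h`. -/
structure CanElim (h : List (Elim r s G.size)) (ε : Elim r s G.size) : Prop where
  v_mem : ε.v ∈ alive h
  p_mem : ε.p ∈ alive h
  ne : ε.v ≠ ε.p
  of_src : ∀ e, G.src e = ε.v → G.dst e ∈ alive h → ε.up = some e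
  of_dst : ∀ e, G.dst e = ε.v → G.src e ∈ alive h → ε.down = some e
  up : ∀ e, ε.up = some e → G.src e = ε.v ∧ G.dst e = ε.p
  down : ∀ e, ε.down = some e → G.src e = ε.p ∧ G.dst e = ε.v

/-- A list of eliminations, each of which is possible after its predecessors. -/
def Legal : List (Elim r s G.size) → Prop
  | [] => True
  | ε :: h => G.CanElim h ε ∧ Legal h

variable {G}

theorem Legal.rep_mem : ∀ {h : List (Elim r s G.size)}, G.Legal h → ∀ x, rep h x ∈ alive h
  | [], _, x => by simp [alive]
  | ε :: h, ⟨h1, h2⟩, x => by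
    have := h2.rep_mem x
    simp only [rep, alive, Finset.mem_erase]
    split
    · exact ⟨h1.ne.symm, h1.p_mem⟩
    · exact ⟨‹_›, this⟩

theorem rep_eq_self : ∀ {h : List (Elim r s G.size)} {x : Fin s}, x ∈ alive h → rep h x = x
  | [], _, _ => rfl
  | ε :: h, x, hx => by
    simp only [alive, Finset.mem_erase] at hx
    rw [rep, rep_eq_self hx.2, if_neg hx.1]

/-- Merging a leaf makes loops of the edges at the leaf and leaves the ends of all other remaining
edges alone. So an edge between two different parts joins their representatives themselves, and a
part touches the rest only through its representative. -/
theorem Legal.edge : ∀ {h : List (Elim r s G.size)}, G.Legal h → ∀ e,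
    rep h (G.src e) = rep h (G.dst e) ∨ G.src e ∈ alive h ∧ G.dst e ∈ alive h
  | [], _, e => by simp [alive]
  | ε :: h, ⟨h1, h2⟩, e => by
    rcases h2.edge e with h3 | ⟨h3, h4⟩
    · left; simp only [rep, h3]
    · by_cases hs : G.src e = ε.v
      · left
        have := (h1.up e (h1.of_src e hs h4)).2
        rw [rep, rep, rep_eq_self h3, rep_eq_self h4, if_pos hs, this]
        simp
      · by_cases hd : G.dst e = ε.v
        · left
          have := (h1.down e (h1.of_dst e hd h3)).1
          rw [rep, rep, rep_eq_self h3, rep_eq_self h4, if_pos hd, this]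
          simp
        · right; simp [alive, *]

/-- Apply `IsPath.cut` to the set `B` of nodes merged with `ε.v`; by `Legal.edge` its boundary
consists of edges between `ε.v` and `ε.p`. Whether a path uses `ε.up` or `ε.down` is thus decided by
its ends alone, and the existence of a path shows that no missing link is needed. -/
theorem CanElim.path_cut {h : List (Elim r s G.size)} {ε : Elim r s G.size} (h1 : G.CanElim h ε)
    (h2 : G.Legal h) {x y : Fin s} {q : List (Fin G.size)} (hq : G.IsPath x y q) :
    (∀ e, ε.up = some e → (e ∈ q ↔ rep h x = ε.v ∧ rep h y ≠ ε.v)) ∧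
    (∀ e, ε.down = some e → (e ∈ q ↔ rep h x ≠ ε.v ∧ rep h y = ε.v)) ∧
    (ε.up = none → ¬ (rep h x = ε.v ∧ rep h y ≠ ε.v)) ∧
    (ε.down = none → ¬ (rep h x ≠ ε.v ∧ rep h y = ε.v)) := by
  have hout : ∀ e, rep h (G.src e) = ε.v → ¬ rep h (G.dst e) = ε.v →
      G.src e = ε.v ∧ G.dst e = ε.p := fun e hs hd => by
    rcases h2.edge e with h3 | ⟨h3, h4⟩
    · exact absurd (h3 ▸ hs) hd
    · rw [rep_eq_self h3] at hs
      exact h1.up e (h1.of_src e hs h4)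
  have hin : ∀ e, ¬ rep h (G.src e) = ε.v → rep h (G.dst e) = ε.v →
      G.src e = ε.p ∧ G.dst e = ε.v := fun e hs hd => by
    rcases h2.edge e with h3 | ⟨h3, h4⟩
    · exact absurd (h3.trans hd) hs
    · rw [rep_eq_self h4] at hd
      exact h1.down e (h1.of_dst e hd h3)
  have key := hq.cut (B := fun z => rep h z = ε.v) (v := ε.v) (p := ε.p)
    (rep_eq_self h1.v_mem) (by rw [rep_eq_self h1.p_mem]; exact h1.ne.symm) hout hin
  refine ⟨fun e he => ?_, fun e he => ?_, fun he hc => ?_, fun he hc => ?_⟩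
  · have h3 := h1.up e he
    rw [← key.1]
    exact ⟨fun h => ⟨e, h, h3⟩, fun ⟨f, hf, hf'⟩ => by
      rwa [edge_ext (h3.1.trans hf'.1.symm) (h3.2.trans hf'.2.symm)]⟩
  · have h3 := h1.down e he
    have k2 := key.2
    rw [ne_eq, ← k2]
    exact ⟨fun h => ⟨e, h, h3⟩, fun ⟨f, hf, hf'⟩ => by
      rwa [edge_ext (h3.1.trans hf'.1.symm) (h3.2.trans hf'.2.symm)]⟩
  · obtain ⟨e, _, h3, h4⟩ := key.1.2 hc
    have := h1.of_src e h3 (h4 ▸ h1.p_mem)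
    simp [he] at this
  · obtain ⟨e, _, h3, h4⟩ := key.2.2 hc
    have := h1.of_dst e h4 (h3 ▸ h1.p_mem)
    simp [he] at this

end DiGraph

/-! ### Values -/

open scoped ENNReal

/-- The cost of placing the items in `J` with the demands `d` on an element with the given capacity
and cost vectors; infinite if the capacity does not suffice. -/
noncomputable def loadVal {m τ : ℕ} (d : Fin m → Fin τ → ℝ≥0) (cap cost : Fin τ → ℝ≥0)
    (J : Finset (Fin m)) : ℝ≥0∞ :=
  ∑ k, if ∑ j ∈ J, d j k ≤ cap k then (((∑ j ∈ J, d j k) * cost k : ℝ≥0) : ℝ≥0∞) else ⊤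

section loadVal

variable {m τ : ℕ} {d : Fin m → Fin τ → ℝ≥0} {cap cost : Fin τ → ℝ≥0} {J : Finset (Fin m)}

theorem loadVal_of_le (h : ∑ j ∈ J, d j ≤ cap) :
    loadVal d cap cost J = ((∑ j ∈ J, dotProduct (d j) cost : ℝ≥0) : ℝ≥0∞) := by
  have h' : ∀ k, ∑ j ∈ J, d j k ≤ cap k := fun k => by simpa using h k
  unfold loadVal
  simp only [h', if_true, dotProduct]
  rw [← ENNReal.ofNNReal_finsetSum, Finset.sum_comm]
  simp only [Finset.sum_mul]

theorem loadVal_of_not_le (h : ¬ ∑ j ∈ J, d j ≤ cap) : loadVal d cap cost J = ⊤ := by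
  rw [Pi.le_def, not_forall] at h
  obtain ⟨k, hk⟩ := h
  unfold loadVal
  rw [ENNReal.sum_eq_top]
  exact ⟨k, Finset.mem_univ _, if_neg (by simpa using hk)⟩

end loadVal

/-! ### Costs of nodes, links and cuts, and the total value of a node mapping -/

namespace Inst

variable {τ r s : ℕ} (I : Inst τ r s)

/-- The cost of placing the set `S` of request nodes on the substrate node `x`. -/
noncomputable def nodeVal (x : Fin s) (S : Finset (Fin r)) : ℝ≥0∞ :=
  loadVal I.nodeDemand (I.nodeCap x) (I.nodeCost x) S

/-- The cost of sending the set `J` of request edges through a substrate edge that may be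
missing. -/
noncomputable def linkVal (o : Option (Fin I.substrate.size)) (J : Finset (Fin I.request.size)) :
    ℝ≥0∞ :=
  match o with
  | none => if J = ∅ then 0 else ⊤
  | some e => loadVal I.edgeDemand (I.edgeCap e) (I.edgeCost e) J

/-- The request edges that leave `S`. -/
def leaving (S : Finset (Fin r)) : Finset (Fin I.request.size) :=
  {e | I.request.src e ∈ S ∧ I.request.dst e ∉ S}

/-- The request edges that enter `S`. -/
def entering (S : Finset (Fin r)) : Finset (Fin I.request.size) :=
  {e | I.request.src e ∉ S ∧ I.request.dst e ∈ S}

/-- The cost on the edges between `ε.v` and `ε.p` if `S` is the set of request nodes placed in the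
part of the substrate that has been merged with `ε.v`. -/
noncomputable def cutVal (ε : Elim r s I.substrate.size) (S : Finset (Fin r)) : ℝ≥0∞ :=
  I.linkVal ε.up (I.leaving S) + I.linkVal ε.down (I.entering S)

/-- The request nodes that `b` maps to `x`. -/
def _root_.VNEP.fiber (b : Fin r → Fin s) (x : Fin s) : Finset (Fin r) := {w | b w = x}

@[simp] theorem _root_.VNEP.mem_fiber {b : Fin r → Fin s} {x : Fin s} {w : Fin r} :
    w ∈ fiber b x ↔ b w = x := by simp [fiber]

/-- The cost of the node mapping `a` on all nodes and on the edges that have been eliminated. -/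
noncomputable def total : List (Elim r s I.substrate.size) → (Fin r → Fin s) → ℝ≥0∞
  | [], a => ∑ x, I.nodeVal x (fiber a x)
  | ε :: h, a => total h a + I.cutVal ε (fiber (rep h ∘ a) ε.v)

variable {I}

/-- The request edges routed through `e'`. -/
def Mapping.through (M : I.Mapping) (e' : Fin I.substrate.size) : Finset (Fin I.request.size) :=
  {e | e' ∈ M.edge e}

/-- Induction on the eliminations. Each one takes exactly `ε.up` and `ε.down` out of the remaining
graph, and by `path_cut` the request edges that leave or enter the part are those routed through
these links. A missing link contributes `0`, because the given paths show that no request edge needs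
it. -/
theorem total_eq {M : I.Mapping}
    (hM : ∀ e, I.substrate.IsPath (M.node (I.request.src e)) (M.node (I.request.dst e)) (M.edge e)) :
    ∀ {h : List (Elim r s I.substrate.size)}, I.substrate.Legal h →
      I.total h M.node = ∑ x, I.nodeVal x (fiber M.node x) +
        ∑ e' with ¬ (I.substrate.src e' ∈ alive h ∧ I.substrate.dst e' ∈ alive h),
          I.linkVal (some e') (M.through e')
  | [], _ => by simp [total, alive]
  | ε :: h, ⟨h1, h2⟩ => by
    rw [total, total_eq hM h2, add_assoc]
    congr 1
    have hup : I.linkVal ε.up (I.leaving (fiber (rep h ∘ M.node) ε.v)) =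
        ∑ e' ∈ ε.up.toFinset, I.linkVal (some e') (M.through e') := by
      cases hu : ε.up with
      | none =>
        have : I.leaving (fiber (rep h ∘ M.node) ε.v) = ∅ := by
          ext e
          have := (h1.path_cut h2 (hM e)).2.2.1 hu
          simpa [leaving] using this
        simp [linkVal, this]
      | some e' =>
        have : I.leaving (fiber (rep h ∘ M.node) ε.v) = M.through e' := by
          ext e
          have := (h1.path_cut h2 (hM e)).1 e' hu
          simp [leaving, Mapping.through, this]
        simp [this]
    have hdown : I.linkVal ε.down (I.entering (fiber (rep h ∘ M.node) ε.v)) =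
        ∑ e' ∈ ε.down.toFinset, I.linkVal (some e') (M.through e') := by
      cases hu : ε.down with
      | none =>
        have : I.entering (fiber (rep h ∘ M.node) ε.v) = ∅ := by
          ext e
          have := (h1.path_cut h2 (hM e)).2.2.2 hu
          simpa [entering] using this
        simp [linkVal, this]
      | some e' =>
        have : I.entering (fiber (rep h ∘ M.node) ε.v) = M.through e' := by
          ext e
          have := (h1.path_cut h2 (hM e)).2.1 e' hu
          simp [entering, Mapping.through, this]
        simp [this]
    -- The sums are over disjoint sets: both links had two remaining ends before this elimination,
    -- and they differ from each other in their sources.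
    rw [cutVal, hup, hdown, ← Finset.sum_union, ← Finset.sum_union]
    · refine Finset.sum_congr ?_ fun _ _ => rfl
      ext e
      simp only [Finset.mem_union, Finset.mem_filter, Finset.mem_univ, true_and,
        Option.mem_toFinset, Option.mem_def, alive, Finset.mem_erase]
      have a1 := h1.of_src e
      have a2 := h1.of_dst e
      have a3 := h1.up e
      have a4 := h1.down e
      constructor
      · rintro (h | h | h)
        · tauto
        · have := a3 h; tauto
        · have := a4 h; tauto
      · tauto
    · rw [Finset.disjoint_left]
      intro e he
      simp only [Finset.mem_filter, Finset.mem_univ, true_and] at he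
      simp only [Finset.mem_union, Option.mem_toFinset, Option.mem_def, not_or]
      refine ⟨fun h => he ?_, fun h => he ?_⟩
      · rw [(h1.up e h).1, (h1.up e h).2]; exact ⟨h1.v_mem, h1.p_mem⟩
      · rw [(h1.down e h).1, (h1.down e h).2]; exact ⟨h1.p_mem, h1.v_mem⟩
    · rw [Finset.disjoint_left]
      intro e he he'
      simp only [Option.mem_toFinset, Option.mem_def] at he he'
      exact h1.ne ((h1.up e he).1.symm.trans (h1.down e he').1)

/-- After all eliminations, the total value of a node mapping with a path for every request edge
is the cost if the mapping is feasible, and infinite otherwise. -/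
theorem total_final {M : I.Mapping}
    (hM : ∀ e, I.substrate.IsPath (M.node (I.request.src e)) (M.node (I.request.dst e)) (M.edge e))
    (hl : ∀ e, I.substrate.src e ≠ I.substrate.dst e)
    {h : List (Elim r s I.substrate.size)} (hh : I.substrate.Legal h) {root : Fin s}
    (hr : alive h = {root}) :
    (M.Feasible → I.total h M.node = M.cost) ∧ (I.total h M.node ≠ ⊤ → M.Feasible) := by
  have key : I.total h M.node = ∑ x, I.nodeVal x (fiber M.node x) +
      ∑ e', I.linkVal (some e') (M.through e') := by
    -- With a single node left and no loops, every substrate edge has been accounted for.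
    rw [total_eq hM hh, Finset.filter_true_of_mem]
    rintro e - ⟨h1, h2⟩
    rw [hr, Finset.mem_singleton] at h1 h2
    exact hl e (h1.trans h2.symm)
  constructor
  · intro hF
    have h1 : ∀ x, I.nodeVal x (fiber M.node x) =
        ((∑ w ∈ fiber M.node x, dotProduct (I.nodeDemand w) (I.nodeCost (M.node w)) : ℝ≥0) : ℝ≥0∞) := by
      intro x
      rw [nodeVal, loadVal_of_le (J := fiber M.node x) (hF.node_sum_le x)]
      congr 1
      refine Finset.sum_congr rfl fun w hw => ?_
      rw [mem_fiber.1 hw]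
    have h2 : ∀ e', I.linkVal (some e') (M.through e') =
        ((∑ e ∈ M.through e', dotProduct (I.edgeDemand e) (I.edgeCost e') : ℝ≥0) : ℝ≥0∞) := by
      intro e'
      rw [linkVal, loadVal_of_le (J := M.through e') (hF.edge_sum_le e')]
    rw [key]
    simp only [h1, h2]
    rw [← ENNReal.ofNNReal_finsetSum, ← ENNReal.ofNNReal_finsetSum, ← ENNReal.coe_add, ENNReal.coe_inj,
      Mapping.cost]
    congr 1
    · exact Finset.sum_fiberwise _ _ _
    · have h3 : ∀ e, ((M.edge e).map fun e' => dotProduct (I.edgeDemand e) (I.edgeCost e')).sum =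
          ∑ e' with e' ∈ M.edge e, dotProduct (I.edgeDemand e) (I.edgeCost e') := by
        intro e
        -- A path repeats no node, hence no edge, so the list sum in `Mapping.cost` is a sum over a
        -- set of edges.
        have hnd : (M.edge e).Nodup :=
          List.Nodup.of_map _ (List.nodup_cons.1 (hM e).2).2
        rw [← List.sum_toFinset _ hnd]
        refine Finset.sum_congr ?_ fun _ _ => rfl
        ext; simp
      simp only [h3, Mapping.through]
      exact Finset.sum_comm' (by simp)
  · intro hT
    rw [key, ENNReal.add_ne_top, ENNReal.sum_ne_top, ENNReal.sum_ne_top] at hT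
    have h1 : ∀ x, ∑ w with M.node w = x, I.nodeDemand w ≤ I.nodeCap x := fun x => by
      by_contra hc
      exact hT.1 x (Finset.mem_univ _) (loadVal_of_not_le hc)
    have h2 : ∀ e', ∑ e with e' ∈ M.edge e, I.edgeDemand e ≤ I.edgeCap e' := fun e' => by
      by_contra hc
      exact hT.2 e' (Finset.mem_univ _) (loadVal_of_not_le hc)
    refine ⟨⟨hM, fun w => ?_, fun e e' he => ?_⟩, h1, h2⟩
    · refine le_trans ?_ (h1 (M.node w))
      exact Finset.single_le_sum (f := I.nodeDemand) (fun _ _ => zero_le) (by simp)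
    · refine le_trans ?_ (h2 e')
      exact Finset.single_le_sum (f := I.edgeDemand) (fun _ _ => zero_le) (by simpa using he)

end Inst

end VNEP

namespace VNEP

open Elim
open scoped ENNReal

/-! ### The dynamic program -/

section Decode

variable {r s m : ℕ}

/-- Undo one elimination in a node mapping. -/
def Elim.undo (ε : Elim r s m) (b : Fin r → Fin s) (w : Fin r) : Fin s :=
  if b w = ε.p ∧ w ∈ ε.ch (fiber b ε.p) then ε.v else b w

/-- Undo eliminations in a node mapping. -/
def decode : List (Elim r s m) → (Fin r → Fin s) → Fin r → Fin s
  | [], b => b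
  | ε :: h, b => decode h (ε.undo b)

variable {ε : Elim r s m} {b : Fin r → Fin s}

/-- Undoing `ε` splits the set at `ε.p` in two and moves no other request node. This lemma and the
next two give the three kinds of fibers that result. -/
theorem Elim.fiber_undo_v (hch : ∀ S, ε.ch S ⊆ S) (hb : ∀ w, b w ≠ ε.v) :
    fiber (ε.undo b) ε.v = ε.ch (fiber b ε.p) := by
  ext w
  simp only [mem_fiber, undo]
  constructor
  · intro h
    split at h
    · rename_i h'; exact h'.2
    · exact absurd h (hb w)
  · intro h
    rw [if_pos ⟨mem_fiber.1 (hch _ h), h⟩]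

theorem Elim.fiber_undo_p (hne : ε.v ≠ ε.p) :
    fiber (ε.undo b) ε.p = fiber b ε.p \ ε.ch (fiber b ε.p) := by
  ext w
  simp only [mem_fiber, undo, Finset.mem_sdiff]
  constructor
  · intro h
    split at h
    · exact absurd h hne
    · rename_i h'; exact ⟨h, fun hw => h' ⟨h, hw⟩⟩
  · rintro ⟨h, hw⟩
    rw [if_neg (fun h' => hw h'.2), h]

theorem Elim.fiber_undo_of_ne {x : Fin s} (hp : x ≠ ε.p) (hv : x ≠ ε.v) :
    fiber (ε.undo b) x = fiber b x := by
  ext w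
  simp only [mem_fiber, undo]
  split
  · rename_i h
    simp [h.1, hp.symm, hv.symm]
  · rfl

theorem DiGraph.CanElim.undo_mem {G : DiGraph s} {h : List (Elim r s G.size)}
    {ε : Elim r s G.size} (hε : G.CanElim h ε) (hb : ∀ w, b w ∈ alive (ε :: h)) (w : Fin r) :
    ε.undo b w ∈ alive h := by
  unfold undo
  split
  · exact hε.v_mem
  · exact (Finset.mem_erase.1 (hb w)).2

end Decode

namespace Inst

variable {τ r s : ℕ} (I : Inst τ r s)

/-- `G x S` is the minimum cost of placing `S` in the part of the substrate that has been merged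
with `x`, and the choices that were recorded attain the minimum. -/
structure Good (h : List (Elim r s I.substrate.size)) (G : Fin s → Finset (Fin r) → ℝ≥0∞) :
    Prop where
  le : ∀ a, ∑ x ∈ alive h, G x (fiber (rep h ∘ a) x) ≤ I.total h a
  ge : ∀ b, (∀ w, b w ∈ alive h) → rep h ∘ decode h b = b ∧
    I.total h (decode h b) ≤ ∑ x ∈ alive h, G x (fiber b x)

variable {I}

theorem good_nil : I.Good [] I.nodeVal where
  le a := le_of_eq <| by simp only [alive, total]; rfl
  ge b _ := ⟨rfl, le_of_eq <| by simp only [alive, total, decode]⟩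

/-- The recursion of the dynamic program. For the lower bound, `T` is the set that the given mapping
`a` places in the part of `ε.v`, and `h2` applies to it. For the upper bound, a mapping into the
remaining nodes is split by the recorded choice, which attains the value by `h4`. In both halves the
sums over the remaining nodes differ only at `ε.v` and `ε.p`. -/
theorem Good.step {h : List (Elim r s I.substrate.size)} {G G' : Fin s → Finset (Fin r) → ℝ≥0∞}
    {ε : Elim r s I.substrate.size} (hG : I.Good h G) (hε : I.substrate.CanElim h ε)
    (h1 : ∀ x, x ≠ ε.p → x ≠ ε.v → G' x = G x)
    (h2 : ∀ S T, T ⊆ S → G' ε.p S ≤ G ε.p (S \ T) + (G ε.v T + I.cutVal ε T))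
    (h3 : ∀ S, ε.ch S ⊆ S)
    (h4 : ∀ S, G ε.p (S \ ε.ch S) + (G ε.v (ε.ch S) + I.cutVal ε (ε.ch S)) ≤ G' ε.p S) :
    I.Good (ε :: h) G' := by
  have hp : ε.p ∈ (alive h).erase ε.v := Finset.mem_erase.2 ⟨hε.ne.symm, hε.p_mem⟩
  refine ⟨fun a => ?_, fun b hb => ?_⟩
  · have e1 : fiber (rep (ε :: h) ∘ a) ε.p \ fiber (rep h ∘ a) ε.v = fiber (rep h ∘ a) ε.p := by
      ext w
      simp only [Finset.mem_sdiff, mem_fiber, Function.comp, rep]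
      have := hε.ne
      by_cases hw : rep h (a w) = ε.v <;> simp [hw, this]
    have e2 : fiber (rep h ∘ a) ε.v ⊆ fiber (rep (ε :: h) ∘ a) ε.p := by
      intro w
      simp only [mem_fiber, Function.comp, rep]
      intro hw; simp [hw]
    have e3 : ∀ x ∈ ((alive h).erase ε.v).erase ε.p,
        G' x (fiber (rep (ε :: h) ∘ a) x) = G x (fiber (rep h ∘ a) x) := by
      intro x hx
      simp only [Finset.mem_erase] at hx
      rw [h1 x hx.1 hx.2.1]
      congr 1
      ext w
      simp only [mem_fiber, Function.comp, rep]
      by_cases hw : rep h (a w) = ε.v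
      · simp [hw, hx.1.symm, hx.2.1.symm]
      · simp [hw]
    have h2' := h2 _ _ e2
    rw [e1] at h2'
    have hle := hG.le a
    rw [← Finset.add_sum_erase _ _ hε.v_mem, ← Finset.add_sum_erase _ _ hp] at hle
    simp only [alive]
    rw [← Finset.add_sum_erase _ _ hp, Finset.sum_congr rfl e3, total]
    refine (add_le_add_left h2' _).trans ?_
    refine le_trans (le_of_eq ?_) (add_le_add_left hle _)
    ring
  · have hbv : ∀ w, b w ≠ ε.v := fun w => (Finset.mem_erase.1 (hb w)).1
    have e1 := fiber_undo_v h3 hbv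
    have e2 := fiber_undo_p (b := b) hε.ne
    have e3 : ∀ x ∈ ((alive h).erase ε.v).erase ε.p,
        G' x (fiber b x) = G x (fiber (ε.undo b) x) := by
      intro x hx
      simp only [Finset.mem_erase] at hx
      rw [h1 x hx.1 hx.2.1, fiber_undo_of_ne hx.1 hx.2.1]
    obtain ⟨g1, g2⟩ := hG.ge (ε.undo b) (hε.undo_mem hb)
    have g1' : ∀ w, rep h (decode h (ε.undo b) w) = ε.undo b w := fun w => congrFun g1 w
    constructor
    · funext w
      simp only [Function.comp, decode, rep, g1']
      split
      · rename_i h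
        have : w ∈ fiber b ε.p := h3 _ (e1 ▸ mem_fiber.2 h)
        exact (mem_fiber.1 this).symm
      · rename_i h
        simp only [undo] at h ⊢
        split
        · rename_i h'; simp [h'] at h
        · rfl
    · rw [decode, total, g1, e1]
      simp only [alive]
      rw [← Finset.add_sum_erase _ _ hp, Finset.sum_congr rfl e3]
      rw [← Finset.add_sum_erase _ _ hε.v_mem, ← Finset.add_sum_erase _ _ hp, e1, e2] at g2
      refine (add_le_add_left g2 _).trans ?_
      refine le_trans (le_of_eq ?_) (add_le_add_left (h4 (fiber b ε.p)) _)
      ring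

end Inst

/-! ### Routes -/

namespace Elim

variable {r s m : ℕ}

/-- The number of eliminations before that of a given node, and `s` for the last node. -/
def rank : List (Elim r s m) → Fin s → ℕ
  | [], _ => s
  | ε :: h, x => if x = ε.v then h.length else rank h x

theorem alive_subset {h h' : List (Elim r s m)} (hs : h' <:+ h) : alive h ⊆ alive h' := by
  obtain ⟨l, rfl⟩ := hs
  induction l with
  | nil => rfl
  | cons ε l ih => exact (Finset.erase_subset _ _).trans ih

theorem rep_congr {h h' : List (Elim r s m)} (hs : h' <:+ h) {x y : Fin s}
    (hxy : rep h' x = rep h' y) : rep h x = rep h y := by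
  obtain ⟨l, rfl⟩ := hs
  induction l with
  | nil => exact hxy
  | cons ε l ih => simp only [List.cons_append, rep, ih]

theorem exists_of_not_mem : ∀ {h : List (Elim r s m)} {x : Fin s}, x ∉ alive h →
    ∃ ε h', ε :: h' <:+ h ∧ ε.v = x
  | [], x, hx => by simp [alive] at hx
  | ε :: h, x, hx => by
    by_cases hv : ε.v = x
    · exact ⟨ε, h, List.suffix_rfl, hv⟩
    · have : x ∉ alive h := fun h' => hx (Finset.mem_erase.2 ⟨fun h => hv h.symm, h'⟩)
      obtain ⟨δ, h', h1, h2⟩ := exists_of_not_mem this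
      exact ⟨δ, h', h1.trans (List.suffix_cons _ _), h2⟩

end Elim

namespace DiGraph

variable {r s : ℕ} {G : DiGraph s}

theorem Legal.suffix {h h' : List (Elim r s G.size)} (hh : G.Legal h) (hs : h' <:+ h) :
    G.Legal h' := by
  obtain ⟨l, rfl⟩ := hs
  induction l with
  | nil => exact hh
  | cons ε l ih => exact ih hh.2

theorem Legal.card : ∀ {h : List (Elim r s G.size)}, G.Legal h → (alive h).card + h.length = s
  | [], _ => by simp [alive]
  | ε :: h, ⟨h1, h2⟩ => by
    have := h2.card
    rw [alive, Finset.card_erase_of_mem h1.v_mem, List.length_cons]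
    have := Finset.card_pos.2 ⟨_, h1.v_mem⟩
    omega

theorem _root_.VNEP.Elim.rank_of_mem_alive {m : ℕ} : ∀ {h : List (Elim r s m)} {x : Fin s},
    x ∈ alive h → rank h x = s
  | [], _, _ => rfl
  | ε :: h, x, hx => by
    simp only [alive, Finset.mem_erase] at hx
    rw [rank, if_neg hx.1, rank_of_mem_alive hx.2]

theorem _root_.VNEP.Elim.rank_lt {m : ℕ} : ∀ {h : List (Elim r s m)} {x : Fin s},
    x ∉ alive h → rank h x < h.length
  | [], x, hx => by simp [alive] at hx
  | ε :: h, x, hx => by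
    rw [rank, List.length_cons]
    split
    · omega
    · have := rank_lt (h := h) (x := x) fun h' => hx (Finset.mem_erase.2 ⟨‹_›, h'⟩)
      omega

/-- The rank is the time of elimination, so after `h'` precisely the nodes of rank below `h'.length`
are gone. The value `s` for a remaining node exceeds all other ranks, since there are at most `s`
eliminations. -/
theorem Legal.mem_alive_iff {h h' : List (Elim r s G.size)} (hh : G.Legal h) (hs : h' <:+ h)
    {x : Fin s} : x ∈ alive h' ↔ h'.length ≤ rank h x := by
  obtain ⟨l, rfl⟩ := hs
  induction l with
  | nil =>
    have := hh.card
    rw [List.nil_append] at this ⊢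
    constructor
    · intro hx
      rw [rank_of_mem_alive hx]; omega
    · intro hx
      by_contra hc
      have := rank_lt hc
      omega
  | cons ε l ih =>
    rw [List.cons_append, rank]
    split
    · rename_i hx
      simp only [hx, alive_subset (List.suffix_append _ _) hh.1.v_mem, true_iff]
      simp
    · exact ih hh.2

variable {h : List (Elim r s G.size)}

theorem Legal.rank_v (hh : G.Legal h) {ε : Elim r s G.size} {h' : List (Elim r s G.size)}
    (hs : ε :: h' <:+ h) : rank h ε.v = h'.length := by
  have h1 := (hh.mem_alive_iff ((List.suffix_cons ε h').trans hs)).1 (hh.suffix hs).1.v_mem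
  have h2 := mt (hh.mem_alive_iff (x := ε.v) hs).2 (by simp [alive])
  rw [List.length_cons] at h2
  omega

theorem Legal.rank_p (hh : G.Legal h) {ε : Elim r s G.size} {h' : List (Elim r s G.size)}
    (hs : ε :: h' <:+ h) : h'.length < rank h ε.p :=
  (hh.mem_alive_iff hs).1
    (Finset.mem_erase.2 ⟨(hh.suffix hs).1.ne.symm, (hh.suffix hs).1.p_mem⟩)

theorem Legal.rank_le (hh : G.Legal h) (x : Fin s) : rank h x ≤ s := by
  by_cases hx : x ∈ alive h
  · exact (rank_of_mem_alive hx).le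
  · have := rank_lt hx
    have := hh.card
    omega

/-- The route from `x` to `y`: of the two nodes, the one that was eliminated first is replaced by
the node with which it was merged. -/
inductive Route (G : DiGraph s) (h : List (Elim r s G.size)) :
    Fin s → Fin s → List (Fin G.size) → Prop
  | nil (x : Fin s) : Route G h x x []
  | up {ε : Elim r s G.size} {h' : List (Elim r s G.size)} {y : Fin s} {e : Fin G.size}
      {q : List (Fin G.size)} (hs : ε :: h' <:+ h) (hr : rank h ε.v < rank h y)
      (he : ε.up = some e) (hq : Route G h ε.p y q) : Route G h ε.v y (e :: q)
  | down {ε : Elim r s G.size} {h' : List (Elim r s G.size)} {x : Fin s} {e : Fin G.size}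
      {q : List (Fin G.size)} (hs : ε :: h' <:+ h) (hr : rank h ε.v < rank h x)
      (he : ε.down = some e) (hq : Route G h x ε.p q) : Route G h x ε.v (q ++ [e])

/-- The node added last has smaller rank than the opposite end and than the node it was merged with,
whereas every node of the shorter route has at least the smaller of these two ranks. Hence it does
not occur there. The rank bound is part of the conclusion for the sake of this induction. -/
theorem Route.isPath (hh : G.Legal h) {x y : Fin s} {q : List (Fin G.size)}
    (hq : G.Route h x y q) : G.IsPath x y q ∧
      ∀ z ∈ x :: q.map G.dst, min (rank h x) (rank h y) ≤ rank h z := by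
  induction hq with
  | nil x => simp [IsPath, IsWalk]
  | @up ε h' y e q hs hr he hq ih =>
    obtain ⟨⟨w, nd⟩, hm⟩ := ih
    obtain ⟨e1, e2⟩ := (hh.suffix hs).1.up e he
    have r1 := hh.rank_v hs
    have r2 := hh.rank_p hs
    have hlt : ∀ z ∈ ε.p :: q.map G.dst, rank h ε.v < rank h z := fun z hz =>
      lt_of_lt_of_le (lt_min (by omega) hr) (hm z hz)
    refine ⟨⟨⟨e1, e2.symm ▸ w⟩, ?_⟩, ?_⟩
    · rw [List.map_cons, e2, List.nodup_cons]
      exact ⟨fun hz => lt_irrefl _ (hlt _ hz), nd⟩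
    · intro z hz
      rw [List.map_cons, e2] at hz
      rcases List.mem_cons.1 hz with rfl | hz
      · exact min_le_left _ _
      · exact (min_le_left _ _).trans (hlt z hz).le
  | @down ε h' x e q hs hr he hq ih =>
    obtain ⟨⟨w, nd⟩, hm⟩ := ih
    obtain ⟨e1, e2⟩ := (hh.suffix hs).1.down e he
    have r1 := hh.rank_v hs
    have r2 := hh.rank_p hs
    have hlt : ∀ z ∈ x :: q.map G.dst, rank h ε.v < rank h z := fun z hz =>
      lt_of_lt_of_le (lt_min hr (by omega)) (hm z hz)
    have hl : x :: (q ++ [e]).map G.dst = (x :: q.map G.dst) ++ [ε.v] := by simp [e2]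
    refine ⟨⟨w.append ⟨e1, e2⟩, ?_⟩, ?_⟩
    · rw [hl, List.nodup_append]
      refine ⟨nd, by simp, ?_⟩
      rintro z hz _ hz' rfl
      rw [List.mem_singleton.1 hz'] at hz
      exact lt_irrefl _ (hlt _ hz)
    · intro z hz
      rw [hl, List.mem_append, List.mem_singleton] at hz
      rcases hz with hz | rfl
      · exact (min_le_right _ _).trans (hlt z hz).le
      · exact min_le_right _ _

theorem IsPath.length_lt {x y : Fin s} {q : List (Fin G.size)} (hq : G.IsPath x y q) :
    q.length < s := by
  have := hq.2.length_le_card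
  simp at this
  omega

/-- The hypotheses say that a link is present whenever `x` and `y` lie on the two sides of its cut
in the matching direction. Climbing from the end of smaller rank uses one such link, and the
hypotheses pass to the parent; the ranks increase towards `s`, which ends the induction. -/
theorem exists_route (hh : G.Legal h) {root : Fin s} (hr : alive h = {root}) (x y : Fin s)
    (hup : ∀ ε h', ε :: h' <:+ h → rep h' x = ε.v → rep h' y ≠ ε.v → ε.up ≠ none)
    (hdown : ∀ ε h', ε :: h' <:+ h → rep h' x ≠ ε.v → rep h' y = ε.v → ε.down ≠ none) :
    ∃ q, G.Route h x y q := by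
  -- A node of larger rank survives the elimination `δ`, so it is its own representative and lies
  -- outside the part of `δ.v`.
  have key : ∀ {z : Fin s} {δ h''}, δ :: h'' <:+ h → h''.length < rank h z →
      rep h'' z = z ∧ z ≠ δ.v := by
    intro z δ h'' hs hz
    have h1 := (hh.mem_alive_iff hs).2 hz
    simp only [alive, Finset.mem_erase] at h1
    exact ⟨rep_eq_self h1.2, h1.1⟩
  -- Once `ε` has been carried out, `ε.v` and `ε.p` have the same representative forever.
  have key' : ∀ {ε δ : Elim r s G.size} {h' h'' : List (Elim r s G.size)}, ε :: h' <:+ h →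
      δ :: h'' <:+ h → h'.length < h''.length → rep h'' ε.v = rep h'' ε.p := by
    intro ε δ h' h'' hs hs' hl
    have h1 : ε :: h' <:+ h'' := List.suffix_of_suffix_length_le hs
      ((List.suffix_cons δ h'').trans hs') hl
    have hc := (hh.suffix hs).1
    refine rep_congr h1 ?_
    rw [rep, rep, rep_eq_self hc.v_mem, rep_eq_self hc.p_mem]
    simp
  induction hn : (s - rank h x) + (s - rank h y) using Nat.strong_induction_on generalizing x y with
  | _ n ih =>
  subst hn
  have hrx := hh.rank_le x
  have hry := hh.rank_le y
  have hex : ∀ z, rank h z < s → ∃ ε h', ε :: h' <:+ h ∧ ε.v = z := fun z hz =>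
    exists_of_not_mem fun hm => by rw [rank_of_mem_alive hm] at hz; exact lt_irrefl _ hz
  rcases lt_trichotomy (rank h x) (rank h y) with hlt | heq | hlt
  · obtain ⟨ε, h', hs, rfl⟩ := hex x (by omega)
    have r1 := hh.rank_v hs
    have r2 := hh.rank_p hs
    have r3 := hh.rank_le ε.p
    have hne : ε.up ≠ none := by
      have := key hs (r1 ▸ hlt)
      refine hup ε h' hs (rep_eq_self (hh.suffix hs).1.v_mem) ?_
      rw [this.1]; exact this.2
    obtain ⟨e, he⟩ := Option.ne_none_iff_exists'.1 hne
    -- Eliminations after `ε` do not distinguish `ε.v` from `ε.p`. At `ε` and before, `ε.p` and `y`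
    -- both lie outside the part that is merged, so nothing is required there.
    obtain ⟨q, hq⟩ := ih _ (by omega) ε.p y (fun δ h'' hs' h1 h2 => by
        rcases lt_or_ge h'.length h''.length with hl | hl
        · rw [← key' hs hs' hl] at h1
          exact hup δ h'' hs' h1 h2
        · have := key hs' (z := ε.p) (by omega)
          exact absurd (this.1.symm.trans h1) this.2)
      (fun δ h'' hs' h1 h2 => by
        rcases lt_or_ge h'.length h''.length with hl | hl
        · rw [← key' hs hs' hl] at h1
          exact hdown δ h'' hs' h1 h2
        · have := key hs' (z := y) (by omega)
          exact absurd (this.1.symm.trans h2) this.2) rfl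
    exact ⟨_, .up hs hlt he hq⟩
  -- An eliminated node is determined by its position in `h`, and the root is the only node of rank
  -- `s`; so equal ranks mean equal nodes.
  · suffices x = y from ⟨[], this ▸ .nil x⟩
    by_cases hx : rank h x < s
    · obtain ⟨ε, h', hs, rfl⟩ := hex x hx
      obtain ⟨δ, h'', hs', rfl⟩ := hex y (by omega)
      rw [hh.rank_v hs, hh.rank_v hs'] at heq
      have h1 := List.suffix_of_suffix_length_le hs hs' (by simp [heq])
      have h2 := h1.eq_of_length (by simp [heq])
      rw [List.cons.injEq] at h2
      rw [h2.1]
    · have hm : ∀ z, rank h z = s → z = root := fun z hz => by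
        have := hh.card
        have hz := (hh.mem_alive_iff (x := z) List.suffix_rfl).2 (by omega)
        rwa [hr, Finset.mem_singleton] at hz
      rw [hm x (by omega), hm y (by omega)]
  · obtain ⟨ε, h', hs, rfl⟩ := hex y (by omega)
    have r1 := hh.rank_v hs
    have r2 := hh.rank_p hs
    have r3 := hh.rank_le ε.p
    have hne : ε.down ≠ none := by
      have := key hs (r1 ▸ hlt)
      refine hdown ε h' hs ?_ (rep_eq_self (hh.suffix hs).1.v_mem)
      rw [this.1]; exact this.2
    obtain ⟨e, he⟩ := Option.ne_none_iff_exists'.1 hne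
    obtain ⟨q, hq⟩ := ih _ (by omega) x ε.p (fun δ h'' hs' h1 h2 => by
        rcases lt_or_ge h'.length h''.length with hl | hl
        · rw [← key' hs hs' hl] at h2
          exact hup δ h'' hs' h1 h2
        · have := key hs' (z := x) (by omega)
          exact absurd (this.1.symm.trans h1) this.2)
      (fun δ h'' hs' h1 h2 => by
        rcases lt_or_ge h'.length h''.length with hl | hl
        · rw [← key' hs hs' hl] at h2
          exact hdown δ h'' hs' h1 h2
        · have := key hs' (z := ε.p) (by omega)
          exact absurd (this.1.symm.trans h2) this.2) rfl
    exact ⟨_, .down hs hlt he hq⟩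

end DiGraph

namespace Inst

variable {τ r s : ℕ} {I : Inst τ r s}

theorem total_suffix {h h' : List (Elim r s I.substrate.size)} (hs : h' <:+ h)
    (a : Fin r → Fin s) : I.total h' a ≤ I.total h a := by
  obtain ⟨l, rfl⟩ := hs
  induction l with
  | nil => rfl
  | cons ε l ih => exact ih.trans le_self_add

/-- If a node mapping has a finite value, then there is a route for every request edge. -/
theorem exists_route_of_total_ne_top {h : List (Elim r s I.substrate.size)}
    (hh : I.substrate.Legal h) {root : Fin s} (hr : alive h = {root}) {a : Fin r → Fin s}
    (ha : I.total h a ≠ ⊤) (e : Fin I.request.size) :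
    ∃ q, I.substrate.Route h (a (I.request.src e)) (a (I.request.dst e)) q := by
  refine DiGraph.exists_route hh hr _ _ (fun ε h' hs h1 h2 h3 => ?_) fun ε h' hs h1 h2 h3 => ?_ <;>
    have ht := ne_top_of_le_ne_top ha (total_suffix hs a) <;>
    rw [total, ENNReal.add_ne_top, cutVal, ENNReal.add_ne_top, h3] at ht
  · have : e ∈ I.leaving (fiber (rep h' ∘ a) ε.v) := by simp [leaving, h1, h2]
    exact ht.2.1 (by rw [linkVal, if_neg (Finset.ne_empty_of_mem this)])
  · have : e ∈ I.entering (fiber (rep h' ∘ a) ε.v) := by simp [entering, h1, h2]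
    exact ht.2.2 (by rw [linkVal, if_neg (Finset.ne_empty_of_mem this)])

end Inst

end VNEP

namespace VNEP

open Elim

/-! ### Sets of request nodes as numbers -/

section Masks

variable {r : ℕ}

/-- The number whose binary digits describe the set `F`. -/
def enc (F : Finset (Fin r)) : ℕ := ∑ w ∈ F, 2 ^ (w : ℕ)

theorem enc_lt_of {F : Finset (Fin r)} {i : ℕ} (h : ∀ w ∈ F, (w : ℕ) < i) : enc F < 2 ^ i := by
  have := Nat.geomSum_lt (m := 2) (n := i) (s := F.map Fin.valEmbedding) le_rfl (by simpa using h)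
  simpa [enc] using this

theorem enc_lt (F : Finset (Fin r)) : enc F < 2 ^ r := enc_lt_of fun w _ => w.2

theorem enc_injective : Function.Injective (enc (r := r)) := fun F F' h => by
  have := Finset.geomSum_injective (n := 2) le_rfl (a₁ := F.map Fin.valEmbedding)
    (a₂ := F'.map Fin.valEmbedding) (by simpa [enc] using h)
  simpa using this

/-- An injection between finite sets of the same size is onto. Hence a loop over the numbers below
`2 ^ r` visits every set. -/
theorem exists_enc_eq {n : ℕ} (h : n < 2 ^ r) : ∃ F : Finset (Fin r), enc F = n := by
  have hb : Function.Bijective fun F : Finset (Fin r) => (⟨enc F, enc_lt F⟩ : Fin (2 ^ r)) := by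
    rw [Fintype.bijective_iff_injective_and_card]
    exact ⟨fun F F' h => enc_injective (by simpa using h), by simp⟩
  obtain ⟨F, hF⟩ := hb.2 ⟨n, h⟩
  exact ⟨F, by simpa using hF⟩

@[simp] theorem enc_empty : enc (∅ : Finset (Fin r)) = 0 := rfl

theorem enc_union {T U : Finset (Fin r)} (h : Disjoint T U) : enc (T ∪ U) = enc T + enc U :=
  Finset.sum_union h

theorem enc_sdiff {T S : Finset (Fin r)} (h : T ⊆ S) : enc (S \ T) + enc T = enc S :=
  Finset.sum_sdiff h

theorem enc_insert {F : Finset (Fin r)} {w : Fin r} (h : w ∉ F) :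
    enc (insert w F) = enc F + 2 ^ (w : ℕ) := by
  rw [enc, Finset.sum_insert h, add_comm]; rfl

end Masks

section Prefix

variable {m : ℕ}

/-- The indices below `n`. -/
def below (m n : ℕ) : Finset (Fin m) := {i | (i : ℕ) < n}

@[simp] theorem mem_below {n : ℕ} {i : Fin m} : i ∈ below m n ↔ (i : ℕ) < n := by simp [below]

@[simp] theorem below_zero : below m 0 = ∅ := by ext; simp

@[simp] theorem below_self : below m m = Finset.univ := by ext; simp

theorem below_succ {n : ℕ} (h : n < m) : below m (n + 1) = insert ⟨n, h⟩ (below m n) := by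
  ext i
  simp only [mem_below, Finset.mem_insert, Fin.ext_iff]
  omega

theorem sum_below_succ {M : Type*} [AddCommMonoid M] {n : ℕ} (h : n < m) (f : Fin m → M) :
    ∑ i ∈ below m (n + 1), f i = ∑ i ∈ below m n, f i + f ⟨n, h⟩ := by
  rw [below_succ h, Finset.sum_insert (by simp), add_comm]

end Prefix

/-! ### Leaves -/

namespace DiGraph

variable {r s : ℕ} {G : DiGraph s}

theorem underlying_adj {x y : Fin s} : G.underlying.Adj x y ↔
    x ≠ y ∧ ((∃ e, G.src e = x ∧ G.dst e = y) ∨ ∃ e, G.src e = y ∧ G.dst e = x) := by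
  simp [underlying]

/-- Each of the `s - 1` undirected edges underlies at most two directed ones, which are told apart
by whether `src < dst`. This makes a pass over the edge list linear in `s`. -/
theorem IsTree.size_le (hT : G.IsTree) : G.size ≤ 2 * s := by
  classical
  have h1 := hT.2.card_edgeFinset
  have hadj : ∀ e, G.underlying.Adj (G.src e) (G.dst e) := fun e =>
    underlying_adj.2 ⟨hT.1 e, .inl ⟨e, rfl, rfl⟩⟩
  have h2 : Fintype.card (Fin G.size) ≤
      (G.underlying.edgeFinset ×ˢ (Finset.univ : Finset Bool)).card := by
    rw [← Finset.card_univ]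
    refine Finset.card_le_card_of_injOn
      (fun e => (s(G.src e, G.dst e), decide (G.src e < G.dst e))) (fun e _ => by simp [hadj, lt_or_ge]) ?_
    intro e _ f _ hef
    simp only [Prod.mk.injEq, Sym2.eq_iff, decide_eq_decide] at hef
    rcases hef with ⟨⟨h1, h2⟩ | ⟨h1, h2⟩, h3⟩
    · exact edge_ext h1 h2
    · rw [h1, h2] at h3
      have := hT.1 f
      exfalso
      rcases lt_or_gt_of_ne this with h | h
      · exact lt_asymm h (h3.2 h)
      · exact lt_asymm h (h3.1 h)
  rw [Finset.card_product, Fintype.card_fin, Finset.card_univ, Fintype.card_bool] at h2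
  rw [Fintype.card_fin] at h1
  omega

/-- `v` has exactly one neighbour in the part of the graph on the node set `A`. -/
def IsLeaf (G : DiGraph s) (A : Finset (Fin s)) (v : Fin s) : Prop :=
  v ∈ A ∧ ∃ p ∈ A, G.underlying.Adj v p ∧ ∀ q ∈ A, G.underlying.Adj v q → q = p

/-- A connected induced subgraph of a tree is a tree, and a tree with at least two nodes has a node
of degree one. It serves to show that the search has not stopped too early. -/
theorem IsTree.exists_isLeaf (hT : G.IsTree) {A : Finset (Fin s)}
    (hA : (G.underlying.induce (A : Set (Fin s))).Connected) (h2 : 2 ≤ A.card) :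
    ∃ v, G.IsLeaf A v := by
  classical
  have hT' : (G.underlying.induce (A : Set (Fin s))).IsTree := ⟨hA, hT.2.isAcyclic.induce _⟩
  have : Nontrivial (A : Set (Fin s)) := by
    obtain ⟨x, hx, y, hy, hxy⟩ := Finset.one_lt_card.1 h2
    exact ⟨⟨x, hx⟩, ⟨y, hy⟩, fun h => hxy (congrArg Subtype.val h)⟩
  obtain ⟨v, hv⟩ := hT'.exists_vert_degree_one_of_nontrivial
  obtain ⟨p, hp, hu⟩ := SimpleGraph.degree_eq_one_iff_existsUnique_adj.1 hv
  exact ⟨v, v.2, p, p.2, hp, fun q hq hvq => congrArg Subtype.val (hu ⟨q, hq⟩ hvq)⟩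

/-- Deleting `v` changes the neighbourhood of its only neighbour `p` alone, so `p` is the only node
that can become a leaf. For this reason a single scan finds all leaves. -/
theorem IsLeaf.of_erase {A : Finset (Fin s)} {v p x : Fin s}
    (hv : ∀ q ∈ A, G.underlying.Adj v q → q = p) (hx : G.IsLeaf (A.erase v) x) (hxp : x ≠ p) :
    G.IsLeaf A x := by
  obtain ⟨h1, q, h2, h3, h4⟩ := hx
  rw [Finset.mem_erase] at h1 h2
  refine ⟨h1.2, q, h2.2, h3, fun z hz hxz => h4 z (Finset.mem_erase.2 ⟨?_, hz⟩) hxz⟩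
  rintro rfl
  exact hxp (hv x h1.2 hxz.symm)

/-- The map that sends `v` to `p` and fixes all other nodes takes adjacent nodes to equal or
adjacent ones, hence preserves reachability. -/
theorem connected_erase {A : Finset (Fin s)} {v p : Fin s} (hp : p ∈ A) (hvp : p ≠ v)
    (hv : ∀ q ∈ A, G.underlying.Adj v q → q = p)
    (hA : (G.underlying.induce (A : Set (Fin s))).Connected) :
    (G.underlying.induce ((A.erase v : Finset (Fin s)) : Set (Fin s))).Connected := by
  have hp' : p ∈ ((A.erase v : Finset (Fin s)) : Set (Fin s)) := by simp [hp, hvp]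
  let f : ↥(A : Set (Fin s)) → ↥((A.erase v : Finset (Fin s)) : Set (Fin s)) := fun x =>
    if hx : (x : Fin s) = v then ⟨p, hp'⟩ else ⟨x, by simp only [Finset.coe_erase]; exact ⟨x.2, hx⟩⟩
  have hf : ∀ x y, (G.underlying.induce (A : Set (Fin s))).Adj x y →
      (G.underlying.induce ((A.erase v : Finset (Fin s)) : Set (Fin s))).Reachable (f x) (f y) := by
    intro x y hxy
    have hxy' : G.underlying.Adj x y := hxy
    by_cases hx : (x : Fin s) = v
    · have hy : (y : Fin s) = p := hv y y.2 (hx ▸ hxy')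
      have : f x = f y := by
        simp only [f, hx, dif_pos]
        rw [dif_neg (by rw [hy]; exact hvp)]
        exact Subtype.ext hy.symm
      rw [this]
    · by_cases hy : (y : Fin s) = v
      · have hx' : (x : Fin s) = p := hv x x.2 (hy ▸ hxy'.symm)
        have : f x = f y := by
          simp only [f, hy, dif_pos]
          rw [dif_neg hx]
          exact Subtype.ext hx'
        rw [this]
      · refine SimpleGraph.Adj.reachable ?_
        simp only [f, hx, hy, dif_neg, not_false_eq_true]
        exact hxy'
  have hr : ∀ x y, (G.underlying.induce (A : Set (Fin s))).Reachable x y →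
      (G.underlying.induce ((A.erase v : Finset (Fin s)) : Set (Fin s))).Reachable (f x) (f y) := by
    rintro x y ⟨w⟩
    induction w with
    | nil => rfl
    | cons h _ ih => exact (hf _ _ h).trans ih
  have hne : Nonempty ((A.erase v : Finset (Fin s)) : Set (Fin s)) := ⟨⟨p, hp'⟩⟩
  refine ⟨fun x y => ?_⟩
  have hx := x.2
  have hy := y.2
  rw [Finset.mem_coe, Finset.mem_erase] at hx hy
  have := hr ⟨x, hx.2⟩ ⟨y, hy.2⟩ (hA.preconnected _ _)
  simp only [f] at this
  rwa [dif_neg hx.1, dif_neg hy.1] at this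

/-- The edges inside `A`. -/
def edgesIn (G : DiGraph s) (A : Finset (Fin s)) : Finset (Fin G.size) :=
  {e | G.src e ∈ A ∧ G.dst e ∈ A}

/-- The edges that leave `v`. -/
def outOf (E : Finset (Fin G.size)) (v : Fin s) : Finset (Fin G.size) := {e ∈ E | G.src e = v}

/-- The edges that enter `v`. -/
def into (E : Finset (Fin G.size)) (v : Fin s) : Finset (Fin G.size) := {e ∈ E | G.dst e = v}

theorem exists_option_of_card_le_one {α : Type*} {J : Finset α} (h : J.card ≤ 1) :
    ∃ o : Option α, J = o.toFinset := by
  rcases Nat.le_one_iff_eq_zero_or_eq_one.1 h with h | h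
  · exact ⟨none, by simpa using h⟩
  · obtain ⟨a, rfl⟩ := Finset.card_eq_one.1 h
    exact ⟨some a, by simp⟩

/-- Completeness of the leaf test: as there are no parallel edges, a leaf has at most one edge to
its neighbour and at most one back, and these are all its remaining edges. -/
theorem IsLeaf.card_le (hl : ∀ e, G.src e ≠ G.dst e) {A : Finset (Fin s)} {v : Fin s}
    (h : G.IsLeaf A v) :
    (outOf (G.edgesIn A) v).card ≤ 1 ∧ (into (G.edgesIn A) v).card ≤ 1 ∧
      1 ≤ (outOf (G.edgesIn A) v).card + (into (G.edgesIn A) v).card ∧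
      ∀ e f, e ∈ outOf (G.edgesIn A) v → f ∈ into (G.edgesIn A) v → G.dst e = G.src f := by
  obtain ⟨hv, p, hp, hvp, hu⟩ := h
  have h1 : ∀ e ∈ outOf (G.edgesIn A) v, G.src e = v ∧ G.dst e = p := fun e he => by
    simp only [outOf, edgesIn, Finset.mem_filter, Finset.mem_univ, true_and] at he
    exact ⟨he.2, hu _ he.1.2 (underlying_adj.2 ⟨he.2 ▸ hl e, .inl ⟨e, he.2, rfl⟩⟩)⟩
  have h2 : ∀ e ∈ into (G.edgesIn A) v, G.src e = p ∧ G.dst e = v := fun e he => by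
    simp only [into, edgesIn, Finset.mem_filter, Finset.mem_univ, true_and] at he
    exact ⟨hu _ he.1.1 (underlying_adj.2 ⟨he.2 ▸ (hl e).symm, .inr ⟨e, rfl, he.2⟩⟩), he.2⟩
  refine ⟨Finset.card_le_one.2 fun e he f hf => edge_ext ?_ ?_,
    Finset.card_le_one.2 fun e he f hf => edge_ext ?_ ?_, ?_, fun e f he hf => ?_⟩
  · rw [(h1 e he).1, (h1 f hf).1]
  · rw [(h1 e he).2, (h1 f hf).2]
  · rw [(h2 e he).1, (h2 f hf).1]
  · rw [(h2 e he).2, (h2 f hf).2]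
  · rcases (underlying_adj.1 hvp).2 with ⟨e, he, he'⟩ | ⟨e, he, he'⟩
    · have : e ∈ outOf (G.edgesIn A) v := by simp [outOf, edgesIn, he, he', hv, hp]
      have := Finset.card_pos.2 ⟨e, this⟩
      omega
    · have : e ∈ into (G.edgesIn A) v := by simp [into, edgesIn, he, he', hv, hp]
      have := Finset.card_pos.2 ⟨e, this⟩
      omega
  · rw [(h1 e he).2, (h2 f hf).1]

/-- Soundness of the leaf test: what the edge counts at `ε.v` tell already permits the elimination,
with no appeal to the tree structure. -/
theorem canElim_of_leaf (hl : ∀ e, G.src e ≠ G.dst e) {h : List (Elim r s G.size)}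
    {ε : Elim r s G.size} (hup : outOf (G.edgesIn (alive h)) ε.v = ε.up.toFinset)
    (hdown : into (G.edgesIn (alive h)) ε.v = ε.down.toFinset)
    (hne : ε.up ≠ none ∨ ε.down ≠ none) (h1 : ∀ e, ε.up = some e → G.dst e = ε.p)
    (h2 : ∀ e, ε.down = some e → G.src e = ε.p) : G.CanElim h ε := by
  have a1 : ∀ e, ε.up = some e ↔ G.src e ∈ alive h ∧ G.dst e ∈ alive h ∧ G.src e = ε.v := by
    intro e
    have : e ∈ outOf (G.edgesIn (alive h)) ε.v ↔ e ∈ ε.up.toFinset := by rw [hup]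
    simp only [outOf, edgesIn, Finset.mem_filter, Finset.mem_univ, true_and, Option.mem_toFinset,
      Option.mem_def] at this
    rw [← this]; tauto
  have a2 : ∀ e, ε.down = some e ↔ G.src e ∈ alive h ∧ G.dst e ∈ alive h ∧ G.dst e = ε.v := by
    intro e
    have : e ∈ into (G.edgesIn (alive h)) ε.v ↔ e ∈ ε.down.toFinset := by rw [hdown]
    simp only [into, edgesIn, Finset.mem_filter, Finset.mem_univ, true_and, Option.mem_toFinset,
      Option.mem_def] at this
    rw [← this]; tauto
  have key : ε.v ∈ alive h ∧ ε.p ∈ alive h ∧ ε.v ≠ ε.p := by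
    rcases hne with hne | hne <;> obtain ⟨e, he⟩ := Option.ne_none_iff_exists'.1 hne
    · have := (a1 e).1 he
      rw [h1 e he, this.2.2] at this
      exact ⟨this.1, this.2.1, by rw [← h1 e he, ← ((a1 e).1 he).2.2]; exact hl e⟩
    · have := (a2 e).1 he
      rw [h2 e he, this.2.2] at this
      exact ⟨this.2.1, this.1, by rw [← h2 e he, ← ((a2 e).1 he).2.2]; exact (hl e).symm⟩
  exact ⟨key.1, key.2.1, key.2.2, fun e he he' => (a1 e).2 ⟨he ▸ key.1, he', he⟩,
    fun e he he' => (a2 e).2 ⟨he', he ▸ key.1, he⟩, fun e he => ⟨((a1 e).1 he).2.2, h1 e he⟩,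
    fun e he => ⟨h2 e he, ((a2 e).1 he).2.2⟩⟩

theorem CanElim.eq_p {h : List (Elim r s G.size)} {ε : Elim r s G.size} (hε : G.CanElim h ε) :
    ∀ q ∈ alive h, G.underlying.Adj ε.v q → q = ε.p := by
  intro q hq hvq
  rcases (underlying_adj.1 hvq).2 with ⟨e, he, rfl⟩ | ⟨e, rfl, he⟩
  · exact (hε.up e (hε.of_src e he hq)).2
  · exact (hε.down e (hε.of_dst e he hq)).1

theorem CanElim.edgesIn {h : List (Elim r s G.size)} {ε : Elim r s G.size} (hε : G.CanElim h ε) :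
    G.edgesIn (alive (ε :: h)) =
      (G.edgesIn (alive h) \ ε.up.toFinset) \ ε.down.toFinset := by
  ext e
  have a1 := hε.of_src e
  have a2 := hε.of_dst e
  have a3 := hε.up e
  have a4 := hε.down e
  simp only [DiGraph.edgesIn, alive, Finset.mem_erase, Finset.mem_filter, Finset.mem_univ,
    true_and, Finset.mem_sdiff, Option.mem_toFinset, Option.mem_def]
  tauto

end DiGraph

end VNEP

namespace VNEP

open Elim
open scoped ENNReal

/-! ### The representation of values, and the evaluation of a load -/

/-- A flag and a real number represent a value that may be infinite. -/
def Val (F : ℕ) (V : ℝ) (y : ℝ≥0∞) : Prop :=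
  F = 0 ∧ y = ⊤ ∨ 1 ≤ F ∧ ∃ z : ℝ≥0, V = z ∧ y = z

infixr:60 " ;; " => Prog.seq

/-- Checks the capacities of, and adds the costs for, a selected set of items on one substrate
element. -/
def loadProg (D Cap Cost c sel : ℕ) : Prog :=
  .for_ 25 (.get 0 (.lit 0))
    (.setReal 7 (.lit 0) (.lit 0) ;;
    .for_ 26 (.get 0 (.lit c))
      (.ite (.natLe (.lit 1) (.get sel (.var 26)))
        (.setReal 7 (.lit 0)
          (.add (.get 7 (.lit 0)) (.get D (.add (.get 15 (.var 26)) (.var 25))))) .skip) ;;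
    .ite (.realLe (.get 7 (.lit 0)) (.get Cap (.add (.var 28) (.var 25)))) .skip
      (.setVar 27 (.lit 0)) ;;
    .setReal 8 (.lit 0) (.add (.get 8 (.lit 0))
      (.mul (.get 7 (.lit 0)) (.get Cost (.add (.var 28) (.var 25))))))

/-- Once a capacity is exceeded, the flag remains `0` and the value `⊤`. The number is then
meaningless, so the program may go on adding to it without a test. -/
theorem Val.add_term {F F' : ℕ} {V V' : ℝ} {y : ℝ≥0∞} (h : Val F V y) (a b c : ℝ≥0)
    (hF : F' = if a ≤ b then F else 0) (hV : V' = V + a * c) :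
    Val F' V' (y + if a ≤ b then ((a * c : ℝ≥0) : ℝ≥0∞) else ⊤) := by
  subst hF hV
  by_cases hab : a ≤ b
  · simp only [hab, if_true]
    rcases h with ⟨h1, h2⟩ | ⟨h1, z, h2, h3⟩
    · left; simp [h1, h2]
    · right; exact ⟨h1, z + a * c, by simp [h2], by simp [h3]⟩
  · left; simp [hab]

theorem loadProg_run {D Cap Cost c sel m τ : ℕ} (d : Fin m → Fin τ → ℝ≥0) (cap cost : Fin τ → ℝ≥0)
    (J : Finset (Fin m)) {y : ℝ≥0∞} {σ : State} (hD : D < 6) (hC : Cap < 6) (hC' : Cost < 6)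
    (hs : sel < 25) (hτ : σ.nat 0 0 = τ) (hn : σ.nat 0 c = m)
    (hmul : ∀ j < m, σ.nat 15 j = j * τ) (hd : ∀ (j : Fin m) (k : Fin τ), σ.real D (j * τ + k) = d j k)
    (hcap : ∀ k : Fin τ, σ.real Cap (σ.nat 28 0 + k) = cap k)
    (hcost : ∀ k : Fin τ, σ.real Cost (σ.nat 28 0 + k) = cost k)
    (hsel : ∀ j : Fin m, 1 ≤ σ.nat sel j ↔ j ∈ J) (hV : Val (σ.nat 27 0) (σ.real 8 0) y) :
    Run (loadProg D Cap Cost c sel) σ (100 * ((τ + 1) * (m + 1))) fun σ' =>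
      Val (σ'.nat 27 0) (σ'.real 8 0) (y + loadVal d cap cost J) := by
  have hnw' : ∀ a < 25, (loadProg D Cap Cost c sel).natWrites.elem a = false := by
    intro a ha
    simp [loadProg, Prog.for_, Prog.natWrites]
    omega
  have hrw' : ∀ a < 6, (loadProg D Cap Cost c sel).realWrites.elem a = false := by
    intro a ha
    simp [loadProg, Prog.for_, Prog.realWrites]
    omega
  -- The outer loop keeps the partial sum of `loadVal` over the components treated so far; the inner
  -- loop collects the load in one component.
  refine (Run.for_ (T := 43 * (m + 1) + 40) (J := fun n σ' => Val (σ'.nat 27 0) (σ'.real 8 0)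
    (y + ∑ k ∈ below τ n, if ∑ j ∈ J, d j k ≤ cap k then
      (((∑ j ∈ J, d j k) * cost k : ℝ≥0) : ℝ≥0∞) else ⊤)) τ rfl ?_ ?_ ?_).mono ?_ ?_
  · intro k σ' _ hF
    simp [NExp.eval, hF.nat 0 (hnw' 0 (by omega)), hτ]
  · simpa using hV
  · intro k σ' hJ hk hik hF
    have e28 := hF.nat 28 rfl
    have e15 := hF.nat 15 rfl
    have es := hF.nat sel (hnw' sel hs)
    have e0 := hF.nat 0 rfl
    have eD := hF.real D (hrw' D hD)
    have eC := hF.real Cap (hrw' Cap hC)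
    have eC' := hF.real Cost (hrw' Cost hC')
    refine (Run.seq (T := 3) (T' := (m + 1) * 43 + 37) ((Run.straight _ _ rfl).conseq (by rfl)
      fun σ1 h1 hF1 => ?_)).mono (by omega) fun _ h => h
    refine Run.seq ((Run.for_ (T := 26) (J := fun n σ' => σ'.real 7 0 =
      ((∑ j ∈ below m n with j ∈ J, d j ⟨k, hk⟩ : ℝ≥0) : ℝ)) m rfl ?_ ?_ ?_).conseq le_rfl
      fun σ2 h2 hF2 => ?_)
    · intro j σ2 _ hF2
      simp only [NExp.eval]
      rw [hF2.nat 0 rfl, hF1.nat 0 rfl, e0, hn]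
    · simp [h1, Prog.result, RExp.eval, NExp.eval]
    · intro j σ2 hJ2 hj hij hF2
      have f25 : σ2.nat 25 0 = k := by rw [hF2.nat 25 rfl, hF1.nat 25 rfl, hik]
      have f15 : σ2.nat 15 j = j * τ := by
        rw [hF2.nat 15 rfl, hF1.nat 15 rfl, e15, hmul j hj]
      have fs : σ2.nat sel j = σ.nat sel j := by
        rw [hF2.nat sel (by simp [Prog.for_, Prog.natWrites]; omega),
          hF1.nat sel (by simp [Prog.natWrites]), es]
      have fD : σ2.real D (j * τ + k) = d ⟨j, hj⟩ ⟨k, hk⟩ := by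
        rw [hF2.real D (by simp [Prog.for_, Prog.realWrites]; omega),
          hF1.real D (by simp [Prog.realWrites]; omega), eD, ← hd]
      refine Run.of_straight rfl (by simp [Prog.bound, BExp.time, NExp.time, RExp.time]) ?_
      have hsj := hsel ⟨j, hj⟩
      simp only at hsj
      simp only [Prog.result, BExp.holds_natLe, NExp.eval, hij, fs, hsj]
      rw [Finset.sum_filter, sum_below_succ hj, ← Finset.sum_filter]
      split
      · simp [RExp.eval, NExp.eval, hij, f15, f25, fD, hJ2]
      · simp [hJ2]
    · have f25 : σ2.nat 25 0 = k := by rw [hF2.nat 25 rfl, hF1.nat 25 rfl, hik]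
      have f28 : σ2.nat 28 0 = σ.nat 28 0 := by rw [hF2.nat 28 rfl, hF1.nat 28 rfl, e28]
      have fC : σ2.real Cap (σ.nat 28 0 + k) = cap ⟨k, hk⟩ := by
        rw [hF2.real Cap (by simp [Prog.for_, Prog.realWrites]; omega),
          hF1.real Cap (by simp [Prog.realWrites]; omega), eC, ← hcap]
      have fC' : σ2.real Cost (σ.nat 28 0 + k) = cost ⟨k, hk⟩ := by
        rw [hF2.real Cost (by simp [Prog.for_, Prog.realWrites]; omega),
          hF1.real Cost (by simp [Prog.realWrites]; omega), eC', ← hcost]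
      have f27 : σ2.nat 27 0 = σ'.nat 27 0 := by rw [hF2.nat 27 rfl, hF1.nat 27 rfl]
      have f8 : σ2.real 8 0 = σ'.real 8 0 := by rw [hF2.real 8 rfl, hF1.real 8 rfl]
      rw [below_self] at h2
      have h2' : σ2.real 7 0 = ((∑ j ∈ J, d j ⟨k, hk⟩ : ℝ≥0) : ℝ) := by
        rw [h2]; congr 2; ext; simp
      refine Run.of_straight rfl (by simp [Prog.bound, BExp.time, NExp.time, RExp.time]) ?_
      rw [sum_below_succ hk, ← add_assoc]
      refine hJ.add_term _ _ _ ?_ ?_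
      · simp only [Prog.result, BExp.holds_realLe, RExp.eval, NExp.eval, f25, f28, fC, h2',
          NNReal.coe_le_coe]
        split <;> simp [f27]
      · simp only [Prog.result, BExp.holds_realLe, RExp.eval, NExp.eval, f25, f28, fC, h2',
          NNReal.coe_le_coe]
        split <;> simp [f8, f25, f28, fC', h2']
  · simp only [NExp.time]
    nlinarith
  · intro σ' h
    simpa [loadVal] using h

end VNEP

namespace VNEP

open Elim
open scoped ENNReal

/-! ### Tables -/

namespace Inst

variable {τ r s : ℕ} (I : Inst τ r s)

/-- The memory contains the input. -/
structure Inp (σ : State) : Prop where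
  nat : ∀ a < 5, σ.nat a = I.input.nat a
  real : ∀ a < 6, σ.real a = I.input.real a

variable {I}

theorem _root_.VNEP.natArray_apply {m : ℕ} (f : Fin m → ℕ) (i : Fin m) : natArray f i = f i := by
  simp [natArray]

theorem _root_.VNEP.vecArray_apply {m τ : ℕ} (f : Fin m → Fin τ → ℝ≥0) (i : Fin m) (k : Fin τ) :
    vecArray f (i * τ + k) = f i k := by
  have h0 : (finProdFinEquiv (i, k) : ℕ) = i * τ + k := by
    rw [finProdFinEquiv_apply_val]; simp only; ring
  have h2 : (i : ℕ) * τ + k < m * τ := h0 ▸ (finProdFinEquiv (i, k)).2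
  have h1 : (⟨i * τ + k, h2⟩ : Fin (m * τ)) = finProdFinEquiv (i, k) := Fin.ext h0.symm
  rw [vecArray, dif_pos h2, h1]
  simp

namespace Inp

variable {σ σ' : State} (h : I.Inp σ)
include h

theorem dim : σ.nat 0 0 = τ := by rw [h.nat 0 (by omega)]; rfl
theorem reqNodes : σ.nat 0 1 = r := by rw [h.nat 0 (by omega)]; rfl
theorem subNodes : σ.nat 0 2 = s := by rw [h.nat 0 (by omega)]; rfl
theorem reqEdges : σ.nat 0 3 = I.request.size := by rw [h.nat 0 (by omega)]; rfl
theorem subEdges : σ.nat 0 4 = I.substrate.size := by rw [h.nat 0 (by omega)]; rfl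

theorem reqSrc (e : Fin I.request.size) : σ.nat 1 e = I.request.src e := by
  rw [h.nat 1 (by omega)]; exact natArray_apply (fun e => (I.request.src e : ℕ)) e
theorem reqDst (e : Fin I.request.size) : σ.nat 2 e = I.request.dst e := by
  rw [h.nat 2 (by omega)]; exact natArray_apply (fun e => (I.request.dst e : ℕ)) e
theorem subSrc (e : Fin I.substrate.size) : σ.nat 3 e = I.substrate.src e := by
  rw [h.nat 3 (by omega)]; exact natArray_apply (fun e => (I.substrate.src e : ℕ)) e
theorem subDst (e : Fin I.substrate.size) : σ.nat 4 e = I.substrate.dst e := by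
  rw [h.nat 4 (by omega)]; exact natArray_apply (fun e => (I.substrate.dst e : ℕ)) e

theorem nodeDemand (i : Fin r) (k : Fin τ) : σ.real 0 (i * τ + k) = I.nodeDemand i k := by
  rw [h.real 0 (by omega)]; exact vecArray_apply _ i k
theorem edgeDemand (i : Fin I.request.size) (k : Fin τ) :
    σ.real 1 (i * τ + k) = I.edgeDemand i k := by
  rw [h.real 1 (by omega)]; exact vecArray_apply _ i k
theorem nodeCap (i : Fin s) (k : Fin τ) : σ.real 2 (i * τ + k) = I.nodeCap i k := by
  rw [h.real 2 (by omega)]; exact vecArray_apply _ i k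
theorem edgeCap (i : Fin I.substrate.size) (k : Fin τ) :
    σ.real 3 (i * τ + k) = I.edgeCap i k := by
  rw [h.real 3 (by omega)]; exact vecArray_apply _ i k
theorem nodeCost (i : Fin s) (k : Fin τ) : σ.real 4 (i * τ + k) = I.nodeCost i k := by
  rw [h.real 4 (by omega)]; exact vecArray_apply _ i k
theorem edgeCost (i : Fin I.substrate.size) (k : Fin τ) :
    σ.real 5 (i * τ + k) = I.edgeCost i k := by
  rw [h.real 5 (by omega)]; exact vecArray_apply _ i k

theorem framed {P : Prog} (hF : Framed P σ σ')
    (hP : ([0, 1, 2, 3, 4].all fun a => !P.natWrites.elem a) = true := by rfl)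
    (hP' : ([0, 1, 2, 3, 4, 5].all fun a => !P.realWrites.elem a) = true := by rfl) :
    I.Inp σ' where
  nat a ha := by
    rw [hF.nat a, h.nat a ha]
    simp only [List.all_eq_true, Bool.not_eq_true'] at hP
    exact hP a (by interval_cases a <;> simp)
  real a ha := by
    rw [hF.real a, h.real a ha]
    simp only [List.all_eq_true, Bool.not_eq_true'] at hP'
    exact hP' a (by interval_cases a <;> simp)

end Inp

variable (I)

/-- The memory contains the input and tables for arithmetic: powers of two, the pairs of disjoint
sets of request nodes, and multiples of `τ` and of `2 ^ r`. -/
structure Ctx (σ : State) : Prop extends I.Inp σ where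
  pow : ∀ i ≤ r, σ.nat 10 i = 2 ^ i
  numSets : σ.nat 14 0 = 2 ^ r
  numPairs : σ.nat 13 0 = 3 ^ r
  pair : ∀ k < 3 ^ r, ∃ T U : Finset (Fin r), Disjoint T U ∧ σ.nat 11 k = enc T ∧ σ.nat 12 k = enc U
  exists_pair : ∀ T U : Finset (Fin r), Disjoint T U →
    ∃ k < 3 ^ r, σ.nat 11 k = enc T ∧ σ.nat 12 k = enc U
  mul : ∀ j < r + s + I.request.size + I.substrate.size, σ.nat 15 j = j * τ
  base : ∀ v < s, σ.nat 16 v = v * 2 ^ r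

variable {I}

theorem Ctx.framed {σ σ' : State} {P : Prog} (h : I.Ctx σ) (hF : Framed P σ σ')
    (hP : ([0, 1, 2, 3, 4, 10, 11, 12, 13, 14, 15, 16].all fun a => !P.natWrites.elem a) = true :=
      by rfl)
    (hP' : ([0, 1, 2, 3, 4, 5].all fun a => !P.realWrites.elem a) = true := by rfl) :
    I.Ctx σ' := by
  have hi := h.toInp.framed hF (by
    simp only [List.all_eq_true] at hP ⊢
    exact fun a ha => hP a (by simp only [List.mem_cons] at ha ⊢; tauto)) hP'
  simp only [List.all_eq_true, Bool.not_eq_true'] at hP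
  have e : ∀ a ∈ [0, 1, 2, 3, 4, 10, 11, 12, 13, 14, 15, 16], σ'.nat a = σ.nat a :=
    fun a ha => hF.nat a (hP a ha)
  refine ⟨hi, ?_, ?_, ?_, ?_, ?_, ?_, ?_⟩
  · rw [e 10 (by simp)]; exact h.pow
  · rw [e 14 (by simp)]; exact h.numSets
  · rw [e 13 (by simp)]; exact h.numPairs
  · rw [e 11 (by simp), e 12 (by simp)]; exact h.pair
  · rw [e 11 (by simp), e 12 (by simp)]; exact h.exists_pair
  · rw [e 15 (by simp)]; exact h.mul
  · rw [e 16 (by simp)]; exact h.base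

end Inst

/-- Lists the powers of two and the pairs of disjoint subsets. -/
def pairsProg : Prog :=
  (.setNat 10 (.lit 0) (.lit 1) ;; .setVar 13 (.lit 1) ;; .setNat 11 (.lit 0) (.lit 0) ;;
    .setNat 12 (.lit 0) (.lit 0)) ;;
  .for_ 22 (.get 0 (.lit 1))
    (.setVar 21 (.var 13) ;;
    .for_ 23 (.var 21)
      (.setNat 11 (.var 13) (.get 11 (.var 23)) ;;
      .setNat 12 (.var 13) (.add (.get 12 (.var 23)) (.get 10 (.var 22))) ;;
      .setVar 13 (.add (.var 13) (.lit 1)) ;;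
      .setNat 11 (.var 13) (.add (.get 11 (.var 23)) (.get 10 (.var 22))) ;;
      .setNat 12 (.var 13) (.get 12 (.var 23)) ;;
      .setVar 13 (.add (.var 13) (.lit 1))) ;;
    .setNat 10 (.add (.var 22) (.lit 1)) (.add (.get 10 (.var 22)) (.get 10 (.var 22)))) ;;
  .setVar 14 (.get 10 (.get 0 (.lit 1)))

/-- The arrays `11` and `12` list the pairs of disjoint subsets of the first `i` request nodes. -/
structure PairsBelow (r i : ℕ) (σ : State) : Prop where
  pow : ∀ j ≤ i, σ.nat 10 j = 2 ^ j
  num : σ.nat 13 0 = 3 ^ i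
  pair : ∀ k < 3 ^ i, ∃ T U : Finset (Fin r), Disjoint T U ∧ (∀ w ∈ T, (w : ℕ) < i) ∧
    (∀ w ∈ U, (w : ℕ) < i) ∧ σ.nat 11 k = enc T ∧ σ.nat 12 k = enc U
  exists_pair : ∀ T U : Finset (Fin r), Disjoint T U → (∀ w ∈ T, (w : ℕ) < i) →
    (∀ w ∈ U, (w : ℕ) < i) → ∃ k < 3 ^ i, σ.nat 11 k = enc T ∧ σ.nat 12 k = enc U

/-- The new element `i` joins neither set, the second or the first. The old pairs stay in their
cells for the first case, and pair `k` produces the pairs number `3 ^ i + 2 * k` and `3 ^ i + 2 * k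
+ 1` for the other two. -/
theorem PairsBelow.succ {r i : ℕ} {σ σ' : State} (hi : i < r) (h : PairsBelow r i σ)
    (h10 : ∀ j ≤ i + 1, σ'.nat 10 j = 2 ^ j) (h13 : σ'.nat 13 0 = 3 ^ i + 2 * 3 ^ i)
    (h1 : ∀ k < 3 ^ i, σ'.nat 11 k = σ.nat 11 k ∧ σ'.nat 12 k = σ.nat 12 k)
    (h2 : ∀ k < 3 ^ i, σ'.nat 11 (3 ^ i + 2 * k) = σ.nat 11 k ∧
      σ'.nat 12 (3 ^ i + 2 * k) = σ.nat 12 k + 2 ^ i)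
    (h3 : ∀ k < 3 ^ i, σ'.nat 11 (3 ^ i + 2 * k + 1) = σ.nat 11 k + 2 ^ i ∧
      σ'.nat 12 (3 ^ i + 2 * k + 1) = σ.nat 12 k) : PairsBelow r (i + 1) σ' := by
  have hlt : ∀ {F : Finset (Fin r)}, (∀ w ∈ F, (w : ℕ) < i) → ∀ w ∈ F, (w : ℕ) < i + 1 :=
    fun h w hw => (h w hw).trans (by omega)
  have hins : ∀ {F : Finset (Fin r)}, (∀ w ∈ F, (w : ℕ) < i) →
      ∀ w ∈ insert ⟨i, hi⟩ F, (w : ℕ) < i + 1 := fun h w hw => by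
    rcases Finset.mem_insert.1 hw with rfl | hw
    · simp
    · exact hlt h w hw
  have hnot : ∀ {F : Finset (Fin r)}, (∀ w ∈ F, (w : ℕ) < i) → (⟨i, hi⟩ : Fin r) ∉ F :=
    fun h hw => lt_irrefl _ (h _ hw)
  have hback : ∀ {F : Finset (Fin r)}, (∀ w ∈ F, (w : ℕ) < i + 1) → (⟨i, hi⟩ : Fin r) ∉ F →
      ∀ w ∈ F, (w : ℕ) < i := fun {F} h hw w hwF => by
    have := h w hwF
    have : (w : ℕ) ≠ i := fun hc => hw (by rwa [show w = ⟨i, hi⟩ from Fin.ext hc] at hwF)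
    omega
  have hers : ∀ {F : Finset (Fin r)}, (∀ w ∈ F, (w : ℕ) < i + 1) →
      ∀ w ∈ F.erase ⟨i, hi⟩, (w : ℕ) < i := fun {F} h =>
    hback (fun w hw => h w (Finset.mem_of_mem_erase hw)) (Finset.notMem_erase _ _)
  refine ⟨h10, by rw [h13]; ring, fun k hk => ?_, fun T U hTU hT hU => ?_⟩
  · rw [pow_succ] at hk
    rcases lt_or_ge k (3 ^ i) with hk' | hk'
    · obtain ⟨T, U, a1, a2, a3, a4, a5⟩ := h.pair k hk'
      exact ⟨T, U, a1, hlt a2, hlt a3, by rw [(h1 k hk').1, a4], by rw [(h1 k hk').2, a5]⟩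
    -- Pair `k` was made from the old pair `l`, and the parity tells which of the two sets received
    -- `i`.
    · obtain ⟨l, hl⟩ : ∃ l, l = (k - 3 ^ i) / 2 := ⟨_, rfl⟩
      obtain ⟨T, U, a1, a2, a3, a4, a5⟩ := h.pair l (by omega)
      rcases Nat.even_or_odd (k - 3 ^ i) with ⟨m, hm⟩ | ⟨m, hm⟩
      · obtain rfl : k = 3 ^ i + 2 * l := by omega
        have := h2 l (by omega)
        refine ⟨T, insert ⟨i, hi⟩ U, ?_, hlt a2, hins a3, by rw [this.1, a4],
          by rw [this.2, a5, enc_insert (hnot a3)]⟩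
        rw [Finset.disjoint_insert_right]
        exact ⟨hnot a2, a1⟩
      · obtain rfl : k = 3 ^ i + 2 * l + 1 := by omega
        have := h3 l (by omega)
        refine ⟨insert ⟨i, hi⟩ T, U, ?_, hins a2, hlt a3, by rw [this.1, a4, enc_insert (hnot a2)],
          by rw [this.2, a5]⟩
        rw [Finset.disjoint_insert_left]
        exact ⟨hnot a3, a1⟩
  · rw [pow_succ]
    by_cases hiT : (⟨i, hi⟩ : Fin r) ∈ T
    · have hiU : (⟨i, hi⟩ : Fin r) ∉ U := Finset.disjoint_left.1 hTU hiT
      obtain ⟨k, hk, k1, k2⟩ := h.exists_pair (T.erase ⟨i, hi⟩) U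
        (hTU.mono_left (Finset.erase_subset _ _)) (hers hT) (hback hU hiU)
      refine ⟨3 ^ i + 2 * k + 1, by omega, ?_, by rw [(h3 k hk).2, k2]⟩
      rw [(h3 k hk).1, k1, ← Finset.insert_erase hiT, enc_insert (Finset.notMem_erase _ _)]
      simp
    · by_cases hiU : (⟨i, hi⟩ : Fin r) ∈ U
      · obtain ⟨k, hk, k1, k2⟩ := h.exists_pair T (U.erase ⟨i, hi⟩)
          (hTU.mono_right (Finset.erase_subset _ _)) (hback hT hiT) (hers hU)
        refine ⟨3 ^ i + 2 * k, by omega, by rw [(h2 k hk).1, k1], ?_⟩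
        rw [(h2 k hk).2, k2, ← Finset.insert_erase hiU, enc_insert (Finset.notMem_erase _ _)]
        simp
      · obtain ⟨k, hk, k1, k2⟩ := h.exists_pair T U hTU (hback hT hiT) (hback hU hiU)
        exact ⟨k, by omega, by rw [(h1 k hk).1, k1], by rw [(h1 k hk).2, k2]⟩

theorem pairsProg_run {r : ℕ} {σ : State} (hr : σ.nat 0 1 = r) :
    Run pairsProg σ (300 * ((r + 1) * 3 ^ r)) fun σ' => PairsBelow r r σ' ∧ σ'.nat 14 0 = 2 ^ r := by
  have hpos : 0 < 3 ^ r := by positivity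
  refine (Run.seq (T := 12) (T' := (r + 1) * (80 * (3 ^ r + 1) + 40) + 10)
    ((Run.straight _ _ rfl).conseq (by rfl) fun σ1 h1 hF1 => ?_)).mono
    (by nlinarith) fun _ h => h
  have f0 : σ1.nat 0 1 = r := by rw [hF1.nat 0 rfl, hr]
  refine Run.seq (T' := 10) ((Run.for_ (J := fun i σ' => PairsBelow r i σ') (T := 80 * (3 ^ r + 1) + 20)
    r rfl ?_ ?_ ?_).conseq ?_ fun σ2 h2 hF2 => ?_)
  · intro k σ2 _ hF2
    simp only [NExp.eval]
    rw [hF2.nat 0 rfl, f0]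
  · subst h1
    refine ⟨?_, ?_, ?_, ?_⟩
    · intro j hj
      obtain rfl : j = 0 := by omega
      simp [Prog.result, NExp.eval]
    · simp [Prog.result, NExp.eval]
    · intro k hk
      obtain rfl : k = 0 := by simpa using hk
      exact ⟨∅, ∅, by simp [Prog.result, NExp.eval]⟩
    · intro T U _ hT hU
      refine ⟨0, by simp, ?_⟩
      obtain rfl : T = ∅ := Finset.eq_empty_of_forall_notMem fun w hw => by simpa using hT w hw
      obtain rfl : U = ∅ := Finset.eq_empty_of_forall_notMem fun w hw => by simpa using hU w hw
      simp [Prog.result, NExp.eval]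
  · intro i σ2 hJ hi hii hF2
    -- Every pass is charged as much as a full one; the resulting factor `r + 1` is affordable.
    have hle : 3 ^ i ≤ 3 ^ r := Nat.pow_le_pow_right (by omega) hi.le
    refine (Run.seq (T := 4) (T' := 80 * (3 ^ r + 1) + 14) ((Run.straight _ _ rfl).conseq (by rfl)
      fun σ3 h3 hF3 => ?_)).mono (by omega) fun _ h => h
    -- Variable `21` freezes the length of the old list, since variable `13` grows during the pass.
    have g21 : σ3.nat 21 0 = 3 ^ i := by subst h3; simp [Prog.result, NExp.eval, hJ.num]
    have g22 : σ3.nat 22 0 = i := by rw [hF3.nat 22 rfl, hii]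
    refine Run.seq (T' := 12) ((Run.for_ (J := fun j σ' => σ'.nat 13 0 = 3 ^ i + 2 * j ∧
      (∀ k < 3 ^ i, σ'.nat 11 k = σ2.nat 11 k ∧ σ'.nat 12 k = σ2.nat 12 k) ∧
      (∀ k < j, σ'.nat 11 (3 ^ i + 2 * k) = σ2.nat 11 k ∧
        σ'.nat 12 (3 ^ i + 2 * k) = σ2.nat 12 k + 2 ^ i) ∧
      (∀ k < j, σ'.nat 11 (3 ^ i + 2 * k + 1) = σ2.nat 11 k + 2 ^ i ∧
        σ'.nat 12 (3 ^ i + 2 * k + 1) = σ2.nat 12 k)) (T := 60) (3 ^ i) rfl ?_ ?_ ?_).conseq ?_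
        fun σ4 h4 hF4 => ?_)
    · intro k σ4 _ hF4
      simp only [NExp.eval]
      rw [hF4.nat 21 rfl, g21]
    · subst h3
      simp [Prog.result, NExp.eval, hJ.num]
    · rintro j σ4 ⟨k1, k2, k3, k4⟩ hj hij hF4
      have f22 : σ4.nat 22 0 = i := by rw [hF4.nat 22 rfl, g22]
      have f10 : σ4.nat 10 i = 2 ^ i := by
        rw [hF4.nat 10 rfl, hF3.nat 10 rfl, hJ.pow i le_rfl]
      have kj := k2 j hj
      refine Run.of_straight rfl (by simp [Prog.bound, NExp.time]) ⟨?_, ?_, ?_, ?_⟩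
      · simp [Prog.result, NExp.eval, k1]; ring
      · intro k hk
        have a1 : k ≠ 3 ^ i + 2 * j := by omega
        have a2 : k ≠ 3 ^ i + 2 * j + 1 := by omega
        simp [Prog.result, NExp.eval, k1, a1, a2, k2 k hk]
      · intro k hk
        have a0 : j ≠ 3 ^ i + 2 * j := by omega
        have a2 : 3 ^ i + 2 * k ≠ 3 ^ i + 2 * j + 1 := by omega
        rcases Nat.lt_succ_iff_lt_or_eq.1 hk with hk | rfl
        · have a1 : k ≠ j := by omega
          simp [Prog.result, NExp.eval, k1, hij, f22, f10, a1, a2, k3 k hk]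
        · simp [Prog.result, NExp.eval, k1, hij, f22, f10, kj]
      · intro k hk
        have a0 : j ≠ 3 ^ i + 2 * j := by omega
        have a2 : 3 ^ i + 2 * k + 1 ≠ 3 ^ i + 2 * j := by omega
        rcases Nat.lt_succ_iff_lt_or_eq.1 hk with hk | rfl
        · have a1 : k ≠ j := by omega
          simp [Prog.result, NExp.eval, k1, hij, f22, f10, a1, a2, k4 k hk]
        · simp [Prog.result, NExp.eval, k1, hij, f22, f10, a0, kj]
    · simp only [NExp.time]
      nlinarith
    · obtain ⟨k1, k2, k3, k4⟩ := h4
      have f22 : σ4.nat 22 0 = i := by rw [hF4.nat 22 rfl, g22]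
      have f10 : ∀ j, σ4.nat 10 j = σ2.nat 10 j := fun j => by
        rw [hF4.nat 10 rfl, hF3.nat 10 rfl]
      refine Run.of_straight rfl (by simp [Prog.bound, NExp.time]) (hJ.succ hi ?_ ?_ ?_ ?_ ?_)
      · intro j hj
        rcases Nat.le_succ_iff.1 hj with hj | rfl
        · have : j ≠ i + 1 := by omega
          simp [Prog.result, NExp.eval, f22, f10, this, hJ.pow j hj]
        · simp [Prog.result, NExp.eval, f22, f10, hJ.pow i le_rfl]
          ring
      · simp [Prog.result, k1]
      · simpa [Prog.result] using k2
      · simpa [Prog.result] using k3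
      · simpa [Prog.result] using k4
  · simp only [NExp.time]
    nlinarith
  · refine Run.of_straight rfl (by simp [Prog.bound, NExp.time]) ⟨?_, ?_⟩
    · refine ⟨?_, ?_, ?_, ?_⟩
      · simpa [Prog.result] using h2.pow
      · simpa [Prog.result] using h2.num
      · simpa [Prog.result] using h2.pair
      · simpa [Prog.result] using h2.exists_pair
    · have : σ2.nat 0 1 = r := by rw [hF2.nat 0 rfl, f0]
      simp [Prog.result, NExp.eval, this, h2.pow r le_rfl]

/-- Fills array `a` with multiples of `x`. -/
def multiplesProg (a : ℕ) (n x : NExp) : Prog :=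
  .setNat a (.lit 0) (.lit 0) ;;
  .for_ 22 n (.setNat a (.add (.var 22) (.lit 1)) (.add (.get a (.var 22)) x))

/-- The machine cannot multiply natural numbers, so multiples come from repeated addition. The
expressions `n` and `x` are evaluated in changing states, which is why their values are required in
every state that differs only in array `a` and the loop variable. -/
theorem multiplesProg_run {a m c : ℕ} {n x : NExp} {σ : State} (ha : a ≠ 22)
    (hn : ∀ σ', (∀ b, b ≠ a → b ≠ 22 → σ'.nat b = σ.nat b) → n.eval σ' = m)
    (hx : ∀ σ', (∀ b, b ≠ a → b ≠ 22 → σ'.nat b = σ.nat b) → x.eval σ' = c) :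
    Run (multiplesProg a n x) σ ((m + 1) * (n.time + x.time + 30))
      fun σ' => ∀ j ≤ m, σ'.nat a j = j * c := by
  refine (Run.seq (T := 3) (T' := (m + 1) * ((x.time + 9) + n.time + 15))
    ((Run.straight _ _ rfl).conseq (by simp [Prog.bound, NExp.time])
      fun σ1 h1 hF1 => ?_)).mono (by nlinarith) fun _ h => h
  have key : ∀ σ', Framed (Prog.for_ 22 n
      (.setNat a (.add (.var 22) (.lit 1)) (.add (.get a (.var 22)) x))) σ1 σ' →
      ∀ b, b ≠ a → b ≠ 22 → σ'.nat b = σ.nat b := by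
    intro σ' hF b h1 h2
    rw [hF.nat b (by simp [Prog.for_, Prog.natWrites, h1, h2]),
      hF1.nat b (by simp [Prog.natWrites, h1])]
  refine Run.for_ (J := fun k σ' => ∀ j ≤ k, σ'.nat a j = j * c) m
    (by simp [Prog.natWrites, ha.symm]) (fun k σ' _ hF => hn σ' (key σ' hF)) ?_ ?_
  · intro j hj
    obtain rfl : j = 0 := by omega
    subst h1
    simp [Prog.result, NExp.eval, ha]
  · intro k σ' hJ hk hik hF
    have hx' := hx σ' (key σ' hF)
    refine Run.of_straight rfl (by simp [Prog.bound, NExp.time]; omega) fun j hj => ?_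
    rcases Nat.le_succ_iff.1 hj with hj | rfl
    · have : j ≠ k + 1 := by omega
      simp [Prog.result, NExp.eval, hik, ha, this, hJ j hj]
    · simp [Prog.result, NExp.eval, hik, ha, hJ k le_rfl, hx']
      ring

/-- Computes all tables. -/
def tablesProg : Prog :=
  pairsProg ;;
  multiplesProg 15 (.add (.add (.get 0 (.lit 1)) (.get 0 (.lit 2)))
    (.add (.get 0 (.lit 3)) (.get 0 (.lit 4)))) (.get 0 (.lit 0)) ;;
  multiplesProg 16 (.get 0 (.lit 2)) (.var 14)

theorem tablesProg_run {τ r s : ℕ} {I : Inst τ r s} {σ : State} (h : I.Inp σ) :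
    Run tablesProg σ (300 * ((r + 1) * 3 ^ r) +
      (50 * (r + s + I.request.size + I.substrate.size + 1) + 50 * (s + 1))) I.Ctx := by
  refine Run.seq ((pairsProg_run h.reqNodes).conseq le_rfl fun σ1 h1 hF1 => ?_)
  have i1 := h.framed hF1
  refine Run.seq ((multiplesProg_run (m := r + s + I.request.size + I.substrate.size) (c := τ)
    (by omega) ?_ ?_).conseq ?_ fun σ2 h2 hF2 => ?_)
  · intro σ' h'
    simp only [NExp.eval]
    rw [h' 0 (by omega) (by omega), i1.reqNodes, i1.subNodes, i1.reqEdges, i1.subEdges]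
    ring
  · intro σ' h'
    simp only [NExp.eval]
    rw [h' 0 (by omega) (by omega), i1.dim]
  · simp only [NExp.time]; omega
  · have i2 := i1.framed hF2
    have e14 : σ2.nat 14 0 = 2 ^ r := by rw [hF2.nat 14 rfl, h1.2]
    refine (multiplesProg_run (m := s) (c := 2 ^ r) (by omega) ?_ ?_).conseq ?_ fun σ3 h3 hF3 => ?_
    · intro σ' h'
      simp only [NExp.eval]
      rw [h' 0 (by omega) (by omega), i2.subNodes]
    · intro σ' h'
      simp only [NExp.eval]
      rw [h' 14 (by omega) (by omega), e14]
    · simp only [NExp.time]; omega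
    · have e : ∀ a ∈ [10, 11, 12, 13], σ3.nat a = σ1.nat a := by
        intro a ha
        simp only [List.mem_cons, List.not_mem_nil, or_false] at ha
        rcases ha with rfl | rfl | rfl | rfl <;> rw [hF3.nat _ rfl, hF2.nat _ rfl]
      refine ⟨i2.framed hF3, ?_, ?_, ?_, ?_, ?_, ?_, ?_⟩
      · rw [e 10 (by simp)]; exact h1.1.pow
      · rw [hF3.nat 14 rfl, e14]
      · rw [e 13 (by simp)]; exact h1.1.num
      · rw [e 11 (by simp), e 12 (by simp)]
        intro k hk
        obtain ⟨T, U, a, -, -, b, c⟩ := h1.1.pair k hk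
        exact ⟨T, U, a, b, c⟩
      · rw [e 11 (by simp), e 12 (by simp)]
        exact fun T U hTU => h1.1.exists_pair T U hTU (fun w _ => w.2) fun w _ => w.2
      · intro j hj
        rw [hF3.nat 15 rfl]
        exact h2 j hj.le
      · exact fun v hv => h3 v hv.le

end VNEP

namespace VNEP

open Elim
open scoped ENNReal

/-! ### Decoding of sets, and the values of single nodes -/

/-- Writes the digits of the number in variable `24` into array `20`. -/
def decodeProg : Prog :=
  .setVar 21 (.var 24) ;;
  .for_ 22 (.get 0 (.lit 1))
    (.ite (.natLe (.get 10 (.sub (.get 0 (.lit 1)) (.add (.var 22) (.lit 1)))) (.var 21))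
      (.setNat 20 (.sub (.get 0 (.lit 1)) (.add (.var 22) (.lit 1))) (.lit 1) ;;
        .setVar 21 (.sub (.var 21) (.get 10 (.sub (.get 0 (.lit 1)) (.add (.var 22) (.lit 1))))))
      (.setNat 20 (.sub (.get 0 (.lit 1)) (.add (.var 22) (.lit 1))) (.lit 0)))

/-- Array `20` is the indicator function of `F`. -/
def Indicator {r : ℕ} (F : Finset (Fin r)) (σ : State) : Prop :=
  ∀ w : Fin r, σ.nat 20 w = if w ∈ F then 1 else 0

namespace Inst

variable {τ r s : ℕ} {I : Inst τ r s}

/-- Digits are split off from the top. After `u` rounds, variable `21` encodes the members of `F`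
below `r - u`. With `i = r - (u + 1)`, the node `i` belongs to `F` exactly if at least `2 ^ i` is
left, as all smaller nodes together give less. -/
theorem decodeProg_run {σ : State} (h : I.Ctx σ) {F : Finset (Fin r)} (hF : σ.nat 24 0 = enc F) :
    Run decodeProg σ (100 * (r + 1)) (Indicator F) := by
  refine (Run.seq (T := 4) (T' := (r + 1) * (60 + 2 + 15))
    ((Run.straight _ _ rfl).conseq (by rfl) fun σ1 h1 hF1 => ?_)).mono
    (by nlinarith) fun _ h => h
  have c1 := h.framed hF1
  refine (Run.for_ (J := fun u σ' => σ'.nat 21 0 = enc (F.filter fun w : Fin r => (w : ℕ) < r - u) ∧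
    ∀ w : Fin r, r - u ≤ w → σ'.nat 20 w = if w ∈ F then 1 else 0) r rfl ?_ ?_ ?_).conseq
    (by rfl) ?_
  · intro k σ2 _ hF2
    exact (c1.framed hF2).reqNodes
  · subst h1
    refine ⟨?_, fun w hw => absurd w.2 (by omega)⟩
    have : F.filter (fun w : Fin r => (w : ℕ) < r - 0) = F := by ext w; simp
    rw [this]
    simp [Prog.result, NExp.eval, hF]
  · rintro u σ2 ⟨k1, k2⟩ hu hiu hF2
    have c2 := c1.framed hF2
    obtain ⟨i, hi⟩ : ∃ i, i = r - (u + 1) := ⟨_, rfl⟩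
    have hir : i < r := by omega
    have hru : r - u = i + 1 := by omega
    have hpow := c2.pow i (by omega)
    have hlt : enc (F.filter fun w : Fin r => (w : ℕ) < i) < 2 ^ i :=
      enc_lt_of fun w hw => (Finset.mem_filter.1 hw).2
    rw [hru] at k1 k2
    rw [← hi]
    refine Run.of_straight rfl (by simp [Prog.bound, BExp.time, NExp.time]) ?_
    simp only [Prog.result, BExp.holds_natLe, NExp.eval, c2.reqNodes, hiu, ← hi, hpow]
    by_cases hiF : (⟨i, hir⟩ : Fin r) ∈ F
    · have e1 : F.filter (fun w : Fin r => (w : ℕ) < i + 1) =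
          insert ⟨i, hir⟩ (F.filter fun w : Fin r => (w : ℕ) < i) := by
        ext w
        simp only [Finset.mem_filter, Finset.mem_insert, Fin.ext_iff]
        constructor
        · rintro ⟨a, b⟩
          by_cases hc : (w : ℕ) = i
          · exact .inl hc
          · exact .inr ⟨a, by omega⟩
        · rintro (a | a)
          · exact ⟨by rwa [show w = ⟨i, hir⟩ from Fin.ext a], by omega⟩
          · exact ⟨a.1, by omega⟩
      rw [e1, enc_insert (by simp)] at k1
      rw [k1, if_pos (by simp)]
      refine ⟨?_, fun w hw => ?_⟩
      · simp [c2.reqNodes, hiu, ← hi, hpow, k1]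
      · by_cases hc : (w : ℕ) = i
        · rw [show w = ⟨i, hir⟩ from Fin.ext hc]
          simp [c2.reqNodes, hiu, ← hi, hiF]
        · have := k2 w (by omega)
          simp [c2.reqNodes, hiu, ← hi, hc, this]
    · have e1 : F.filter (fun w : Fin r => (w : ℕ) < i + 1) = F.filter fun w : Fin r => (w : ℕ) < i := by
        ext w
        simp only [Finset.mem_filter]
        constructor
        · rintro ⟨a, b⟩
          refine ⟨a, ?_⟩
          have : (w : ℕ) ≠ i := fun hc => hiF (by rwa [show w = ⟨i, hir⟩ from Fin.ext hc] at a)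
          omega
        · rintro ⟨a, b⟩
          exact ⟨a, by omega⟩
      rw [e1] at k1
      rw [k1, if_neg (by omega)]
      refine ⟨?_, fun w hw => ?_⟩
      · simp [k1]
      · by_cases hc : (w : ℕ) = i
        · rw [show w = ⟨i, hir⟩ from Fin.ext hc]
          simp [hiF]
        · have := k2 w (by omega)
          simp [hc, this]
  · intro σ2 h2 _ w
    have := h2.2 w (by omega)
    simpa using this

/-- The arrays `30` (flags) and `10` (numbers) contain the values `G x F`. -/
def Table {r s : ℕ} (G : Fin s → Finset (Fin r) → ℝ≥0∞) (σ : State) : Prop :=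
  ∀ (x : Fin s) (F : Finset (Fin r)),
    Val (σ.nat 30 (x * 2 ^ r + enc F)) (σ.real 10 (x * 2 ^ r + enc F)) (G x F)

theorem _root_.VNEP.index_eq_iff {N a b a' b' : ℕ} (h : b < N) (h' : b' < N) :
    a * N + b = a' * N + b' ↔ a = a' ∧ b = b' := by
  constructor
  · intro e
    have h1 : (a * N + b) / N = a := by
      rw [mul_comm, Nat.mul_add_div (by omega), Nat.div_eq_of_lt h]; rfl
    have h2 : (a' * N + b') / N = a' := by
      rw [mul_comm, Nat.mul_add_div (by omega), Nat.div_eq_of_lt h']; rfl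
    have : a = a' := by rw [← h1, ← h2, e]
    subst this
    exact ⟨rfl, by omega⟩
  · rintro ⟨rfl, rfl⟩; rfl

theorem _root_.VNEP.cell_eq_iff {r s : ℕ} {x y : Fin s} {F F' : Finset (Fin r)} :
    (x : ℕ) * 2 ^ r + enc F = y * 2 ^ r + enc F' ↔ x = y ∧ F = F' := by
  rw [index_eq_iff (enc_lt F) (enc_lt F'), Fin.ext_iff, enc_injective.eq_iff]

/-- Computes the values of all sets on all single nodes. -/
def _root_.VNEP.initProg : Prog :=
  .for_ 29 (.get 0 (.lit 2))
    (.setVar 28 (.get 15 (.var 29)) ;;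
    .for_ 24 (.var 14)
      (decodeProg ;;
      (.setVar 27 (.lit 1) ;; .setReal 8 (.lit 0) (.lit 0)) ;;
      loadProg 0 2 4 1 20 ;;
      .setNat 30 (.add (.get 16 (.var 29)) (.var 24)) (.var 27) ;;
      .setReal 10 (.add (.get 16 (.var 29)) (.var 24)) (.get 8 (.lit 0))))

theorem initProg_run {σ : State} (h : I.Ctx σ) :
    Run initProg σ ((s + 1) * (400 * ((2 ^ r + 1) * ((τ + 1) * (r + 1))))) (Table I.nodeVal) := by
  have hTr : 0 < (τ + 1) * (r + 1) := by positivity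
  have hTr' : r + 1 ≤ (τ + 1) * (r + 1) := Nat.le_mul_of_pos_left _ (by omega)
  refine (Run.for_ (J := fun n σ' => ∀ (x : Fin s) (F : Finset (Fin r)), (x : ℕ) < n →
    Val (σ'.nat 30 (x * 2 ^ r + enc F)) (σ'.real 10 (x * 2 ^ r + enc F)) (I.nodeVal x F))
    (T := 6 + (2 ^ r + 1) * ((200 * ((τ + 1) * (r + 1)) + 40) + 2 + 15)) s rfl ?_ ?_ ?_).conseq ?_ ?_
  · intro k σ1 _ hF1
    exact (h.framed hF1).subNodes
  · intro x F hx; omega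
  · intro k σ1 hJ hk hik hF1
    have c1 := h.framed hF1
    refine Run.seq ((Run.straight _ _ rfl).conseq (by simp [Prog.bound, NExp.time])
      fun σ2 h2 hF2 => ?_)
    have c2 := c1.framed hF2
    have e28 : σ2.nat 28 0 = k * τ := by
      subst h2
      simp [Prog.result, NExp.eval, hik, c1.mul k (by omega)]
    -- The cells are filled in lexicographic order: completely for the nodes before `k`, and up to
    -- code `n` for `k` itself.
    refine (Run.for_ (J := fun n σ' => (∀ (x : Fin s) (F : Finset (Fin r)),
      ((x : ℕ) < k ∨ (x : ℕ) = k ∧ enc F < n) →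
      Val (σ'.nat 30 (x * 2 ^ r + enc F)) (σ'.real 10 (x * 2 ^ r + enc F)) (I.nodeVal x F)))
      (T := 200 * ((τ + 1) * (r + 1)) + 40) (2 ^ r) rfl ?_ ?_ ?_).conseq (by rfl) ?_
    · intro k' σ3 _ hF3
      exact (c2.framed hF3).numSets
    · intro x F hx
      subst h2
      have := hJ x F (by omega)
      simpa [Prog.result] using this
    · intro n σ3 hJ3 hn hin hF3
      obtain ⟨S, hS⟩ := exists_enc_eq hn
      have c3 := c2.framed hF3
      refine (Run.seq (T := 100 * (r + 1)) (T' := 6 + (100 * ((τ + 1) * (r + 1)) + 25))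
        ((decodeProg_run c3 (hin.trans hS.symm)).conseq le_rfl
          fun σ4 h4 hF4 => ?_)).mono (by omega) fun _ h => h
      have c4 := c3.framed hF4
      refine Run.seq ((Run.straight _ _ rfl).conseq (by rfl) fun σ5 h5 hF5 => ?_)
      have c5 := c4.framed hF5
      have g28 : σ5.nat 28 0 = k * τ := by
        rw [hF5.nat 28 rfl, hF4.nat 28 rfl, hF3.nat 28 rfl, e28]
      refine Run.seq (T' := 25) ((loadProg_run (y := 0) I.nodeDemand (I.nodeCap ⟨k, hk⟩)
        (I.nodeCost ⟨k, hk⟩) S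
        (by omega) (by omega) (by omega) (by omega) c5.dim c5.reqNodes
        (fun j hj => c5.mul j (by omega)) c5.nodeDemand
        (fun k' => by rw [g28]; exact c5.nodeCap ⟨k, hk⟩ k')
        (fun k' => by rw [g28]; exact c5.nodeCost ⟨k, hk⟩ k')
        (fun w => by
          have := h4 w
          rw [hF5.nat 20 rfl, this]
          split <;> simp [*])
        (by subst h5; right; exact ⟨by simp [Prog.result, NExp.eval], 0, by
          simp [Prog.result, NExp.eval, RExp.eval], rfl⟩)).conseq le_rfl fun σ6 h6 hF6 => ?_)
      have c6 := c5.framed hF6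
      have g24 : σ6.nat 24 0 = n := by
        rw [hF6.nat 24 rfl, hF5.nat 24 rfl, hF4.nat 24 rfl, hin]
      have g29 : σ6.nat 29 0 = k := by
        rw [hF6.nat 29 rfl, hF5.nat 29 rfl, hF4.nat 29 rfl, hF3.nat 29 rfl, hF2.nat 29 rfl, hik]
      have g30 : σ6.nat 30 = σ3.nat 30 := by
        rw [hF6.nat 30 rfl, hF5.nat 30 rfl, hF4.nat 30 rfl]
      have g10 : σ6.real 10 = σ3.real 10 := by
        rw [hF6.real 10 rfl, hF5.real 10 rfl, hF4.real 10 rfl]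
      refine Run.of_straight rfl (by simp [Prog.bound, NExp.time, RExp.time]) fun x F hx => ?_
      rw [zero_add] at h6
      have hidx : (x : ℕ) * 2 ^ r + enc F = k * 2 ^ r + n ↔ (x : ℕ) = k ∧ F = S := by
        rw [index_eq_iff (enc_lt F) hn, ← hS, enc_injective.eq_iff]
      by_cases hc : (x : ℕ) = k ∧ F = S
      · obtain rfl : x = ⟨k, hk⟩ := Fin.ext hc.1
        obtain rfl := hc.2
        simpa [Prog.result, NExp.eval, RExp.eval, g29, g24, c6.base k hk, hS, nodeVal] using h6
      · have := hJ3 x F (by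
          rcases hx with hx | ⟨hx, hx'⟩
          · exact .inl hx
          · refine .inr ⟨hx, ?_⟩
            have : enc F ≠ n := fun he => hc ⟨hx, enc_injective (he.trans hS.symm)⟩
            omega)
        simpa [Prog.result, NExp.eval, RExp.eval, g29, g24, c6.base k hk, hidx, hc, g30, g10]
          using this
    · intro σ3 h3 _ x F hx
      have := h3 x F (by
        have := enc_lt F
        omega)
      simpa using this
  · simp only [NExp.time]
    refine Nat.mul_le_mul_left _ ?_
    have := Nat.mul_le_mul_left (2 ^ r + 1) (show 1 ≤ (τ + 1) * (r + 1) from hTr)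
    nlinarith [Nat.zero_le (2 ^ r)]
  · intro σ1 h1 _ x F
    exact h1 x F x.2

end Inst

end VNEP

namespace VNEP

open Elim
open scoped ENNReal

/-! ### The cost of cuts -/

/-- Adds the cost of sending the request edges from the decoded set to its complement through the
substrate edge in `ar`, if the flag in `fl` is set. -/
def linkProg (a b fl ar : ℕ) : Prog :=
  .for_ 29 (.get 0 (.lit 3))
    (.ite (.and (.natLe (.lit 1) (.get 20 (.get a (.var 29))))
        (.natLe (.get 20 (.get b (.var 29))) (.lit 0)))
      (.setNat 23 (.var 29) (.lit 1)) (.setNat 23 (.var 29) (.lit 0))) ;;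
  .ite (.natLe (.lit 1) (.get fl (.var 47)))
    (.setVar 28 (.get 15 (.get ar (.var 47))) ;; loadProg 1 3 5 3 23)
    (.for_ 29 (.get 0 (.lit 3))
      (.ite (.natLe (.lit 1) (.get 23 (.var 29))) (.setVar 27 (.lit 0)) .skip))

/-- Cell `v` of the arrays `fl` and `ar` represents the optional number `o`. -/
def OptAt {m : ℕ} (σ : State) (fl ar v : ℕ) (o : Option (Fin m)) : Prop :=
  (o = none → σ.nat fl v = 0) ∧ ∀ e, o = some e → σ.nat fl v = 1 ∧ σ.nat ar v = e

/-- Adds the cost of the cut between the node in variable `47` and its parent to all its values. -/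
def cutProg : Prog :=
  .for_ 24 (.var 14)
    (decodeProg ;;
    (.setVar 27 (.get 30 (.add (.get 16 (.var 47)) (.var 24))) ;;
      .setReal 8 (.lit 0) (.get 10 (.add (.get 16 (.var 47)) (.var 24)))) ;;
    linkProg 1 2 33 34 ;;
    linkProg 2 1 35 36 ;;
    .setNat 30 (.add (.get 16 (.var 47)) (.var 24)) (.var 27) ;;
    .setReal 10 (.add (.get 16 (.var 47)) (.var 24)) (.get 8 (.lit 0)))

namespace Inst

variable {τ r s : ℕ} {I : Inst τ r s}

/-- No two request edges share source and target. This bound keeps the work per cut quadratic in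
`r`. -/
theorem size_request_le (I : Inst τ r s) : I.request.size ≤ r * r := by
  have := Fintype.card_le_of_injective _ I.request.simple
  simpa using this

/-- The functions `f` and `g` are source and target of the request edges in either order, so one
program serves both the edges that leave `F` and those that enter it. -/
theorem linkProg_run {a b fl ar v : ℕ} {σ : State} (h : I.Ctx σ) {F : Finset (Fin r)}
    (hF : Indicator F σ) (hv : σ.nat 47 0 = v) {o : Option (Fin I.substrate.size)}
    (ho : OptAt σ fl ar v o) (J : Finset (Fin I.request.size))
    (hab : a < 5 ∧ b < 5) (hfl : 30 ≤ fl ∧ 30 ≤ ar) (f g : Fin I.request.size → Fin r)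
    (hf : ∀ e : Fin I.request.size, σ.nat a e = f e)
    (hg : ∀ e : Fin I.request.size, σ.nat b e = g e)
    (hJ : ∀ e, e ∈ J ↔ f e ∈ F ∧ g e ∉ F) {y : ℝ≥0∞} (hV : Val (σ.nat 27 0) (σ.real 8 0) y) :
    Run (linkProg a b fl ar) σ (300 * ((τ + 1) * (I.request.size + 1)))
      fun σ' => Val (σ'.nat 27 0) (σ'.real 8 0) (y + I.linkVal o J) := by
  refine (Run.seq (T := (I.request.size + 1) * (60 + 2 + 15))
    (T' := BExp.time (.natLe (.lit 1) (.get fl (.var 47))) + 1 +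
      (10 + 100 * ((τ + 1) * (I.request.size + 1)))) ((Run.for_
    (J := fun n σ' => ∀ e : Fin I.request.size, (e : ℕ) < n → (1 ≤ σ'.nat 23 e ↔ e ∈ J))
    I.request.size rfl ?_ ?_ ?_).conseq (by rfl) fun σ1 h1 hF1 => ?_)).mono ?_ fun _ h => h
  · intro k σ1 _ hF1
    exact (h.framed hF1).reqEdges
  · intro e he; omega
  · intro k σ1 hJ1 hk hik hF1
    have ea : σ1.nat a k = f ⟨k, hk⟩ := by
      rw [hF1.nat a (by simp [Prog.for_, Prog.natWrites]; omega)]; exact hf ⟨k, hk⟩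
    have eb : σ1.nat b k = g ⟨k, hk⟩ := by
      rw [hF1.nat b (by simp [Prog.for_, Prog.natWrites]; omega)]; exact hg ⟨k, hk⟩
    have e20 : ∀ w : Fin r, σ1.nat 20 w = if w ∈ F then 1 else 0 := fun w => by
      rw [hF1.nat 20 rfl]; exact hF w
    refine Run.of_straight rfl (by simp [Prog.bound, BExp.time, NExp.time]) fun e he => ?_
    have hcond : (1 ≤ σ1.nat 20 (f ⟨k, hk⟩) ∧ σ1.nat 20 (g ⟨k, hk⟩) ≤ 0) ↔ ⟨k, hk⟩ ∈ J := by
      rw [e20, e20, hJ]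
      by_cases h1 : f ⟨k, hk⟩ ∈ F <;> by_cases h2 : g ⟨k, hk⟩ ∈ F <;> simp [h1, h2]
    simp only [Prog.result, BExp.holds_and, BExp.holds_natLe, NExp.eval, hik, ea, eb, hcond]
    by_cases hek : (e : ℕ) = k
    · obtain rfl : e = ⟨k, hk⟩ := Fin.ext hek
      split <;> rename_i hc <;> simp [hc]
    · have := hJ1 e (by omega)
      split <;> simp [hek, this]
  · have c1 := h.framed hF1
    have e47 : σ1.nat 47 0 = v := by rw [hF1.nat 47 rfl, hv]
    have efl : σ1.nat fl = σ.nat fl := hF1.nat fl (by simp [Prog.for_, Prog.natWrites]; omega)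
    have ear : σ1.nat ar = σ.nat ar := hF1.nat ar (by simp [Prog.for_, Prog.natWrites]; omega)
    have hV1 : Val (σ1.nat 27 0) (σ1.real 8 0) y := by rwa [hF1.nat 27 rfl, hF1.real 8 rfl]
    refine Run.ite (fun hb => ?_) fun hb => ?_
    · simp only [BExp.holds_natLe, NExp.eval, e47, efl] at hb
      obtain ⟨e, rfl⟩ : ∃ e, o = some e := by
        refine Option.ne_none_iff_exists'.1 fun hn => ?_
        have := ho.1 hn
        omega
      have hee := (ho.2 e rfl).2
      refine Run.seq ((Run.straight _ _ rfl).conseq (by simp [Prog.bound, NExp.time])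
        fun σ2 h2 hF2 => ?_)
      have c2 := c1.framed hF2
      have e28 : σ2.nat 28 0 = e * τ := by
        have := c1.mul e (by omega)
        subst h2
        simp [Prog.result, NExp.eval, e47, ear, hee, this]
      exact loadProg_run I.edgeDemand (I.edgeCap e) (I.edgeCost e) J
        (by omega) (by omega) (by omega) (by omega) c2.dim c2.reqEdges
        (fun j hj => c2.mul j (by omega)) c2.edgeDemand
        (fun k' => by rw [e28]; exact c2.edgeCap e k')
        (fun k' => by rw [e28]; exact c2.edgeCost e k')
        (fun w => by rw [hF2.nat 23 rfl]; exact h1 w w.2)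
        (by rwa [hF2.nat 27 rfl, hF2.real 8 rfl])
    · simp only [BExp.holds_natLe, NExp.eval, e47, efl] at hb
      have hn : o = none := by
        by_contra hc
        obtain ⟨e, rfl⟩ := Option.ne_none_iff_exists'.1 hc
        exact hb (ho.2 e rfl).1.ge
      subst hn
      -- Without a link, the value becomes infinite at the first selected request edge.
      refine (Run.for_ (J := fun n σ' => Val (σ'.nat 27 0) (σ'.real 8 0)
        (y + if ∃ e ∈ J, (e : ℕ) < n then ⊤ else 0)) (T := 20) I.request.size rfl
        ?_ ?_ ?_).conseq ?_ ?_
      · intro k σ2 _ hF2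
        exact (c1.framed hF2).reqEdges
      · simpa using hV1
      · intro k σ2 hJ2 hk hik hF2
        have e23 : 1 ≤ σ2.nat 23 k ↔ ⟨k, hk⟩ ∈ J := by
          rw [hF2.nat 23 rfl]; exact h1 ⟨k, hk⟩ hk
        refine Run.of_straight rfl (by simp [Prog.bound, BExp.time, NExp.time]) ?_
        simp only [Prog.result, BExp.holds_natLe, NExp.eval, hik, e23]
        by_cases hkJ : (⟨k, hk⟩ : Fin I.request.size) ∈ J
        · have : ∃ e ∈ J, (e : ℕ) < k + 1 := ⟨_, hkJ, by simp⟩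
          rw [if_pos hkJ, if_pos this]
          left; simp
        · have : (∃ e ∈ J, (e : ℕ) < k + 1) ↔ ∃ e ∈ J, (e : ℕ) < k := by
            refine ⟨fun ⟨e, he, h⟩ => ⟨e, he, ?_⟩, fun ⟨e, he, h⟩ => ⟨e, he, by omega⟩⟩
            have : (e : ℕ) ≠ k := fun hc => hkJ (by rwa [show e = ⟨k, hk⟩ from Fin.ext hc] at he)
            omega
          rw [if_neg hkJ]
          simp only [this]
          simpa using hJ2
      · simp only [NExp.time]; nlinarith
      · intro σ2 h2 _
        have : (∃ e ∈ J, (e : ℕ) < I.request.size) ↔ J ≠ ∅ := by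
          rw [← Finset.nonempty_iff_ne_empty]
          exact ⟨fun ⟨e, he, _⟩ => ⟨e, he⟩, fun ⟨e, he⟩ => ⟨e, he, e.2⟩⟩
        simp only [this] at h2
        rw [linkVal]
        by_cases hJe : J = ∅
        · simpa [hJe] using h2
        · simpa [hJe] using h2
  · simp only [BExp.time, NExp.time]
    nlinarith [Nat.zero_le (τ * I.request.size)]

theorem cutProg_run {σ : State} (h : I.Ctx σ) {G : Fin s → Finset (Fin r) → ℝ≥0∞}
    (hG : Table G σ) {ε : Elim r s I.substrate.size} (hv : σ.nat 47 0 = ε.v)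
    (hup : OptAt σ 33 34 ε.v ε.up) (hdown : OptAt σ 35 36 ε.v ε.down) :
    Run cutProg σ (900 * ((2 ^ r + 1) * ((τ + 1) * ((r + 1) * (r + 1)))))
      (Table (Function.update G ε.v fun S => G ε.v S + I.cutVal ε S)) := by
  have hsz := I.size_request_le
  have hsz' : (τ + 1) * (I.request.size + 1) ≤ (τ + 1) * ((r + 1) * (r + 1)) :=
    Nat.mul_le_mul_left _ (by nlinarith)
  have hr1 : r + 1 ≤ (τ + 1) * ((r + 1) * (r + 1)) := by nlinarith [Nat.zero_le (τ * (r + 1) * (r + 1))]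
  -- The table is updated in place: the cells of `ε.v` with code below `n` already contain the cut
  -- cost, all others are still old.
  refine (Run.for_ (J := fun n σ' => ∀ (x : Fin s) (F : Finset (Fin r)),
    Val (σ'.nat 30 (x * 2 ^ r + enc F)) (σ'.real 10 (x * 2 ^ r + enc F))
      (G x F + if x = ε.v ∧ enc F < n then I.cutVal ε F else 0))
    (T := 700 * ((τ + 1) * ((r + 1) * (r + 1))) + 70) (2 ^ r) rfl ?_ ?_ ?_).conseq ?_ ?_
  · intro k' σ3 _ hF3
    exact (h.framed hF3).numSets
  · intro x F
    simpa using hG x F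
  · intro n σ3 hJ3 hn hin hF3
    obtain ⟨S, hS⟩ := exists_enc_eq hn
    have c3 := h.framed hF3
    refine (Run.seq (T := 100 * (r + 1))
      (T' := 30 + (300 * ((τ + 1) * (I.request.size + 1)) +
        (300 * ((τ + 1) * (I.request.size + 1)) + 40)))
      ((decodeProg_run c3 (hin.trans hS.symm)).conseq le_rfl
        fun σ4 h4 hF4 => ?_)).mono (by omega) fun _ h => h
    have c4 := c3.framed hF4
    have b47 : σ4.nat 47 0 = ε.v := by rw [hF4.nat 47 rfl, hF3.nat 47 rfl, hv]
    have b24 : σ4.nat 24 0 = n := by rw [hF4.nat 24 rfl, hin]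
    refine Run.seq ((Run.straight _ _ rfl).conseq (by simp [Prog.bound, NExp.time, RExp.time])
      fun σ5 h5 hF5 => ?_)
    have c5 := c4.framed hF5
    have v5 : Val (σ5.nat 27 0) (σ5.real 8 0) (G ε.v S) := by
      have := hJ3 ε.v S
      rw [if_neg (by omega), add_zero, hS] at this
      subst h5
      simpa [Prog.result, NExp.eval, RExp.eval, b47, b24, c4.base ε.v ε.v.2, hF4.nat 30 rfl,
        hF4.real 10 rfl] using this
    have i5 : Indicator S σ5 := fun w => by rw [hF5.nat 20 rfl]; exact h4 w
    have d47 : σ5.nat 47 0 = ε.v := by rw [hF5.nat 47 rfl, b47]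
    have u5 : OptAt σ5 33 34 ε.v ε.up := by
      unfold OptAt
      rw [hF5.nat 33 rfl, hF4.nat 33 rfl, hF3.nat 33 rfl, hF5.nat 34 rfl, hF4.nat 34 rfl,
        hF3.nat 34 rfl]
      exact hup
    have w5 : OptAt σ5 35 36 ε.v ε.down := by
      unfold OptAt
      rw [hF5.nat 35 rfl, hF4.nat 35 rfl, hF3.nat 35 rfl, hF5.nat 36 rfl, hF4.nat 36 rfl,
        hF3.nat 36 rfl]
      exact hdown
    refine Run.seq ((linkProg_run c5 i5 d47 u5 (I.leaving S) (by omega) (by omega)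
      I.request.src I.request.dst c5.reqSrc c5.reqDst (by simp [leaving]) v5).conseq le_rfl
      fun σ6 v6 hF6 => ?_)
    have c6 := c5.framed hF6
    have i6 : Indicator S σ6 := fun w => by rw [hF6.nat 20 rfl]; exact i5 w
    have d6 : σ6.nat 47 0 = ε.v := by rw [hF6.nat 47 rfl, d47]
    have w6 : OptAt σ6 35 36 ε.v ε.down := by
      unfold OptAt
      rw [hF6.nat 35 rfl, hF6.nat 36 rfl]
      exact w5
    refine Run.seq ((linkProg_run c6 i6 d6 w6 (I.entering S) (by omega) (by omega)
      I.request.dst I.request.src c6.reqDst c6.reqSrc (by simp [entering, and_comm]) v6).conseq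
      le_rfl fun σ7 v7 hF7 => ?_)
    have c7 := c6.framed hF7
    have d7 : σ7.nat 47 0 = ε.v := by rw [hF7.nat 47 rfl, d6]
    have g24 : σ7.nat 24 0 = n := by
      rw [hF7.nat 24 rfl, hF6.nat 24 rfl, hF5.nat 24 rfl, b24]
    have g30 : σ7.nat 30 = σ3.nat 30 := by
      rw [hF7.nat 30 rfl, hF6.nat 30 rfl, hF5.nat 30 rfl, hF4.nat 30 rfl]
    have g10 : σ7.real 10 = σ3.real 10 := by
      rw [hF7.real 10 rfl, hF6.real 10 rfl, hF5.real 10 rfl, hF4.real 10 rfl]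
    refine Run.of_straight rfl (by simp [Prog.bound, NExp.time, RExp.time]) fun x F => ?_
    have hidx : (x : ℕ) * 2 ^ r + enc F = ε.v * 2 ^ r + n ↔ x = ε.v ∧ F = S := by
      rw [← hS, cell_eq_iff]
    by_cases hc : x = ε.v ∧ F = S
    · obtain ⟨rfl, rfl⟩ := hc
      rw [add_assoc] at v7
      have : enc F < n + 1 := by omega
      simpa [Prog.result, NExp.eval, RExp.eval, d7, g24, c7.base ε.v ε.v.2, hS, cutVal, this]
        using v7
    · have h3 := hJ3 x F
      have : (x = ε.v ∧ enc F < n + 1) ↔ (x = ε.v ∧ enc F < n) := by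
        have : x = ε.v → enc F ≠ n := fun hx he => hc ⟨hx, enc_injective (he.trans hS.symm)⟩
        constructor
        · rintro ⟨h1, h2⟩; have := this h1; exact ⟨h1, by omega⟩
        · rintro ⟨h1, h2⟩; exact ⟨h1, by omega⟩
      simp only [this]
      simpa [Prog.result, NExp.eval, RExp.eval, d7, g24, c7.base ε.v ε.v.2, hidx, hc, g30, g10]
        using h3
  · have h1 : 1 ≤ (τ + 1) * ((r + 1) * (r + 1)) := by omega
    simp only [NExp.time]
    generalize (τ + 1) * ((r + 1) * (r + 1)) = X at *
    rw [mul_left_comm]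
    exact Nat.mul_le_mul_left _ (by omega)
  · intro σ1 h1 _ x F
    have := h1 x F
    by_cases hx : x = ε.v
    · subst hx
      simpa [enc_lt] using this
    · simpa [hx] using this

end Inst

end VNEP

namespace VNEP

open Elim
open scoped ENNReal

/-! ### Merging the values of two nodes -/

/-- Merges the values of the node in variable `47` into those of the node in variable `48`. -/
def mergeProg : Prog :=
  .for_ 24 (.var 14)
    (.setNat 32 (.var 24) (.lit 0) ;;
      .setNat 31 (.add (.get 16 (.var 47)) (.var 24)) (.lit 0)) ;;
  .for_ 24 (.var 13)
    (.ite (.and (.natLe (.lit 1) (.get 30 (.add (.get 16 (.var 47)) (.get 11 (.var 24)))))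
        (.natLe (.lit 1) (.get 30 (.add (.get 16 (.var 48)) (.get 12 (.var 24))))))
      (.setReal 7 (.lit 0) (.add (.get 10 (.add (.get 16 (.var 47)) (.get 11 (.var 24))))
          (.get 10 (.add (.get 16 (.var 48)) (.get 12 (.var 24))))) ;;
        .setVar 21 (.add (.get 11 (.var 24)) (.get 12 (.var 24))) ;;
        .ite (.and (.natLe (.lit 1) (.get 32 (.var 21)))
            (.realLe (.get 11 (.var 21)) (.get 7 (.lit 0))))
          .skip
          (.setNat 32 (.var 21) (.lit 1) ;; .setReal 11 (.var 21) (.get 7 (.lit 0)) ;;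
            .setNat 31 (.add (.get 16 (.var 47)) (.var 21)) (.get 11 (.var 24))))
      .skip) ;;
  .for_ 24 (.var 14)
    (.setNat 30 (.add (.get 16 (.var 48)) (.var 24)) (.get 32 (.var 24)) ;;
      .setReal 10 (.add (.get 16 (.var 48)) (.var 24)) (.get 11 (.var 24)))

namespace Inst

variable {τ r s : ℕ} {I : Inst τ r s}

/-- The memory during a merge: the values `X` found so far, and the choices `ch` that attain
them. -/
structure Merging (G : Fin s → Finset (Fin r) → ℝ≥0∞) (v p : Fin s)
    (X : Finset (Fin r) → ℝ≥0∞) (ch : Finset (Fin r) → Finset (Fin r)) (σ₀ σ : State) : Prop where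
  val : ∀ S, Val (σ.nat 32 (enc S)) (σ.real 11 (enc S)) (X S)
  choice : ∀ S, σ.nat 31 (v * 2 ^ r + enc S) = enc (ch S)
  subset : ∀ S, ch S ⊆ S
  attained : ∀ S, G p (S \ ch S) + G v (ch S) ≤ X S
  other : ∀ x, x ≠ v → ∀ S : Finset (Fin r),
    σ.nat 31 (x * 2 ^ r + enc S) = σ₀.nat 31 (x * 2 ^ r + enc S)

/-- A running minimum over all disjoint pairs `(T, U)`, kept in the cell of `T ∪ U`, whose code is
`enc T + enc U`. The pairs with union `S` correspond to the subsets `T` of `S`, so one pass through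
the list yields all minima. The minima stand in a scratch row until the pass is over, because the
old values of `p` are read throughout. -/
theorem mergeProg_run {σ : State} (h : I.Ctx σ) {G : Fin s → Finset (Fin r) → ℝ≥0∞}
    (hG : Table G σ) {v p : Fin s} (hvp : v ≠ p) (hv : σ.nat 47 0 = v) (hp : σ.nat 48 0 = p) :
    Run mergeProg σ (500 * 3 ^ r) fun σ' => ∃ X ch, Merging G v p X ch σ σ' ∧
      (∀ S T, T ⊆ S → X S ≤ G p (S \ T) + G v T) ∧ Table (Function.update G p X) σ' := by
  have hle : 2 ^ r ≤ 3 ^ r := Nat.pow_le_pow_left (by omega) r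
  have hpos : 1 ≤ 2 ^ r := Nat.one_le_two_pow
  refine (Run.seq (T := (2 ^ r + 1) * (20 + 2 + 15)) (T' := (3 ^ r + 1) * (120 + 2 + 15) +
    (2 ^ r + 1) * (30 + 2 + 15))
    ((Run.for_ (J := fun n σ' => (∀ S : Finset (Fin r), enc S < n → σ'.nat 32 (enc S) = 0 ∧
        σ'.nat 31 (v * 2 ^ r + enc S) = 0) ∧
      ∀ x, x ≠ v → ∀ S : Finset (Fin r),
        σ'.nat 31 (x * 2 ^ r + enc S) = σ.nat 31 (x * 2 ^ r + enc S))
      (2 ^ r) rfl ?_ ?_ ?_).conseq (by rfl) fun σ1 h1 hF1 => ?_)).mono ?_ fun _ h => h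
  · intro k σ1 _ hF1
    exact (h.framed hF1).numSets
  · simp
  · rintro k σ1 ⟨k1, k2⟩ hk hik hF1
    obtain ⟨R, hR⟩ := exists_enc_eq hk
    have c1 := h.framed hF1
    have e47 : σ1.nat 47 0 = v := by rw [hF1.nat 47 rfl, hv]
    refine Run.of_straight rfl (by simp [Prog.bound, NExp.time]) ⟨fun S hS => ?_, fun x hx S => ?_⟩
    · have e1 : enc S = k ↔ S = R := by rw [← hR, enc_injective.eq_iff]
      by_cases hSR : S = R
      · subst hSR
        simp [Prog.result, NExp.eval, hik, hR, e47, c1.base v v.2]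
      · have := k1 S (by
          have : enc S ≠ k := fun he => hSR (e1.1 he)
          omega)
        simp [Prog.result, NExp.eval, hik, e1, hSR, e47, c1.base v v.2, this]
    · have e1 : (x : ℕ) * 2 ^ r + enc S ≠ v * 2 ^ r + k := by
        rw [← hR, Ne, cell_eq_iff]; exact fun h => hx h.1
      simp [Prog.result, NExp.eval, hik, e47, c1.base v v.2, e1, k2 x hx S]
  · have c1 := h.framed hF1
    have e47 : σ1.nat 47 0 = v := by rw [hF1.nat 47 rfl, hv]
    have e48 : σ1.nat 48 0 = p := by rw [hF1.nat 48 rfl, hp]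
    have t1 : Table G σ1 := by
      unfold Table
      rw [hF1.nat 30 rfl, hF1.real 10 rfl]
      exact hG
    refine Run.seq ((Run.for_ (J := fun n σ' => ∃ X ch, Merging G v p X ch σ σ' ∧
      ∀ k < n, ∀ T U, Disjoint T U → σ'.nat 11 k = enc T → σ'.nat 12 k = enc U →
        X (T ∪ U) ≤ G p U + G v T)
      (3 ^ r) rfl ?_ ?_ ?_).conseq (by rfl) fun σ2 h2 hF2 => ?_)
    · intro k σ2 _ hF2
      exact (c1.framed hF2).numPairs
    -- Before any pair is seen, every minimum is infinite and the recorded choice is the empty set,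
    -- whose code is the `0` just written.
    · refine ⟨fun _ => ⊤, fun _ => ∅, ⟨fun S => .inl ⟨?_, rfl⟩, fun S => ?_, fun S => by simp,
        fun S => le_top, fun x hx S => ?_⟩, by simp⟩
      · simpa using (h1.1 S (enc_lt S)).1
      · simpa using (h1.1 S (enc_lt S)).2
      · simpa using h1.2 x hx S
    · rintro k σ2 ⟨X, ch, hM, hX⟩ hk hik hF2
      have c2 := c1.framed hF2
      have f47 : σ2.nat 47 0 = v := by rw [hF2.nat 47 rfl, e47]
      have f48 : σ2.nat 48 0 = p := by rw [hF2.nat 48 rfl, e48]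
      have t2 : Table G σ2 := by
        unfold Table
        rw [hF2.nat 30 rfl, hF2.real 10 rfl]
        exact t1
      obtain ⟨T, U, hTU, eT, eU⟩ := c2.pair k hk
      have hUT : (T ∪ U) \ T = U := by
        rw [Finset.union_sdiff_left]; exact hTU.symm.sdiff_eq_left
      have huniq : ∀ T' U' : Finset (Fin r), σ2.nat 11 k = enc T' → σ2.nat 12 k = enc U' →
          T' = T ∧ U' = U := fun T' U' h1 h2 =>
        ⟨enc_injective (h1.symm.trans eT), enc_injective (h2.symm.trans eU)⟩
      have bv := c2.base v v.2
      have bp := c2.base p p.2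
      refine Run.of_straight rfl (by simp [Prog.bound, BExp.time, NExp.time, RExp.time]) ?_
      by_cases hfl : 1 ≤ σ2.nat 30 (v * 2 ^ r + enc T) ∧ 1 ≤ σ2.nat 30 (p * 2 ^ r + enc U)
      · obtain ⟨z, hz, hz'⟩ : ∃ z : ℝ≥0, σ2.real 10 (v * 2 ^ r + enc T) = z ∧ G v T = z := by
          rcases t2 v T with h | h
          · omega
          · exact h.2
        obtain ⟨z', hy, hy'⟩ : ∃ z : ℝ≥0, σ2.real 10 (p * 2 ^ r + enc U) = z ∧ G p U = z := by
          rcases t2 p U with h | h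
          · omega
          · exact h.2
        by_cases hkeep : 1 ≤ σ2.nat 32 (enc (T ∪ U)) ∧ σ2.real 11 (enc (T ∪ U)) ≤ z + z'
        · rw [enc_union hTU] at hkeep
          refine ⟨X, ch, ⟨?_, ?_, ?_, ?_, ?_⟩, ?_⟩
          · intro S
            simpa [Prog.result, NExp.eval, RExp.eval, hik, eT, eU, f47, f48, bv, bp, hfl, hz, hy,
              hkeep] using hM.val S
          · intro S
            simpa [Prog.result, NExp.eval, RExp.eval, hik, eT, eU, f47, f48, bv, bp, hfl, hz, hy,
              hkeep] using hM.choice S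
          · exact hM.subset
          · exact hM.attained
          · intro x hx S
            simpa [Prog.result, NExp.eval, RExp.eval, hik, eT, eU, f47, f48, bv, bp, hfl, hz, hy,
              hkeep] using hM.other x hx S
          · intro k' hk' T' U' hTU' h1 h2
            have h1' : σ2.nat 11 k' = enc T' := by
              simpa [Prog.result, NExp.eval, RExp.eval, hik, eT, eU, f47, f48, bv, bp, hfl, hz, hy,
                hkeep] using h1
            have h2' : σ2.nat 12 k' = enc U' := by
              simpa [Prog.result, NExp.eval, RExp.eval, hik, eT, eU, f47, f48, bv, bp, hfl, hz, hy,
                hkeep] using h2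
            rcases Nat.lt_succ_iff_lt_or_eq.1 hk' with hk' | rfl
            · exact hX k' hk' T' U' hTU' h1' h2'
            · obtain ⟨rfl, rfl⟩ := huniq T' U' h1' h2'
              rw [hz', hy']
              rcases hM.val (T' ∪ U') with h | ⟨_, w, hw, hw'⟩
              · rw [enc_union hTU] at h; omega
              · rw [hw']
                rw [enc_union hTU] at hw
                rw [hw] at hkeep
                have := hkeep.2
                rw [add_comm]
                exact_mod_cast this
        -- Either nothing finite is stored yet or the stored number is larger. In both cases
        -- overwriting only lowers the value, so the bounds from earlier pairs survive.
        · have hXle : G p U + G v T ≤ X (T ∪ U) := by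
            rw [hz', hy']
            rcases hM.val (T ∪ U) with ⟨_, h⟩ | ⟨h, w, hw, hw'⟩
            · rw [h]; exact le_top
            · rw [hw']
              rw [hw] at hkeep
              have := fun h' => hkeep ⟨h, h'⟩
              rw [add_comm]
              have := (not_le.1 this).le
              exact_mod_cast this
          rw [enc_union hTU] at hkeep
          refine ⟨Function.update X (T ∪ U) (G p U + G v T), Function.update ch (T ∪ U) T,
            ⟨?_, ?_, ?_, ?_, ?_⟩, ?_⟩
          · intro S
            by_cases hS : S = T ∪ U
            · subst hS
              rw [Function.update_self, enc_union hTU]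
              refine .inr ⟨?_, z + z', ?_, ?_⟩
              · simp [Prog.result, NExp.eval, RExp.eval, hik, eT, eU, f47, f48, bv, bp, hfl, hz, hy,
                  hkeep]
              · simp [Prog.result, NExp.eval, RExp.eval, hik, eT, eU, f47, f48, bv, bp, hfl, hz, hy,
                  hkeep]
              · rw [hz', hy', add_comm]; norm_cast
            · have hne : enc S ≠ enc T + enc U := by
                rw [← enc_union hTU]; exact fun h => hS (enc_injective h)
              rw [Function.update_of_ne hS]
              simpa [Prog.result, NExp.eval, RExp.eval, hik, eT, eU, f47, f48, bv, bp, hfl, hz, hy,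
                hkeep, hne] using hM.val S
          · intro S
            by_cases hS : S = T ∪ U
            · subst hS
              rw [Function.update_self, enc_union hTU]
              simp [Prog.result, NExp.eval, RExp.eval, hik, eT, eU, f47, f48, bv, bp, hfl, hz, hy,
                hkeep]
            · have hne : enc S ≠ enc T + enc U := by
                rw [← enc_union hTU]; exact fun h => hS (enc_injective h)
              rw [Function.update_of_ne hS]
              simpa [Prog.result, NExp.eval, RExp.eval, hik, eT, eU, f47, f48, bv, bp, hfl, hz, hy,
                hkeep, hne] using hM.choice S
          · intro S
            by_cases hS : S = T ∪ U
            · subst hS; simp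
            · rw [Function.update_of_ne hS]; exact hM.subset S
          · intro S
            by_cases hS : S = T ∪ U
            · subst hS; simp [hUT]
            · rw [Function.update_of_ne hS, Function.update_of_ne hS]; exact hM.attained S
          · intro x hx S
            have hne : (x : ℕ) * 2 ^ r + enc S ≠ v * 2 ^ r + (enc T + enc U) := by
              rw [← enc_union hTU, Ne, cell_eq_iff]; exact fun h => hx h.1
            simpa [Prog.result, NExp.eval, RExp.eval, hik, eT, eU, f47, f48, bv, bp, hfl, hz, hy,
              hkeep, hne] using hM.other x hx S
          · have hmono : ∀ S, Function.update X (T ∪ U) (G p U + G v T) S ≤ X S := fun S => by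
              by_cases hS : S = T ∪ U
              · subst hS; rwa [Function.update_self]
              · rw [Function.update_of_ne hS]
            intro k' hk' T' U' hTU' h1 h2
            have h1' : σ2.nat 11 k' = enc T' := by
              simpa [Prog.result, NExp.eval, RExp.eval, hik, eT, eU, f47, f48, bv, bp, hfl, hz, hy,
                hkeep] using h1
            have h2' : σ2.nat 12 k' = enc U' := by
              simpa [Prog.result, NExp.eval, RExp.eval, hik, eT, eU, f47, f48, bv, bp, hfl, hz, hy,
                hkeep] using h2
            rcases Nat.lt_succ_iff_lt_or_eq.1 hk' with hk' | rfl
            · exact (hmono _).trans (hX k' hk' T' U' hTU' h1' h2')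
            · obtain ⟨rfl, rfl⟩ := huniq T' U' h1' h2'
              rw [Function.update_self]
      -- A flag that is not set stands for an infinite summand, so skipping this pair loses nothing.
      · have htop : G p U + G v T = ⊤ := by
          rw [not_and_or] at hfl
          rcases hfl with hfl | hfl
          · rcases t2 v T with h | h
            · rw [h.2, add_top]
            · exact absurd h.1 hfl
          · rcases t2 p U with h | h
            · rw [h.2, top_add]
            · exact absurd h.1 hfl
        refine ⟨X, ch, ⟨?_, ?_, ?_, ?_, ?_⟩, ?_⟩
        · intro S
          simpa [Prog.result, NExp.eval, hik, eT, eU, f47, f48, bv, bp, hfl] using hM.val S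
        · intro S
          simpa [Prog.result, NExp.eval, hik, eT, eU, f47, f48, bv, bp, hfl] using hM.choice S
        · exact hM.subset
        · exact hM.attained
        · intro x hx S
          simpa [Prog.result, NExp.eval, hik, eT, eU, f47, f48, bv, bp, hfl] using hM.other x hx S
        · intro k' hk' T' U' hTU' h1 h2
          have h1' : σ2.nat 11 k' = enc T' := by
            simpa [Prog.result, NExp.eval, hik, eT, eU, f47, f48, bv, bp, hfl] using h1
          have h2' : σ2.nat 12 k' = enc U' := by
            simpa [Prog.result, NExp.eval, hik, eT, eU, f47, f48, bv, bp, hfl] using h2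
          rcases Nat.lt_succ_iff_lt_or_eq.1 hk' with hk' | rfl
          · exact hX k' hk' T' U' hTU' h1' h2'
          · obtain ⟨rfl, rfl⟩ := huniq T' U' h1' h2'
            rw [htop]; exact le_top
    · obtain ⟨X, ch, hM, hX⟩ := h2
      have c2 := c1.framed hF2
      have f48 : σ2.nat 48 0 = p := by rw [hF2.nat 48 rfl, e48]
      have t2 : Table G σ2 := by
        unfold Table
        rw [hF2.nat 30 rfl, hF2.real 10 rfl]
        exact t1
      refine (Run.for_ (J := fun n σ' => ∀ (x : Fin s) (F : Finset (Fin r)),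
        Val (σ'.nat 30 (x * 2 ^ r + enc F)) (σ'.real 10 (x * 2 ^ r + enc F))
          (if x = p ∧ enc F < n then X F else G x F))
        (2 ^ r) rfl ?_ ?_ ?_).conseq (by rfl) fun σ3 h3 hF3 => ?_
      · intro k σ3 _ hF3
        exact (c2.framed hF3).numSets
      · intro x F
        simpa using t2 x F
      · intro k σ3 hJ hk hik hF3
        obtain ⟨R, hR⟩ := exists_enc_eq hk
        have c3 := c2.framed hF3
        have g48 : σ3.nat 48 0 = p := by rw [hF3.nat 48 rfl, f48]
        refine Run.of_straight rfl (by simp [Prog.bound, NExp.time, RExp.time]) fun x F => ?_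
        have hidx : (x : ℕ) * 2 ^ r + enc F = p * 2 ^ r + k ↔ x = p ∧ F = R := by
          rw [← hR, cell_eq_iff]
        by_cases hc : x = p ∧ F = R
        · obtain ⟨rfl, rfl⟩ := hc
          have hv := hM.val F
          rw [← hF3.nat 32 rfl, ← hF3.real 11 rfl] at hv
          have : enc F < k + 1 := by omega
          simpa [Prog.result, NExp.eval, RExp.eval, hik, g48, c3.base x x.2, hR, this] using hv
        · have hj := hJ x F
          have : (x = p ∧ enc F < k + 1) ↔ (x = p ∧ enc F < k) := by
            have : x = p → enc F ≠ k := fun hx he => hc ⟨hx, enc_injective (he.trans hR.symm)⟩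
            constructor
            · rintro ⟨h1, h2⟩; have := this h1; exact ⟨h1, by omega⟩
            · rintro ⟨h1, h2⟩; exact ⟨h1, by omega⟩
          simp only [this]
          simpa [Prog.result, NExp.eval, RExp.eval, hik, g48, c3.base p p.2, hidx, hc] using hj
      · refine ⟨X, ch, ⟨?_, ?_, hM.subset, hM.attained, ?_⟩, ?_, ?_⟩
        · rw [hF3.nat 32 rfl, hF3.real 11 rfl]; exact hM.val
        · rw [hF3.nat 31 rfl]; exact hM.choice
        · rw [hF3.nat 31 rfl]; exact hM.other
        · intro S T hTS
          -- The pair `(T, S \ T)` occurs in the list, and its union is `S`.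
          obtain ⟨k, hk, h1, h2⟩ := c2.exists_pair T (S \ T) Finset.disjoint_sdiff
          have := hX k hk T (S \ T) Finset.disjoint_sdiff h1 h2
          rwa [Finset.union_sdiff_of_subset hTS] at this
        · intro x F
          have := h3 x F
          by_cases hx : x = p
          · subst hx; simpa [enc_lt] using this
          · simpa [hx] using this
  · omega

end Inst

end VNEP

namespace VNEP

open Elim
open scoped ENNReal

/-! ### Elimination of all leaves -/

/-- Counts the edges at each node, and adds up their numbers. -/
def degreesProg : Prog :=
  .for_ 29 (.get 0 (.lit 4))
    (.setNat 33 (.get 3 (.var 29)) (.add (.get 33 (.get 3 (.var 29))) (.lit 1)) ;;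
    .setNat 34 (.get 3 (.var 29)) (.add (.get 34 (.get 3 (.var 29))) (.var 29)) ;;
    .setNat 35 (.get 4 (.var 29)) (.add (.get 35 (.get 4 (.var 29))) (.lit 1)) ;;
    .setNat 36 (.get 4 (.var 29)) (.add (.get 36 (.get 4 (.var 29))) (.var 29)))

/-- Removes the edge in cell `47` of `ar` from all counts and sums, if there is one. -/
def eraseProg (fl ar : ℕ) : Prog :=
  .ite (.natLe (.lit 1) (.get fl (.var 47)))
    (.setVar 28 (.get ar (.var 47)) ;;
    .setNat 33 (.get 3 (.var 28)) (.sub (.get 33 (.get 3 (.var 28))) (.lit 1)) ;;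
    .setNat 34 (.get 3 (.var 28)) (.sub (.get 34 (.get 3 (.var 28))) (.var 28)) ;;
    .setNat 35 (.get 4 (.var 28)) (.sub (.get 35 (.get 4 (.var 28))) (.lit 1)) ;;
    .setNat 36 (.get 4 (.var 28)) (.sub (.get 36 (.get 4 (.var 28))) (.var 28)))
    .skip

/-- The arrays `33`–`36` hold the numbers of edges from `E` that leave or enter the nodes, and the
sums of the numbers of these edges. -/
structure Degrees {s : ℕ} {G : DiGraph s} (E : Finset (Fin G.size)) (σ : State) : Prop where
  out : ∀ x : Fin s, σ.nat 33 x = (DiGraph.outOf E x).card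
  outSum : ∀ x : Fin s, σ.nat 34 x = ∑ e ∈ DiGraph.outOf E x, (e : ℕ)
  into : ∀ x : Fin s, σ.nat 35 x = (DiGraph.into E x).card
  intoSum : ∀ x : Fin s, σ.nat 36 x = ∑ e ∈ DiGraph.into E x, (e : ℕ)

namespace Degrees

variable {s : ℕ} {G : DiGraph s} {E : Finset (Fin G.size)} {σ : State}

/-- For a set of at most one edge, the count tells whether there is an edge, and the sum of the edge
numbers is the number of this edge. The arrays of counts and sums thus serve directly as a
representation of the optional link. -/
theorem optAt_out (h : Degrees E σ) {v : Fin s} {o : Option (Fin G.size)}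
    (ho : DiGraph.outOf E v = o.toFinset) : OptAt σ 33 34 v o := by
  constructor
  · rintro rfl
    rw [h.out, ho]; rfl
  · rintro e rfl
    rw [h.out, h.outSum, ho]
    simp

theorem optAt_into (h : Degrees E σ) {v : Fin s} {o : Option (Fin G.size)}
    (ho : DiGraph.into E v = o.toFinset) : OptAt σ 35 36 v o := by
  constructor
  · rintro rfl
    rw [h.into, ho]; rfl
  · rintro e rfl
    rw [h.into, h.intoSum, ho]
    simp

theorem erase (h : Degrees E σ) {e : Fin G.size} (he : e ∈ E) {σ' : State}
    (h1 : ∀ x : Fin s, σ'.nat 33 x = if x = G.src e then σ.nat 33 x - 1 else σ.nat 33 x)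
    (h2 : ∀ x : Fin s, σ'.nat 34 x = if x = G.src e then σ.nat 34 x - e else σ.nat 34 x)
    (h3 : ∀ x : Fin s, σ'.nat 35 x = if x = G.dst e then σ.nat 35 x - 1 else σ.nat 35 x)
    (h4 : ∀ x : Fin s, σ'.nat 36 x = if x = G.dst e then σ.nat 36 x - e else σ.nat 36 x) :
    Degrees (E.erase e) σ' := by
  have a1 : ∀ x, x = G.src e → DiGraph.outOf (E.erase e) x = (DiGraph.outOf E x).erase e ∧
      e ∈ DiGraph.outOf E x := by
    rintro x rfl
    refine ⟨?_, by simp [DiGraph.outOf, he]⟩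
    ext f; simp [DiGraph.outOf]; tauto
  have a2 : ∀ x, x ≠ G.src e → DiGraph.outOf (E.erase e) x = DiGraph.outOf E x := by
    intro x hx
    ext f
    simp only [DiGraph.outOf, Finset.mem_filter, Finset.mem_erase]
    constructor
    · tauto
    · rintro ⟨h1, h2⟩
      exact ⟨⟨fun h => hx (h ▸ h2.symm), h1⟩, h2⟩
  have b1 : ∀ x, x = G.dst e → DiGraph.into (E.erase e) x = (DiGraph.into E x).erase e ∧
      e ∈ DiGraph.into E x := by
    rintro x rfl
    refine ⟨?_, by simp [DiGraph.into, he]⟩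
    ext f; simp [DiGraph.into]; tauto
  have b2 : ∀ x, x ≠ G.dst e → DiGraph.into (E.erase e) x = DiGraph.into E x := by
    intro x hx
    ext f
    simp only [DiGraph.into, Finset.mem_filter, Finset.mem_erase]
    constructor
    · tauto
    · rintro ⟨h1, h2⟩
      exact ⟨⟨fun h => hx (h ▸ h2.symm), h1⟩, h2⟩
  refine ⟨fun x => ?_, fun x => ?_, fun x => ?_, fun x => ?_⟩
  · rw [h1]
    split
    · rename_i hx
      rw [(a1 x hx).1, Finset.card_erase_of_mem (a1 x hx).2, h.out]
    · rename_i hx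
      rw [a2 x hx, h.out]
  · rw [h2]
    split
    · rename_i hx
      -- Truncated subtraction is exact here, since `e` is one of the summands.
      have := Finset.sum_erase_add _ (fun e : Fin G.size => (e : ℕ)) (a1 x hx).2
      rw [(a1 x hx).1, h.outSum]; omega
    · rename_i hx
      rw [a2 x hx, h.outSum]
  · rw [h3]
    split
    · rename_i hx
      rw [(b1 x hx).1, Finset.card_erase_of_mem (b1 x hx).2, h.into]
    · rename_i hx
      rw [b2 x hx, h.into]
  · rw [h4]
    split
    · rename_i hx
      have := Finset.sum_erase_add _ (fun e : Fin G.size => (e : ℕ)) (b1 x hx).2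
      rw [(b1 x hx).1, h.intoSum]; omega
    · rename_i hx
      rw [b2 x hx, h.intoSum]

end Degrees

namespace Inst

variable {τ r s : ℕ} {I : Inst τ r s}

theorem degreesProg_run {σ : State} (h : I.Inp σ)
    (h0 : ∀ a ∈ [33, 34, 35, 36], ∀ j, σ.nat a j = 0) :
    Run degreesProg σ ((I.substrate.size + 1) * 80)
      (Degrees (Finset.univ : Finset (Fin I.substrate.size))) := by
  refine (Run.for_ (J := fun n σ' => Degrees (below I.substrate.size n) σ') (T := 60)
    I.substrate.size rfl ?_ ?_ ?_).conseq ?_ ?_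
  · intro k σ1 _ hF1
    exact (h.framed hF1).subEdges
  · constructor <;> intro x <;> simp [h0, DiGraph.outOf, DiGraph.into]
  · intro k σ1 hJ hk hik hF1
    have i1 := h.framed hF1
    have e3 := i1.subSrc ⟨k, hk⟩
    have e4 := i1.subDst ⟨k, hk⟩
    simp only at e3 e4
    have a1 : ∀ x, DiGraph.outOf (below I.substrate.size (k + 1)) x =
        if x = I.substrate.src ⟨k, hk⟩ then
          insert ⟨k, hk⟩ (DiGraph.outOf (below I.substrate.size k) x)
        else DiGraph.outOf (below I.substrate.size k) x := by
      intro x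
      rw [below_succ hk]
      simp only [DiGraph.outOf, Finset.filter_insert, eq_comm (a := x)]
    have b1 : ∀ x, DiGraph.into (below I.substrate.size (k + 1)) x =
        if x = I.substrate.dst ⟨k, hk⟩ then
          insert ⟨k, hk⟩ (DiGraph.into (below I.substrate.size k) x)
        else DiGraph.into (below I.substrate.size k) x := by
      intro x
      rw [below_succ hk]
      simp only [DiGraph.into, Finset.filter_insert, eq_comm (a := x)]
    have a2 : ∀ x, (⟨k, hk⟩ : Fin I.substrate.size) ∉
        DiGraph.outOf (G := I.substrate) (below I.substrate.size k) x := by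
      simp [DiGraph.outOf]
    have b2 : ∀ x, (⟨k, hk⟩ : Fin I.substrate.size) ∉
        DiGraph.into (G := I.substrate) (below I.substrate.size k) x := by
      simp [DiGraph.into]
    refine Run.of_straight rfl (by simp [Prog.bound, NExp.time]) ⟨?_, ?_, ?_, ?_⟩ <;> intro x
    · have := hJ.out x
      rw [a1]
      by_cases hx : x = I.substrate.src ⟨k, hk⟩
      · rw [if_pos hx, Finset.card_insert_of_notMem (a2 x)]
        subst hx
        simp [Prog.result, NExp.eval, hik, e3, e4, this]
      · rw [if_neg hx]
        have hx' : (x : ℕ) ≠ I.substrate.src ⟨k, hk⟩ := fun h => hx (Fin.ext h)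
        simp [Prog.result, NExp.eval, hik, e3, e4, this, hx']
    · have := hJ.outSum x
      rw [a1]
      by_cases hx : x = I.substrate.src ⟨k, hk⟩
      · rw [if_pos hx, Finset.sum_insert (a2 x)]
        subst hx
        simp [Prog.result, NExp.eval, hik, e3, e4, this, add_comm]
      · rw [if_neg hx]
        have hx' : (x : ℕ) ≠ I.substrate.src ⟨k, hk⟩ := fun h => hx (Fin.ext h)
        simp [Prog.result, NExp.eval, hik, e3, e4, this, hx']
    · have := hJ.into x
      rw [b1]
      by_cases hx : x = I.substrate.dst ⟨k, hk⟩
      · rw [if_pos hx, Finset.card_insert_of_notMem (b2 x)]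
        subst hx
        simp [Prog.result, NExp.eval, hik, e3, e4, this]
      · rw [if_neg hx]
        have hx' : (x : ℕ) ≠ I.substrate.dst ⟨k, hk⟩ := fun h => hx (Fin.ext h)
        simp [Prog.result, NExp.eval, hik, e3, e4, this, hx']
    · have := hJ.intoSum x
      rw [b1]
      by_cases hx : x = I.substrate.dst ⟨k, hk⟩
      · rw [if_pos hx, Finset.sum_insert (b2 x)]
        subst hx
        simp [Prog.result, NExp.eval, hik, e3, e4, this, add_comm]
      · rw [if_neg hx]
        have hx' : (x : ℕ) ≠ I.substrate.dst ⟨k, hk⟩ := fun h => hx (Fin.ext h)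
        simp [Prog.result, NExp.eval, hik, e3, e4, this, hx']
  · simp only [NExp.time]; omega
  · intro σ1 h1 _
    simpa using h1

theorem eraseProg_run {σ : State} (h : I.Inp σ) {E : Finset (Fin I.substrate.size)}
    (hE : Degrees E σ) {fl ar v : ℕ} (hv : σ.nat 47 0 = v) {o : Option (Fin I.substrate.size)}
    (ho : OptAt σ fl ar v o) (hoE : ∀ e, o = some e → e ∈ E) :
    Run (eraseProg fl ar) σ 100 (Degrees (E \ o.toFinset)) := by
  refine Run.of_straight rfl (by simp [eraseProg, Prog.bound, BExp.time, NExp.time]) ?_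
  simp only [eraseProg, Prog.result, BExp.holds_natLe, NExp.eval, hv]
  cases o with
  | none =>
    have := ho.1 rfl
    rw [this, if_neg (by omega)]
    simpa using hE
  | some e =>
    obtain ⟨h1, h2⟩ := ho.2 e rfl
    have e3 := h.subSrc e
    have e4 := h.subDst e
    rw [h1, if_pos le_rfl, h2, Option.toFinset_some, Finset.sdiff_singleton_eq_erase]
    refine hE.erase (hoE e rfl) ?_ ?_ ?_ ?_ <;> intro x
    · by_cases hx : x = I.substrate.src e
      · subst hx
        simp [e3, e4]
      · have hx' : (x : ℕ) ≠ I.substrate.src e := fun h => hx (Fin.ext h)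
        simp [e3, e4, hx, hx']
    · by_cases hx : x = I.substrate.src e
      · subst hx
        simp [e3, e4]
      · have hx' : (x : ℕ) ≠ I.substrate.src e := fun h => hx (Fin.ext h)
        simp [e3, e4, hx, hx']
    · by_cases hx : x = I.substrate.dst e
      · subst hx
        simp [e3, e4]
      · have hx' : (x : ℕ) ≠ I.substrate.dst e := fun h => hx (Fin.ext h)
        simp [e3, e4, hx, hx']
    · by_cases hx : x = I.substrate.dst e
      · subst hx
        simp [e3, e4]
      · have hx' : (x : ℕ) ≠ I.substrate.dst e := fun h => hx (Fin.ext h)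
        simp [e3, e4, hx, hx']

end Inst

end VNEP

/-! ### The leaf test, a single elimination, and the scan for leaves -/

namespace VNEP

open Elim
open scoped ENNReal

/-- The test whether the node in variable `47` is a leaf. -/
def leafTest : BExp :=
  .and (.natLe (.get 33 (.var 47)) (.lit 1)) (.and (.natLe (.get 35 (.var 47)) (.lit 1))
    (.and (.natLe (.lit 1) (.add (.get 33 (.var 47)) (.get 35 (.var 47))))
      (.not (.and (.natLe (.lit 1) (.get 33 (.var 47))) (.and (.natLe (.lit 1) (.get 35 (.var 47)))
        (.ne (.get 4 (.get 34 (.var 47))) (.get 3 (.get 36 (.var 47)))))))))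

/-- Eliminates the leaf in variable `47`, and continues with its parent. -/
def elimProg : Prog :=
  .ite (.natLe (.lit 1) (.get 33 (.var 47))) (.setVar 48 (.get 4 (.get 34 (.var 47))))
    (.setVar 48 (.get 3 (.get 36 (.var 47)))) ;;
  cutProg ;;
  mergeProg ;;
  (.setNat 40 (.var 45) (.var 47) ;;
    .setNat 41 (.var 47) (.var 48) ;;
    .setNat 42 (.var 47) (.get 34 (.var 47)) ;;
    .setNat 43 (.var 47) (.get 36 (.var 47)) ;;
    .setNat 44 (.var 47) (.var 45) ;;
    .setVar 45 (.add (.var 45) (.lit 1)) ;;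
    .setVar 49 (.var 48)) ;;
  eraseProg 33 34 ;;
  eraseProg 35 36 ;;
  .setVar 47 (.var 48)

/-- The main loop. -/
def forwardLoop : Prog :=
  .loop (.lt (.var 46) (.get 0 (.lit 2)))
    (.ite leafTest elimProg (.setVar 46 (.add (.var 46) (.lit 1)) ;; .setVar 47 (.var 46)))

namespace Inst

variable {τ r s : ℕ} {I : Inst τ r s}

/-- The eliminations `h` are recorded in the memory. -/
def Recorded {m : ℕ} (h : List (Elim r s m)) (σ : State) : Prop :=
  ∀ ε h', ε :: h' <:+ h → σ.nat 40 h'.length = ε.v ∧ σ.nat 41 ε.v = ε.p ∧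
    (∀ e, ε.up = some e → σ.nat 42 ε.v = e) ∧ (∀ e, ε.down = some e → σ.nat 43 ε.v = e) ∧
    σ.nat 44 ε.v = h'.length ∧
    ∀ S, ε.ch S ⊆ S ∧ σ.nat 31 (ε.v * 2 ^ r + enc S) = enc (ε.ch S)

variable (I) in
/-- The state of the computation after the eliminations `h`, when the node `v` is inspected, and
all leaves other than `v` are greater than `i`. -/
structure Forward (h : List (Elim r s I.substrate.size)) (G : Fin s → Finset (Fin r) → ℝ≥0∞)
    (i v : ℕ) (σ : State) : Prop extends I.Ctx σ where
  legal : I.substrate.Legal h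
  good : I.Good h G
  table : Table G σ
  recorded : Recorded h σ
  degrees : Degrees (I.substrate.edgesIn (alive h)) σ
  connected : (I.substrate.underlying.induce (alive h : Set (Fin s))).Connected
  count : σ.nat 45 0 = h.length
  index : σ.nat 46 0 = i
  node : σ.nat 47 0 = v
  root : ∃ x ∈ alive h, σ.nat 49 0 = x
  bounds : i < s ∧ v < s ∨ i = s ∧ v = s
  leaves : ∀ x, I.substrate.IsLeaf (alive h) x → (x : ℕ) = v ∨ i < x

theorem elimProg_run (hT : I.substrate.IsTree) {h : List (Elim r s I.substrate.size)}
    {G : Fin s → Finset (Fin r) → ℝ≥0∞} {i : ℕ} {v : Fin s} {σ : State}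
    (hF : I.Forward h G i v σ) (hi : i < s) {up down : Option (Fin I.substrate.size)} {p : Fin s}
    (hup : DiGraph.outOf (I.substrate.edgesIn (alive h)) v = up.toFinset)
    (hdown : DiGraph.into (I.substrate.edgesIn (alive h)) v = down.toFinset)
    (hne : up ≠ none ∨ down ≠ none) (h1 : ∀ e, up = some e → I.substrate.dst e = p)
    (h2 : ∀ e, down = some e → I.substrate.src e = p) :
    Run elimProg σ (900 * ((2 ^ r + 1) * ((τ + 1) * ((r + 1) * (r + 1)))) + 500 * 3 ^ r + 300)
      fun σ' => ∃ h' G' v', I.Forward h' G' i v' σ' ∧ (alive h').card + 1 = (alive h).card := by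
  -- The choices are known only after the merge, but neither the legality of the elimination nor its
  -- cut cost depends on them; until then the identity stands in for `ch`.
  have hcan : ∀ ch, I.substrate.CanElim h ⟨v, p, up, down, ch⟩ := fun ch =>
    DiGraph.canElim_of_leaf hT.1 hup hdown hne h1 h2
  have hvp : v ≠ p := (hcan fun S => S).ne
  have ou := hF.degrees.optAt_out hup
  have od := hF.degrees.optAt_into hdown
  refine (Run.seq (T := 20) (T' := 900 * ((2 ^ r + 1) * ((τ + 1) * ((r + 1) * (r + 1)))) +
    (500 * 3 ^ r + (60 + (100 + (100 + 5)))))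
    ((Run.straight _ _ rfl).conseq (by simp [Prog.bound, BExp.time, NExp.time])
      fun σ1 e1 hF1 => ?_)).mono (by omega) fun _ h => h
  have c1 := hF.toCtx.framed hF1
  have a48 : σ1.nat 48 0 = p := by
    subst e1
    simp only [Prog.result, BExp.holds_natLe, NExp.eval, hF.node]
    cases up with
    | some e =>
      obtain ⟨o1, o2⟩ := ou.2 e rfl
      rw [o1, o2]
      have := hF.toCtx.toInp.subDst e
      rw [h1 e rfl] at this
      simp [this]
    | none =>
      have o1 := ou.1 rfl
      obtain ⟨e, rfl⟩ := Option.ne_none_iff_exists'.1 (hne.resolve_left (by simp))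
      have := hF.toCtx.toInp.subSrc e
      rw [h2 e rfl] at this
      simp [o1, (od.2 e rfl).2, this]
  have a47 : σ1.nat 47 0 = v := by rw [hF1.nat 47 rfl, hF.node]
  have t1 : Table G σ1 := by
    unfold Table
    rw [hF1.nat 30 rfl, hF1.real 10 rfl]; exact hF.table
  refine Run.seq ((cutProg_run (ε := ⟨v, p, up, down, fun S => S⟩) c1 t1 a47
    (by unfold OptAt; rw [hF1.nat 33 rfl, hF1.nat 34 rfl]; exact ou)
    (by unfold OptAt; rw [hF1.nat 35 rfl, hF1.nat 36 rfl]; exact od)).conseq le_rfl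
    fun σ2 t2 hF2 => ?_)
  have c2 := c1.framed hF2
  have b47 : σ2.nat 47 0 = v := by rw [hF2.nat 47 rfl, a47]
  have b48 : σ2.nat 48 0 = p := by rw [hF2.nat 48 rfl, a48]
  refine Run.seq ((mergeProg_run c2 t2 hvp b47 b48).conseq le_rfl fun σ3 h3 hF3 => ?_)
  obtain ⟨X, ch, hM, hX, t3⟩ := h3
  have c3 := c2.framed hF3
  obtain ⟨ε, hε⟩ : ∃ ε : Elim r s I.substrate.size, ε = ⟨v, p, up, down, ch⟩ := ⟨_, rfl⟩
  have hcε : I.substrate.CanElim h ε := hε ▸ hcan ch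
  have keep : ∀ a, a ∈ [33, 34, 35, 36, 40, 41, 42, 43, 44, 45, 46] → σ3.nat a = σ.nat a := by
    intro a ha
    simp only [List.mem_cons, List.not_mem_nil, or_false] at ha
    rcases ha with rfl | rfl | rfl | rfl | rfl | rfl | rfl | rfl | rfl | rfl | rfl <;>
      rw [hF3.nat _ rfl, hF2.nat _ rfl, hF1.nat _ rfl]
  have keep31 : σ2.nat 31 = σ.nat 31 := by rw [hF2.nat 31 rfl, hF1.nat 31 rfl]
  have d47 : σ3.nat 47 0 = v := by rw [hF3.nat 47 rfl, b47]
  have d48 : σ3.nat 48 0 = p := by rw [hF3.nat 48 rfl, b48]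
  have d45 : σ3.nat 45 0 = h.length := by rw [keep 45 (by simp), hF.count]
  refine Run.seq ((Run.straight _ _ rfl).conseq (by simp [Prog.bound, NExp.time])
    fun σ4 e4 hF4 => ?_)
  have c4 := c3.framed hF4
  have rec4 : Recorded (ε :: h) σ4 := by
    intro δ h' hs
    rcases List.suffix_cons_iff.1 hs with hs | hs
    · obtain ⟨rfl, rfl⟩ := List.cons.inj hs
      subst hε e4
      refine ⟨?_, ?_, ?_, ?_, ?_, ?_⟩
      · simp [Prog.result, NExp.eval, d45, d47]
      · simp [Prog.result, NExp.eval, d47, d48]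
      · rintro e rfl
        simp [Prog.result, NExp.eval, d47, keep 34, (ou.2 e rfl).2]
      · rintro e rfl
        simp [Prog.result, NExp.eval, d47, keep 36, (od.2 e rfl).2]
      · simp [Prog.result, NExp.eval, d47, d45]
      · intro S
        exact ⟨hM.subset S, by simpa [Prog.result] using hM.choice S⟩
    · obtain ⟨r1, r2, r3, r4, r5, r6⟩ := hF.recorded δ h' hs
      -- The node `v` has survived all earlier eliminations, so recording its own does not overwrite
      -- theirs.
      have n1 : δ.v ≠ v := by
        rintro rfl
        have := (hcan fun S => S).v_mem
        have := alive_subset hs this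
        simp [alive] at this
      have n1' : (δ.v : ℕ) ≠ v := fun h => n1 (Fin.ext h)
      have n2 : h'.length ≠ h.length := by
        have := hs.length_le
        rw [List.length_cons] at this
        omega
      subst e4
      refine ⟨?_, ?_, ?_, ?_, ?_, ?_⟩
      · simp [Prog.result, NExp.eval, d45, n2, keep 40, r1]
      · simp [Prog.result, NExp.eval, d47, n1', keep 41, r2]
      · intro e he
        simp [Prog.result, NExp.eval, d47, n1', keep 42, r3 e he]
      · intro e he
        simp [Prog.result, NExp.eval, d47, n1', keep 43, r4 e he]
      · simp [Prog.result, NExp.eval, d47, n1', keep 44, r5]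
      · intro S
        have := hM.other δ.v n1 S
        rw [keep31, (r6 S).2] at this
        exact ⟨(r6 S).1, by simpa [Prog.result] using this⟩
  have f45 : σ4.nat 45 0 = (ε :: h).length := by
    subst e4; simp [Prog.result, NExp.eval, d45]
  have f48 : σ4.nat 48 0 = p := by rw [hF4.nat 48 rfl, d48]
  have f47 : σ4.nat 47 0 = v := by rw [hF4.nat 47 rfl, d47]
  have f49 : σ4.nat 49 0 = p := by subst e4; simp [Prog.result, NExp.eval, d48]
  have keep4 : ∀ a, a ∈ [33, 34, 35, 36] → σ4.nat a = σ.nat a := by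
    intro a ha
    rw [← keep a (by simp only [List.mem_cons] at ha ⊢; tauto)]
    simp only [List.mem_cons, List.not_mem_nil, or_false] at ha
    rcases ha with rfl | rfl | rfl | rfl <;> rw [hF4.nat _ rfl]
  have g4 : Degrees (I.substrate.edgesIn (alive h)) σ4 := by
    obtain ⟨g1, g2, g3, g4⟩ := hF.degrees
    exact ⟨by rwa [keep4 33 (by simp)], by rwa [keep4 34 (by simp)], by rwa [keep4 35 (by simp)],
      by rwa [keep4 36 (by simp)]⟩
  refine Run.seq ((eraseProg_run c4.toInp g4 f47 (g4.optAt_out hup) fun e he => ?_).conseq le_rfl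
    fun σ5 g5 hF5 => ?_)
  · have : e ∈ up.toFinset := by simp [he]
    rw [← hup] at this
    exact (Finset.mem_filter.1 this).1
  have c5 := c4.framed hF5
  have hdisj : ∀ e, down = some e → up ≠ some e := fun e he he' =>
    hvp (((hcan fun S => S).up e he').1.symm.trans ((hcan fun S => S).down e he).1)
  -- The two links are different edges, so after the removal of the first, the counts at `v` still
  -- identify the second.
  have hdown' : DiGraph.into (I.substrate.edgesIn (alive h) \ up.toFinset) v = down.toFinset := by
    ext e
    have : e ∈ DiGraph.into (I.substrate.edgesIn (alive h)) v ↔ e ∈ down.toFinset := by rw [hdown]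
    simp only [DiGraph.into, Finset.mem_filter, Finset.mem_sdiff, Option.mem_toFinset,
      Option.mem_def] at this ⊢
    have := hdisj e
    tauto
  refine Run.seq ((eraseProg_run c5.toInp g5 (by rw [hF5.nat 47 rfl, f47])
    (g5.optAt_into hdown') fun e he => ?_).conseq le_rfl fun σ6 g6 hF6 => ?_)
  · have : e ∈ down.toFinset := by simp [he]
    rw [← hdown'] at this
    exact (Finset.mem_filter.1 this).1
  have c6 := c5.framed hF6
  refine (Run.straight _ _ rfl).conseq (by simp [Prog.bound, NExp.time]) fun σ7 e7 hF7 => ?_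
  have c7 := c6.framed hF7
  have keep7 : ∀ a, a ∈ [30, 31, 40, 41, 42, 43, 44, 45, 48, 49] → σ7.nat a = σ4.nat a := by
    intro a ha
    simp only [List.mem_cons, List.not_mem_nil, or_false] at ha
    rcases ha with rfl | rfl | rfl | rfl | rfl | rfl | rfl | rfl | rfl | rfl <;>
      rw [hF7.nat _ rfl, hF6.nat _ rfl, hF5.nat _ rfl]
  refine ⟨ε :: h, Function.update (Function.update G v fun S => G v S +
    I.cutVal ⟨v, p, up, down, fun S => S⟩ S) p X, p, ⟨c7, ⟨hcε, hF.legal⟩, ?_, ?_, ?_, ?_, ?_, ?_,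
      ?_, ?_, ?_, ?_, ?_⟩, ?_⟩
  · refine hF.good.step hcε ?_ ?_ ?_ ?_
    · subst hε
      intro x hx hx'
      rw [Function.update_of_ne hx, Function.update_of_ne hx']
    · subst hε
      intro S T hTS
      have := hX S T hTS
      rw [Function.update_self]
      rwa [Function.update_self, Function.update_of_ne hvp.symm] at this
    · subst hε
      exact hM.subset
    · subst hε
      intro S
      have := hM.attained S
      rw [Function.update_self]
      rwa [Function.update_self, Function.update_of_ne hvp.symm] at this
  · unfold Table at t3 ⊢
    rw [keep7 30 (by simp), hF7.real 10 rfl, hF6.real 10 rfl, hF5.real 10 rfl, hF4.nat 30 rfl,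
      hF4.real 10 rfl]
    exact t3
  · unfold Recorded at rec4 ⊢
    rw [keep7 31 (by simp), keep7 40 (by simp), keep7 41 (by simp), keep7 42 (by simp),
      keep7 43 (by simp), keep7 44 (by simp)]
    exact rec4
  · rw [hcε.edgesIn]
    subst hε
    obtain ⟨g1, g2, g3, g4⟩ := g6
    exact ⟨by rwa [hF7.nat 33 rfl], by rwa [hF7.nat 34 rfl], by rwa [hF7.nat 35 rfl],
      by rwa [hF7.nat 36 rfl]⟩
  · have := DiGraph.connected_erase hcε.p_mem hcε.ne.symm hcε.eq_p hF.connected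
    simpa only [alive] using this
  · rw [keep7 45 (by simp), f45]
  · rw [hF7.nat 46 rfl, hF6.nat 46 rfl, hF5.nat 46 rfl, hF4.nat 46 rfl, keep 46 (by simp),
      hF.index]
  · have : σ6.nat 48 0 = p := by rw [hF6.nat 48 rfl, hF5.nat 48 rfl, f48]
    subst e7
    simp [Prog.result, NExp.eval, this]
  · refine ⟨p, ?_, ?_⟩
    · subst hε
      exact Finset.mem_erase.2 ⟨hvp.symm, hcε.p_mem⟩
    · rw [keep7 49 (by simp), f49]
  · exact .inl ⟨hi, p.2⟩
  -- A leaf of the new graph is either `p`, which is inspected next, or an old leaf other than `v`,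
  -- hence greater than `i`.
  · intro x hx
    by_cases hxp : x = p
    · exact .inl (congrArg Fin.val hxp)
    · right
      have h1 : I.substrate.IsLeaf (alive h) x :=
        DiGraph.IsLeaf.of_erase hcε.eq_p hx (by subst hε; exact hxp)
      rcases hF.leaves x h1 with h2 | h2
      · have hx1 := hx.1
        subst hε
        exact absurd (Fin.ext h2) (Finset.mem_erase.1 hx1).1
      · exact h2
  · rw [alive, Finset.card_erase_of_mem hcε.v_mem]
    have := Finset.card_pos.2 ⟨_, hcε.v_mem⟩
    omega

/-- The quantity `(s - i) + (alive h).card` starts at `2 * s` and drops in every round: an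
elimination removes a node, and a failed test advances `i`. The parent of an eliminated leaf is
inspected next even if the scan has already passed it. At the end no leaf is left in a connected
remaining graph, which therefore is a single node. -/
theorem forwardLoop_run (hT : I.substrate.IsTree) {σ : State}
    (hF : ∃ G, I.Forward [] G 0 0 σ) :
    Run forwardLoop σ ((2 * s + 1) * (900 * ((2 ^ r + 1) * ((τ + 1) * ((r + 1) * (r + 1)))) +
      500 * 3 ^ r + 400)) fun σ' => ∃ h G root, I.Forward h G s s σ' ∧ alive h = {root} ∧
        σ'.nat 49 0 = root := by
  refine (Run.loop (J := fun n σ' => ∃ h G i v, I.Forward h G i v σ' ∧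
    (s - i) + (alive h).card = n) (T := 900 * ((2 ^ r + 1) * ((τ + 1) * ((r + 1) * (r + 1)))) +
      500 * 3 ^ r + 380) (2 * s) ?_ ?_).conseq ?_ ?_
  · obtain ⟨G, hF⟩ := hF
    exact ⟨[], G, 0, 0, hF, by simp [alive]; omega⟩
  · rintro n σ1 ⟨h, G, i, v, hF, rfl⟩ hb
    rw [BExp.holds_lt] at hb
    simp only [NExp.eval, hF.index, hF.subNodes] at hb
    obtain ⟨-, hv⟩ : i < s ∧ v < s := by
      rcases hF.bounds with h | h
      · exact h
      · omega
    obtain ⟨v, rfl⟩ : ∃ v' : Fin s, (v' : ℕ) = v := ⟨⟨v, hv⟩, rfl⟩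
    have htest : leafTest.Holds σ1 ↔
        (DiGraph.outOf (I.substrate.edgesIn (alive h)) v).card ≤ 1 ∧
        (DiGraph.into (I.substrate.edgesIn (alive h)) v).card ≤ 1 ∧
        1 ≤ (DiGraph.outOf (I.substrate.edgesIn (alive h)) v).card +
          (DiGraph.into (I.substrate.edgesIn (alive h)) v).card ∧
        ¬ (1 ≤ (DiGraph.outOf (I.substrate.edgesIn (alive h)) v).card ∧
          1 ≤ (DiGraph.into (I.substrate.edgesIn (alive h)) v).card ∧
          σ1.nat 4 (σ1.nat 34 v) ≠ σ1.nat 3 (σ1.nat 36 v)) := by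
      rw [← hF.degrees.out, ← hF.degrees.into]
      simp only [leafTest, BExp.holds_and, BExp.holds_natLe, BExp.holds_not, BExp.holds_ne,
        NExp.eval, hF.node]
    refine (Run.ite (T := 900 * ((2 ^ r + 1) * ((τ + 1) * ((r + 1) * (r + 1)))) +
      500 * 3 ^ r + 300) (fun ht => ?_) fun ht => ?_).mono ?_ fun _ h => h
    · rw [htest] at ht
      obtain ⟨t1, t2, t3, t4⟩ := ht
      obtain ⟨up, hup⟩ := DiGraph.exists_option_of_card_le_one t1
      obtain ⟨down, hdown⟩ := DiGraph.exists_option_of_card_le_one t2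
      have ou := hF.degrees.optAt_out hup
      have od := hF.degrees.optAt_into hdown
      have hne : up ≠ none ∨ down ≠ none := by
        by_contra hc
        push Not at hc
        rw [hup, hdown, hc.1, hc.2] at t3
        simp at t3
      have hp : ∃ p : Fin s, (∀ e, up = some e → I.substrate.dst e = p) ∧
          ∀ e, down = some e → I.substrate.src e = p := by
        cases up with
        | none =>
          obtain ⟨f, rfl⟩ := Option.ne_none_iff_exists'.1 (hne.resolve_left (by simp))
          exact ⟨I.substrate.src f, by simp, by rintro e ⟨⟩; rfl⟩
        | some e =>
          cases down with
          | none => exact ⟨I.substrate.dst e, by rintro e ⟨⟩; rfl, by simp⟩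
          | some f =>
            refine ⟨I.substrate.dst e, by rintro e ⟨⟩; rfl, ?_⟩
            rintro _ ⟨⟩
            by_contra hc
            refine t4 ⟨by rw [hup]; simp, by rw [hdown]; simp, ?_⟩
            rw [(ou.2 e rfl).2, (od.2 f rfl).2, hF.subDst, hF.subSrc]
            exact fun h => hc (Fin.ext h).symm
      obtain ⟨p, hp1, hp2⟩ := hp
      refine (elimProg_run hT hF hb hup hdown hne hp1 hp2).conseq le_rfl ?_
      rintro σ2 ⟨h', G', v', hF', hc⟩ _
      exact ⟨_, by omega, h', G', i, v', hF', rfl⟩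
    -- A leaf would have passed the test. So `v` is none, all leaves exceed `i`, and inspecting `i +
    -- 1` next preserves the invariant.
    · have hnl : ¬ I.substrate.IsLeaf (alive h) v := fun hl => ht <| by
        obtain ⟨l1, l2, l3, l4⟩ := hl.card_le hT.1
        refine htest.2 ⟨l1, l2, l3, fun ⟨m1, m2, m3⟩ => m3 ?_⟩
        obtain ⟨e, he⟩ := Finset.card_eq_one.1 (le_antisymm l1 m1)
        obtain ⟨f, hf⟩ := Finset.card_eq_one.1 (le_antisymm l2 m2)
        have ou := hF.degrees.optAt_out (v := v) (o := some e) (by simp [he])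
        have od := hF.degrees.optAt_into (v := v) (o := some f) (by simp [hf])
        rw [(ou.2 e rfl).2, (od.2 f rfl).2, hF.subDst, hF.subSrc,
          l4 e f (by simp [he]) (by simp [hf])]
      refine ((Run.straight _ _ rfl).conseq (T' := 20) (by simp [Prog.bound, NExp.time])
        fun σ2 e2 hF2 => ?_).mono (by omega) fun _ h => h
      refine ⟨(s - (i + 1)) + (alive h).card, by omega, h, G, i + 1, i + 1,
        ⟨hF.toCtx.framed hF2, hF.legal, hF.good, ?_, ?_, ?_, hF.connected, ?_, ?_, ?_, ?_, by omega,
          ?_⟩, rfl⟩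
      · unfold Table
        rw [hF2.nat 30 rfl, hF2.real 10 rfl]
        exact hF.table
      · unfold Recorded
        rw [hF2.nat 31 rfl, hF2.nat 40 rfl, hF2.nat 41 rfl, hF2.nat 42 rfl, hF2.nat 43 rfl,
          hF2.nat 44 rfl]
        exact hF.recorded
      · obtain ⟨g1, g2, g3, g4⟩ := hF.degrees
        exact ⟨by rwa [hF2.nat 33 rfl], by rwa [hF2.nat 34 rfl], by rwa [hF2.nat 35 rfl],
          by rwa [hF2.nat 36 rfl]⟩
      · rw [hF2.nat 45 rfl, hF.count]
      · subst e2; simp [Prog.result, NExp.eval, hF.index]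
      · subst e2; simp [Prog.result, NExp.eval, hF.index]
      · rw [hF2.nat 49 rfl]; exact hF.root
      · intro x hx
        rcases hF.leaves x hx with h1 | h1
        · exact absurd (Fin.ext h1 ▸ hx) hnl
        · omega
    · simp only [leafTest, BExp.ne, BExp.time, NExp.time]
      omega
  · rw [BExp.time_lt]
    simp only [NExp.time]
    exact Nat.mul_le_mul_left _ (by omega)
  · rintro σ1 ⟨⟨n, h, G, i, v, hF, -⟩, hb⟩ _
    rw [BExp.holds_lt] at hb
    simp only [NExp.eval, hF.index, hF.subNodes] at hb
    obtain ⟨rfl, rfl⟩ : i = s ∧ v = s := by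
      rcases hF.bounds with h | h
      · omega
      · exact h
    obtain ⟨x, hx, hx'⟩ := hF.root
    refine ⟨h, G, x, hF, ?_, hx'⟩
    have hcard : (alive h).card ≤ 1 := by
      by_contra hc
      obtain ⟨y, hy⟩ := hT.exists_isLeaf hF.connected (by omega)
      have := hF.leaves y hy
      omega
    refine Finset.eq_singleton_iff_unique_mem.2 ⟨hx, fun y hy => ?_⟩
    exact Finset.card_le_one.1 hcard y hy x hx

end Inst

end VNEP

namespace VNEP

open Elim
open scoped ENNReal

/-! ### Reconstruction of the node mapping -/

/-- Undoes all eliminations, where array `50` holds the sets that are mapped to the nodes. -/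
def undoProg : Prog :=
  .setNat 50 (.var 49) (.sub (.var 14) (.lit 1)) ;;
  .loop (.lt (.lit 0) (.var 45))
    (.setVar 45 (.sub (.var 45) (.lit 1)) ;;
    .setVar 47 (.get 40 (.var 45)) ;;
    .setVar 48 (.get 41 (.var 47)) ;;
    .setNat 50 (.var 47) (.get 31 (.add (.get 16 (.var 47)) (.get 50 (.var 48)))) ;;
    .setNat 50 (.var 48) (.sub (.get 50 (.var 48)) (.get 50 (.var 47))))

/-- Turns the sets in array `50` into a node mapping. -/
def assignProg : Prog :=
  .for_ 29 (.get 0 (.lit 2))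
    (.setVar 24 (.get 50 (.var 29)) ;;
    decodeProg ;;
    .for_ 23 (.get 0 (.lit 1))
      (.ite (.natLe (.lit 1) (.get 20 (.var 23))) (.setNat 6 (.var 23) (.var 29)) .skip))

theorem enc_univ (r : ℕ) : enc (Finset.univ : Finset (Fin r)) = 2 ^ r - 1 := by
  have h := Fin.sum_univ_eq_sum_range (fun i => 2 ^ i) r
  rw [Nat.geomSum_eq le_rfl] at h
  simpa [enc] using h

namespace Inst

variable {τ r s : ℕ} {I : Inst τ r s}

/-- The invariant is that decoding the current mapping `b` by the eliminations not yet undone gives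
the final mapping. Each set is kept as its code, so that splitting off the recorded choice is a
subtraction. -/
theorem undoProg_run {h : List (Elim r s I.substrate.size)} {root : Fin s} {σ : State}
    (hσ : I.Ctx σ) (hh : I.substrate.Legal h) (hR : Recorded h σ) (hr : alive h = {root})
    (h45 : σ.nat 45 0 = h.length) (h49 : σ.nat 49 0 = root) :
    Run undoProg σ (100 * (s + 1)) fun σ' =>
      ∀ x : Fin s, σ'.nat 50 x = enc (fiber (decode h fun _ => root) x) := by
  have hlen : h.length ≤ s := by have := hh.card; omega
  refine (Run.seq (T := 20) (T' := (h.length + 1) * (60 + 6 + 1)) ((Run.straight _ _ rfl).conseq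
    (by simp [Prog.bound, NExp.time]) fun σ1 e1 hF1 => ?_)).mono (by nlinarith) fun _ h => h
  have c1 := hσ.framed hF1
  refine (Run.while_ (J := fun n σ' => ∃ h' b, h' <:+ h ∧ h'.length = n ∧ σ'.nat 45 0 = n ∧
    decode h' b = decode h (fun _ => root) ∧ (∀ w, b w ∈ alive h') ∧
    ∀ x ∈ alive h', σ'.nat 50 x = enc (fiber b x)) (T := 60) h.length ?_ ?_).conseq
    (by simp [NExp.time]) ?_
  · refine ⟨h, fun _ => root, List.suffix_rfl, rfl, ?_, rfl, by simp [hr], ?_⟩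
    · rw [hF1.nat 45 rfl, h45]
    · intro x hx
      rw [hr, Finset.mem_singleton] at hx
      have : fiber (fun _ : Fin r => root) root = Finset.univ := by ext; simp [mem_fiber]
      subst e1 hx
      have h2 := enc_univ r
      simp [Prog.result, NExp.eval, h49, hσ.numSets, this]
      omega
  · rintro n σ2 ⟨h', b, hs, hn, h45', hd, hb, hA⟩ hlt hF2
    rw [BExp.holds_lt] at hlt
    simp only [NExp.eval, h45'] at hlt
    obtain ⟨ε, h', rfl⟩ : ∃ ε h'', h' = ε :: h'' := by
      cases h' with
      | nil => rw [← hn] at hlt; exact absurd hlt (by simp)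
      | cons ε h'' => exact ⟨ε, h'', rfl⟩
    obtain ⟨r1, r2, -, -, -, r6⟩ := hR ε h' hs
    have hc := (hh.suffix hs).1
    have hbv : ∀ w, b w ≠ ε.v := fun w => (Finset.mem_erase.1 (hb w)).1
    rw [List.length_cons] at hn
    have k45 : n - 1 = h'.length := by omega
    have k40 : σ2.nat 40 h'.length = ε.v := by rw [hF2.nat 40 rfl, hF1.nat 40 rfl, r1]
    have k41 : σ2.nat 41 ε.v = ε.p := by rw [hF2.nat 41 rfl, hF1.nat 41 rfl, r2]
    have k31 : σ2.nat 31 (ε.v * 2 ^ r + enc (fiber b ε.p)) = enc (ε.ch (fiber b ε.p)) := by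
      rw [hF2.nat 31 rfl, hF1.nat 31 rfl, (r6 _).2]
    have k16 : σ2.nat 16 ε.v = ε.v * 2 ^ r := (c1.framed hF2).base ε.v ε.v.2
    have kp : σ2.nat 50 ε.p = enc (fiber b ε.p) :=
      hA _ (Finset.mem_erase.2 ⟨hc.ne.symm, hc.p_mem⟩)
    have hpv : (ε.p : ℕ) ≠ ε.v := fun h => hc.ne (Fin.ext h.symm)
    refine Run.of_straight rfl (by simp [Prog.bound, NExp.time]) ⟨n - 1, by omega, h', ε.undo b,
      (List.suffix_cons _ _).trans hs, by omega, ?_, hd, hc.undo_mem hb, ?_⟩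
    · simp [Prog.result, NExp.eval, h45']
    · intro x hx
      by_cases hxv : x = ε.v
      · subst hxv
        rw [fiber_undo_v (fun S => (r6 S).1) hbv]
        simp [Prog.result, NExp.eval, h45', k45, k40, k41, k31, k16, kp, hpv.symm]
      · have hxv' : (x : ℕ) ≠ ε.v := fun h => hxv (Fin.ext h)
        by_cases hxp : x = ε.p
        · subst hxp
          have := enc_sdiff (r6 (fiber b ε.p)).1
          rw [fiber_undo_p hc.ne]
          simp [Prog.result, NExp.eval, h45', k45, k40, k41, k31, k16, kp, hpv]
          omega
        · have hxp' : (x : ℕ) ≠ ε.p := fun h => hxp (Fin.ext h)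
          rw [fiber_undo_of_ne hxp hxv, ← hA x (Finset.mem_erase.2 ⟨hxv, hx⟩)]
          simp [Prog.result, NExp.eval, h45', k45, k40, k41, hxv', hxp']
  · rintro σ2 ⟨⟨n, h', b, hs, hn, h45', hd, hb, hA⟩, hlt⟩ _ x
    rw [BExp.holds_lt] at hlt
    simp only [NExp.eval, h45'] at hlt
    obtain rfl : h' = [] := List.eq_nil_of_length_eq_zero (by omega)
    rw [← hd]
    exact hA x (by simp [alive])

theorem assignProg_run {a : Fin r → Fin s} {σ : State} (hσ : I.Ctx σ)
    (h50 : ∀ x : Fin s, σ.nat 50 x = enc (fiber a x)) :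
    Run assignProg σ ((s + 1) * (200 * (r + 1))) fun σ' => ∀ w : Fin r, σ'.nat 6 w = a w := by
  refine (Run.for_ (J := fun n σ' => ∀ w : Fin r, (a w : ℕ) < n → σ'.nat 6 w = a w)
    (T := 5 + (100 * (r + 1) + (r + 1) * (12 + 2 + 15))) s rfl ?_ ?_ ?_).conseq ?_ ?_
  · intro k σ1 _ hF1
    exact (hσ.framed hF1).subNodes
  · intro w hw; omega
  · intro k σ1 hJ hk hik hF1
    have c1 := hσ.framed hF1
    refine Run.seq ((Run.straight _ _ rfl).conseq (by simp [Prog.bound, NExp.time])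
      fun σ2 e2 hF2 => ?_)
    have c2 := c1.framed hF2
    have m2 : σ2.nat 24 0 = enc (fiber a ⟨k, hk⟩) := by
      have := h50 ⟨k, hk⟩
      subst e2
      simp only [Prog.result, State.writeNat_nat, NExp.eval, hik, and_self, if_true]
      rw [hF1.nat 50 rfl]; exact this
    refine Run.seq ((decodeProg_run c2 m2).conseq le_rfl fun σ3 h3 hF3 => ?_)
    have c3 := c2.framed hF3
    have i3 : σ3.nat 29 0 = k := by rw [hF3.nat 29 rfl, hF2.nat 29 rfl, hik]
    refine (Run.for_ (J := fun n σ' => ∀ w : Fin r, ((a w : ℕ) < k ∨ (a w : ℕ) = k ∧ (w : ℕ) < n) →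
      σ'.nat 6 w = a w) (T := 12) r rfl ?_ ?_ ?_).conseq (by simp [NExp.time]) ?_
    · intro j σ4 _ hF4
      exact (c3.framed hF4).reqNodes
    · intro w hw
      have : σ3.nat 6 w = a w := by
        rw [hF3.nat 6 rfl, hF2.nat 6 rfl]
        exact hJ w (by omega)
      simpa using this
    · intro j σ4 hJ4 hj hij hF4
      have i4 : σ4.nat 29 0 = k := by rw [hF4.nat 29 rfl, i3]
      have k20 : σ4.nat 20 j = if a ⟨j, hj⟩ = ⟨k, hk⟩ then 1 else 0 := by
        have := h3 ⟨j, hj⟩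
        rw [hF4.nat 20 rfl]
        simpa [mem_fiber] using this
      refine Run.of_straight rfl (by simp [Prog.bound, BExp.time, NExp.time]) fun w hw => ?_
      simp only [Prog.result, BExp.holds_natLe, NExp.eval, hij, k20]
      by_cases hwj : w = ⟨j, hj⟩
      · subst hwj
        by_cases hak : a ⟨j, hj⟩ = ⟨k, hk⟩
        · simp [hak, i4]
        · have hak' : (a ⟨j, hj⟩ : ℕ) ≠ k := fun h => hak (Fin.ext h)
          have := hJ4 ⟨j, hj⟩ (by omega)
          simpa [hak] using this
      · have hwj' : (w : ℕ) ≠ j := fun h => hwj (Fin.ext h)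
        have := hJ4 w (by omega)
        split <;> simp [hwj', this]
    · intro σ4 h4 _ w hw
      have := h4 w (by omega)
      simpa using this
  · simp only [NExp.time]
    exact Nat.mul_le_mul_left _ (by omega)
  · intro σ1 h1 _ w
    exact h1 w (a w).2

end Inst

end VNEP

namespace VNEP

open Elim
open scoped ENNReal

/-! ### Construction of the paths -/

/-- Climbs from both nodes, in the variables `47` and `48`, until they agree. -/
def climbProg : Prog :=
  .loop (.ne (.var 47) (.var 48))
    (.ite (.lt (.get 44 (.var 47)) (.get 44 (.var 48)))
      (.setNat 8 (.var 51) (.get 42 (.var 47)) ;;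
        .setVar 51 (.add (.var 51) (.lit 1)) ;;
        .setVar 47 (.get 41 (.var 47)))
      (.setNat 52 (.var 45) (.get 43 (.var 48)) ;;
        .setVar 45 (.add (.var 45) (.lit 1)) ;;
        .setVar 48 (.get 41 (.var 48))))

/-- Moves the contents of the stack to the output. -/
def popProg : Prog :=
  .loop (.lt (.lit 0) (.var 45))
    (.setVar 45 (.sub (.var 45) (.lit 1)) ;;
    .setNat 8 (.var 51) (.get 52 (.var 45)) ;;
    .setVar 51 (.add (.var 51) (.lit 1)))

/-- Writes the paths for all request edges. -/
def pathsProg : Prog :=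
  (.setVar 51 (.lit 0) ;; .setNat 7 (.lit 0) (.lit 0)) ;;
  .for_ 29 (.get 0 (.lit 3))
    ((.setVar 47 (.get 6 (.get 1 (.var 29))) ;;
      .setVar 48 (.get 6 (.get 2 (.var 29))) ;;
      .setVar 45 (.lit 0)) ;;
    climbProg ;;
    popProg ;;
    .setNat 7 (.add (.var 29) (.lit 1)) (.var 51))

/-- The entries of the list `q` stand in array `a` from cell `k` on. -/
def Listed {m : ℕ} (σ : State) (a k : ℕ) (q : List (Fin m)) : Prop :=
  ∀ (j : ℕ) (e : Fin m), q[j]? = some e → σ.nat a (k + j) = e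

theorem Listed.snoc {m : ℕ} {σ σ' : State} {a k : ℕ} {q : List (Fin m)} (h : Listed σ a k q)
    {e : Fin m} (hlt : ∀ i < k + q.length, σ'.nat a i = σ.nat a i)
    (he : σ'.nat a (k + q.length) = e) : Listed σ' a k (q ++ [e]) := by
  intro j f hf
  rcases lt_trichotomy j q.length with hj | rfl | hj
  · rw [List.getElem?_append_left hj] at hf
    rw [hlt _ (by omega), h j f hf]
  · simp only [List.getElem?_concat_length, Option.some.injEq] at hf
    rw [he, hf]
  · rw [List.getElem?_eq_none (by simp; omega)] at hf
    simp at hf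

theorem Listed.of_append {m : ℕ} {σ σ' : State} {a k : ℕ} {q q' : List (Fin m)}
    (h : Listed σ a k (q ++ q')) (hlt : ∀ i < k + q.length, σ'.nat a i = σ.nat a i) :
    Listed σ' a k q := by
  intro j e he
  have hj : j < q.length := (List.getElem?_eq_some_iff.1 he).1
  rw [hlt _ (by omega)]
  exact h j e (by rwa [List.getElem?_append_left hj])

theorem Listed.congr {m : ℕ} {σ σ' : State} {a k : ℕ} {q : List (Fin m)}
    (h : Listed σ a k q) (hlt : ∀ i < k + q.length, σ'.nat a i = σ.nat a i) : Listed σ' a k q :=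
  Listed.of_append (q' := []) (by simpa using h) hlt

namespace Inst

variable {τ r s : ℕ} {I : Inst τ r s}

/-- The loop takes a `Route` apart from outside: comparing the ranks of the ends tells which
constructor came last. Links climbed from the source go directly to the output; those climbed from
the target come in reverse order and wait on a stack. -/
theorem climbProg_run {h : List (Elim r s I.substrate.size)} {x y : Fin s}
    {q : List (Fin I.substrate.size)} {k : ℕ} {σ : State} (hR : Recorded h σ)
    (hrank : ∀ x : Fin s, σ.nat 44 x = rank h x) (hq : I.substrate.Route h x y q)
    (h47 : σ.nat 47 0 = x) (h48 : σ.nat 48 0 = y) (h45 : σ.nat 45 0 = 0) (h51 : σ.nat 51 0 = k) :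
    Run climbProg σ ((q.length + 1) * 100) fun σ' => ∃ q₁ q₂, q₁ ++ q₂ = q ∧
      σ'.nat 51 0 = k + q₁.length ∧ Listed σ' 8 k q₁ ∧ σ'.nat 45 0 = q₂.length ∧
      Listed σ' 52 0 q₂.reverse ∧ ∀ i < k, σ'.nat 8 i = σ.nat 8 i := by
  refine (Run.while_ (J := fun n σ' => ∃ x y p q₁ q₂, I.substrate.Route h x y p ∧ p.length = n ∧
    σ'.nat 47 0 = x ∧ σ'.nat 48 0 = y ∧ q₁ ++ p ++ q₂ = q ∧ σ'.nat 51 0 = k + q₁.length ∧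
    Listed σ' 8 k q₁ ∧ σ'.nat 45 0 = q₂.length ∧ Listed σ' 52 0 q₂.reverse ∧
    ∀ i < k, σ'.nat 8 i = σ.nat 8 i) (T := 60) q.length ?_ ?_).conseq ?_ ?_
  · exact ⟨x, y, q, [], [], hq, rfl, h47, h48, by simp, by simp [h51], by simp [Listed],
      by simp [h45], by simp [Listed], fun _ _ => rfl⟩
  · rintro n σ1 ⟨x, y, p, q₁, q₂, hp, rfl, k47, k48, rfl, k51, k8, k45, k52, kk⟩ hne hF
    rw [BExp.holds_ne] at hne
    simp only [NExp.eval, k47, k48] at hne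
    have hrank' : ∀ x : Fin s, σ1.nat 44 x = rank h x := fun x => by rw [hF.nat 44 rfl, hrank]
    refine Run.of_straight rfl (by simp [Prog.bound, NExp.time]) ?_
    simp only [Prog.result, BExp.holds_lt, NExp.eval, k47, k48, hrank']
    cases hp with
    | nil => exact absurd rfl hne
    | @up ε h' _ e p hs hr he hp =>
      obtain ⟨-, r2, r3, -, -, -⟩ := hR ε h' hs
      have k41 : σ1.nat 41 ε.v = ε.p := by rw [hF.nat 41 rfl, r2]
      have k42 : σ1.nat 42 ε.v = e := by rw [hF.nat 42 rfl, r3 e he]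
      rw [if_pos hr]
      refine ⟨p.length, by simp, ε.p, y, p, q₁ ++ [e], q₂, hp, rfl, ?_, ?_, by simp, ?_, ?_, ?_,
        ?_, ?_⟩
      · simp [k47, k41]
      · simp [k48]
      · simp [k51]; omega
      · refine k8.snoc (fun i hi => ?_) ?_
        · have : i ≠ k + q₁.length := by omega
          simp [k51, this]
        · simp [k51, k42]
      · simp [k45]
      · simpa [Listed] using k52
      · intro i hi
        have : i ≠ k + q₁.length := by omega
        simp [k51, this, kk i hi]
    | @down ε h' _ e p hs hr he hp =>
      obtain ⟨-, r2, -, r4, -, -⟩ := hR ε h' hs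
      have k41 : σ1.nat 41 ε.v = ε.p := by rw [hF.nat 41 rfl, r2]
      have k43 : σ1.nat 43 ε.v = e := by rw [hF.nat 43 rfl, r4 e he]
      rw [if_neg (by omega)]
      refine ⟨p.length, by simp, x, ε.p, p, q₁, e :: q₂, hp, rfl, ?_, ?_, by simp, ?_, ?_, ?_,
        ?_, ?_⟩
      · simp [k47]
      · simp [k48, k41]
      · simp [k51]
      · simpa [Listed] using k8
      · simp [k45]
      · rw [List.reverse_cons]
        refine k52.snoc (fun i hi => ?_) ?_
        · have : i ≠ q₂.length := by simp at hi; omega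
          simp [k45, this]
        · simp [k45, k43]
      · intro i hi
        simp [kk i hi]
  · simp only [BExp.ne, BExp.time, NExp.time]
    exact Nat.mul_le_mul_left _ (by omega)
  · rintro σ1 ⟨⟨n, x, y, p, q₁, q₂, hp, -, k47, k48, rfl, k51, k8, k45, k52, kk⟩, hne⟩ _
    rw [BExp.holds_ne, not_not] at hne
    simp only [NExp.eval, k47, k48] at hne
    -- The constructors `up` and `down` join ends of different ranks, so when the ends agree only
    -- the empty route remains.
    obtain rfl : p = [] := by
      cases hp with
      | nil => rfl
      | up hs hr => exact absurd (congrArg (rank h) (Fin.ext hne)) hr.ne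
      | down hs hr => exact absurd (congrArg (rank h) (Fin.ext hne)) hr.ne'
    exact ⟨q₁, q₂, by simp, k51, k8, k45, k52, kk⟩

theorem _root_.VNEP.popProg_run {m k : ℕ} {q₁ q₂ : List (Fin m)} {σ : State}
    (h51 : σ.nat 51 0 = k + q₁.length) (h8 : Listed σ 8 k q₁) (h45 : σ.nat 45 0 = q₂.length)
    (h52 : Listed σ 52 0 q₂.reverse) :
    Run popProg σ ((q₂.length + 1) * 50) fun σ' => σ'.nat 51 0 = k + (q₁ ++ q₂).length ∧
      Listed σ' 8 k (q₁ ++ q₂) ∧ ∀ i < k, σ'.nat 8 i = σ.nat 8 i := by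
  refine (Run.loop (J := fun n σ' => ∃ p p' : List (Fin m), p ++ p' = q₁ ++ q₂ ∧ p'.length = n ∧
    σ'.nat 51 0 = k + p.length ∧ Listed σ' 8 k p ∧ σ'.nat 45 0 = p'.length ∧
    Listed σ' 52 0 p'.reverse ∧ ∀ i < k, σ'.nat 8 i = σ.nat 8 i) (T := 30) q₂.length
    ⟨q₁, q₂, rfl, rfl, h51, h8, h45, h52, fun _ _ => rfl⟩ ?_).mono ?_ ?_
  · rintro n σ1 ⟨p, p', hpp, rfl, k51, k8, k45, k52, kk⟩ hlt
    rw [BExp.holds_lt] at hlt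
    simp only [NExp.eval, k45] at hlt
    cases p' with
    | nil => exact absurd hlt (by simp)
    | cons e p' =>
      have ke : σ1.nat 52 p'.length = e := by
        have := k52 p'.length e (by simp)
        rwa [zero_add] at this
      refine Run.of_straight rfl (by simp [Prog.bound, NExp.time]) ⟨p'.length, by simp, p ++ [e],
        p', by simpa using hpp, rfl, ?_, ?_, ?_, ?_, ?_⟩
      · simp [Prog.result, NExp.eval, k51]; omega
      · refine k8.snoc (fun i hi => ?_) ?_
        · have : i ≠ k + p.length := by omega
          simp [Prog.result, NExp.eval, k51, this]
        · simp [Prog.result, NExp.eval, k51, k45, ke]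
      · simp [Prog.result, NExp.eval, k45]
      · rw [List.reverse_cons] at k52
        exact k52.of_append fun i _ => by simp [Prog.result]
      · intro i hi
        have : i ≠ k + p.length := by omega
        simp [Prog.result, NExp.eval, k51, this, kk i hi]
  · simp only [BExp.time_lt, NExp.time]
    exact Nat.mul_le_mul_left _ (by omega)
  · rintro σ1 ⟨⟨n, p, p', hpp, -, k51, k8, k45, -, kk⟩, hlt⟩
    rw [BExp.holds_lt] at hlt
    simp only [NExp.eval, k45] at hlt
    obtain rfl : p' = [] := List.eq_nil_of_length_eq_zero (by omega)
    rw [List.append_nil] at hpp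
    subst hpp
    exact ⟨k51, k8, kk⟩

theorem pathsProg_run {h : List (Elim r s I.substrate.size)} {σ : State} (hσ : I.Inp σ)
    (hh : I.substrate.Legal h) (hR : Recorded h σ) (hrank : ∀ x : Fin s, σ.nat 44 x = rank h x)
    {M : I.Mapping} (hM : ∀ w : Fin r, σ.nat 6 w = M.node w)
    (hq : ∀ e, I.substrate.Route h (M.node (I.request.src e)) (M.node (I.request.dst e))
      (M.edge e)) :
    Run pathsProg σ ((I.request.size + 1) * (300 * (s + 1))) (I.Displays · M) := by
  refine (Run.seq (T := 10) (T' := (I.request.size + 1) * ((20 + (100 * s + (50 * s + 10))) + 2 + 15))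
    ((Run.straight _ _ rfl).conseq (by simp [Prog.bound, NExp.time])
      fun σ1 e1 hF1 => ?_)).mono (by nlinarith) fun _ h => h
  have i1 := hσ.framed hF1
  -- Here `k` is the first free cell of array `8`. All stored paths end at or before it, so writing
  -- the next path does not damage them.
  refine (Run.for_ (J := fun n σ' => (∃ k, σ'.nat 51 0 = k ∧ σ'.nat 7 n = k ∧
    ∀ e : Fin I.request.size, (e : ℕ) < n → σ'.nat 7 e + (M.edge e).length ≤ k) ∧
    ∀ e : Fin I.request.size, (e : ℕ) < n →
      σ'.nat 7 e + (M.edge e).length = σ'.nat 7 (e + 1) ∧ Listed σ' 8 (σ'.nat 7 e) (M.edge e))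
    (T := 20 + (100 * s + (50 * s + 10))) I.request.size rfl ?_ ?_ ?_).conseq (by rfl) ?_
  · intro n σ2 _ hF2
    exact (i1.framed hF2).reqEdges
  · subst e1
    refine ⟨⟨0, ?_, ?_, fun e he => by omega⟩, fun e he => by omega⟩ <;>
      simp [Prog.result, NExp.eval]
  · rintro n σ2 ⟨⟨k, k51, k7, kle⟩, kd⟩ hn hin hF2
    have i2 := i1.framed hF2
    -- A route is a path, hence shorter than `s`; this bounds the climbing and the emptying of the
    -- stack.
    have hlen : (M.edge ⟨n, hn⟩).length < s := ((hq ⟨n, hn⟩).isPath hh).1.length_lt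
    have R2 : Recorded h σ2 := by
      unfold Recorded
      rw [hF2.nat 31 rfl, hF2.nat 40 rfl, hF2.nat 41 rfl, hF2.nat 42 rfl, hF2.nat 43 rfl,
        hF2.nat 44 rfl, hF1.nat 31 rfl, hF1.nat 40 rfl, hF1.nat 41 rfl, hF1.nat 42 rfl,
        hF1.nat 43 rfl, hF1.nat 44 rfl]
      exact hR
    have m6 : ∀ w : Fin r, σ2.nat 6 w = M.node w := fun w => by
      rw [hF2.nat 6 rfl, hF1.nat 6 rfl, hM]
    have s1 := i2.reqSrc ⟨n, hn⟩
    have s2 := i2.reqDst ⟨n, hn⟩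
    simp only at s1 s2
    refine Run.seq ((Run.straight _ _ rfl).conseq (by simp [Prog.bound, NExp.time])
      fun σ3 e3 hF3 => ?_)
    refine Run.seq ((climbProg_run (h := h) (k := k) (hq := hq ⟨n, hn⟩) ?_ ?_ ?_ ?_ ?_ ?_).conseq
      (by nlinarith) fun σ4 h4 hF4 => ?_)
    · unfold Recorded
      rw [hF3.nat 31 rfl, hF3.nat 40 rfl, hF3.nat 41 rfl, hF3.nat 42 rfl, hF3.nat 43 rfl,
        hF3.nat 44 rfl]
      exact R2
    · intro x
      rw [hF3.nat 44 rfl, hF2.nat 44 rfl, hF1.nat 44 rfl, hrank]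
    · subst e3
      simp [Prog.result, NExp.eval, hin, s1, m6]
    · subst e3
      simp [Prog.result, NExp.eval, hin, s2, m6]
    · subst e3
      simp [Prog.result, NExp.eval]
    · rw [hF3.nat 51 rfl, k51]
    · obtain ⟨q₁, q₂, hqq, p51, p8, p45, p52, pk⟩ := h4
      have hl2 : q₂.length < s := by
        rw [← hqq, List.length_append] at hlen; omega
      refine Run.seq ((popProg_run p51 p8 p45 p52).conseq (T' := 50 * s) (by nlinarith)
        fun σ5 h5 hF5 => ?_)
      rw [hqq] at h5
      obtain ⟨u51, u8, uk⟩ := h5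
      have e7 : σ5.nat 7 = σ2.nat 7 := by rw [hF5.nat 7 rfl, hF4.nat 7 rfl, hF3.nat 7 rfl]
      have e29 : σ5.nat 29 0 = n := by
        rw [hF5.nat 29 rfl, hF4.nat 29 rfl, hF3.nat 29 rfl, hin]
      have e8 : ∀ i < k, σ5.nat 8 i = σ2.nat 8 i := fun i hi => by
        rw [uk i hi, pk i hi, hF3.nat 8 rfl]
      refine Run.of_straight rfl (by simp [Prog.bound, NExp.time]) ⟨⟨k + (M.edge ⟨n, hn⟩).length,
        ?_, ?_, ?_⟩, ?_⟩
      · simpa [Prog.result] using u51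
      · simp [Prog.result, NExp.eval, e29, u51]
      · intro e he
        have he' : (e : ℕ) ≠ n + 1 := by omega
        by_cases hen : (e : ℕ) = n
        · obtain rfl : e = ⟨n, hn⟩ := Fin.ext hen
          simp [Prog.result, NExp.eval, e29, e7, k7]
        · have := kle e (by omega)
          simp [Prog.result, NExp.eval, e29, e7, he']
          omega
      · intro e he
        have he' : (e : ℕ) ≠ n + 1 := by omega
        by_cases hen : (e : ℕ) = n
        · obtain rfl : e = ⟨n, hn⟩ := Fin.ext hen
          refine ⟨?_, ?_⟩
          · simp [Prog.result, NExp.eval, e29, e7, k7, u51]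
          · simpa [Prog.result, NExp.eval, e29, e7, k7, Listed] using u8
        · obtain ⟨d1, d2⟩ := kd e (by omega)
          have := kle e (by omega)
          refine ⟨?_, ?_⟩
          · simpa [Prog.result, NExp.eval, e29, e7, hen, he'] using d1
          · have : Listed σ5 8 (σ2.nat 7 e) (M.edge e) := d2.congr fun i hi => e8 i (by omega)
            simpa [Prog.result, NExp.eval, e29, e7, he', Listed] using this
  · rintro σ2 ⟨-, hd⟩ hF2
    refine ⟨fun w => ?_, fun e => (hd e e.2).1, fun e j hj => (hd e e.2).2 j _ ?_⟩
    · rw [hF2.nat 6 rfl, hF1.nat 6 rfl, hM]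
    · exact List.getElem?_eq_getElem hj

end Inst

end VNEP

namespace VNEP

open Elim
open scoped ENNReal

/-! ### The algorithm -/

namespace Inst

variable {τ r s : ℕ} {I : Inst τ r s} {h : List (Elim r s I.substrate.size)}
  {G : Fin s → Finset (Fin r) → ℝ≥0∞} {root : Fin s}

theorem Good.le_total (hG : I.Good h G) (hh : I.substrate.Legal h) (hr : alive h = {root})
    (a : Fin r → Fin s) : G root Finset.univ ≤ I.total h a := by
  have h1 := hG.le a
  have h2 : fiber (rep h ∘ a) root = Finset.univ := by
    ext w
    have := hh.rep_mem (a w)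
    rw [hr, Finset.mem_singleton] at this
    simp [this]
  rwa [hr, Finset.sum_singleton, h2] at h1

theorem Good.total_decode (hG : I.Good h G) (hh : I.substrate.Legal h) (hr : alive h = {root}) :
    I.total h (decode h fun _ => root) = G root Finset.univ := by
  refine le_antisymm ?_ (hG.le_total hh hr _)
  have h1 := (hG.ge (fun _ => root) (by simp [hr])).2
  have h2 : fiber (fun _ : Fin r => root) root = Finset.univ := by ext w; simp
  rwa [hr, Finset.sum_singleton, h2] at h1

theorem Good.not_feasible (hG : I.Good h G) (hl : ∀ e, I.substrate.src e ≠ I.substrate.dst e)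
    (hh : I.substrate.Legal h) (hr : alive h = {root}) (ht : G root Finset.univ = ⊤) :
    ¬ ∃ M : I.Mapping, M.Feasible := by
  rintro ⟨M, hM⟩
  have h1 := hG.le_total hh hr M.node
  rw [(total_final hM.valid.path hl hh hr).1 hM, ht] at h1
  exact ENNReal.coe_ne_top (top_le_iff.1 h1)

/-- If the value at the root is finite, the recorded choices decode to a node mapping with this
total value, and finiteness supplies a route for every request edge. By `total_final` the mapping is
feasible with this cost, and the total value of any feasible mapping, which is its cost, is at least
the value at the root. -/
theorem Good.exists_optimal (hG : I.Good h G) (hl : ∀ e, I.substrate.src e ≠ I.substrate.dst e)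
    (hh : I.substrate.Legal h) (hr : alive h = {root}) {z : ℝ≥0} (hz : G root Finset.univ = z) :
    ∃ M : I.Mapping, M.Optimal ∧ M.cost = z ∧ M.node = (decode h fun _ => root) ∧
      ∀ e, I.substrate.Route h (M.node (I.request.src e)) (M.node (I.request.dst e))
        (M.edge e) := by
  have h1 : I.total h (decode h fun _ => root) = z := (hG.total_decode hh hr).trans hz
  have h2 : I.total h (decode h fun _ => root) ≠ ⊤ := h1 ▸ ENNReal.coe_ne_top
  choose q hq using exists_route_of_total_ne_top hh hr h2
  obtain ⟨M, hM⟩ : ∃ M : I.Mapping, M = ⟨decode h fun _ => root, q⟩ := ⟨_, rfl⟩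
  have hp : ∀ e, I.substrate.IsPath (M.node (I.request.src e)) (M.node (I.request.dst e))
      (M.edge e) := fun e => hM ▸ ((hq e).isPath hh).1
  have hf := total_final hp hl hh hr
  have hfeas : M.Feasible := hf.2 (by rw [hM]; exact h2)
  have hcost : M.cost = z := by
    have := hf.1 hfeas
    rw [hM, h1, ← hM] at this
    exact_mod_cast this.symm
  refine ⟨M, ⟨hfeas, fun M' hM' => ?_⟩, hcost, by rw [hM], by rw [hM]; exact hq⟩
  have h3 := hG.le_total hh hr M'.node
  rw [(total_final hM'.valid.path hl hh hr).1 hM', hz] at h3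
  rw [hcost]
  exact_mod_cast h3

/-- Reads off the answer. -/
def _root_.VNEP.answerProg : Prog :=
  .ite (.natLe (.lit 1) (.get 30 (.add (.get 16 (.var 49)) (.sub (.var 14) (.lit 1)))))
    ((.setReal 6 (.lit 0) (.get 10 (.add (.get 16 (.var 49)) (.sub (.var 14) (.lit 1)))) ;;
        .setVar 5 (.lit 1) ;;
        .setNat 44 (.var 49) (.get 0 (.lit 2))) ;;
      undoProg ;;
      assignProg ;;
      pathsProg)
    (.setVar 5 (.lit 0))

theorem answerProg_run (hT : I.substrate.IsTree) {i v : ℕ} {σ : State}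
    (hF : I.Forward h G i v σ) (hr : alive h = {root}) (h49 : σ.nat 49 0 = root) :
    Run answerProg σ (100 + (100 * (s + 1) + ((s + 1) * (200 * (r + 1)) +
      (I.request.size + 1) * (300 * (s + 1))))) I.Answered := by
  have hbase : σ.nat 16 root = root * 2 ^ r := hF.base root root.2
  have hval := hF.table root Finset.univ
  rw [enc_univ] at hval
  refine (Run.ite (T := 40 + (100 * (s + 1) + ((s + 1) * (200 * (r + 1)) +
    (I.request.size + 1) * (300 * (s + 1))))) (fun hb => ?_) fun hb => ?_).mono
    (by simp only [BExp.time, NExp.time]; omega) fun _ h => h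
  · simp only [BExp.holds_natLe, NExp.eval, h49, hF.numSets, hbase] at hb
    obtain ⟨z, hz, hz'⟩ : ∃ z : ℝ≥0, σ.real 10 (root * 2 ^ r + (2 ^ r - 1)) = z ∧
        G root Finset.univ = z := by
      rcases hval with hval | hval
      · omega
      · exact hval.2
    obtain ⟨M, hM, hcost, hnode, hroute⟩ := hF.good.exists_optimal hT.1 hF.legal hr hz'
    refine Run.seq ((Run.straight _ _ rfl).conseq (by simp [Prog.bound, NExp.time, RExp.time])
      fun σ1 e1 hF1 => ?_)
    have c1 := hF.toCtx.framed hF1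
    -- The root was never eliminated, so giving it the rank `s` in array `44`, as the climbing
    -- needs, destroys no record.
    have hnr : ∀ ε h', ε :: h' <:+ h → ε.v ≠ root := by
      rintro ε h' hs rfl
      have : ε.v ∈ alive h := by simp [hr]
      have := alive_subset hs this
      simp [alive] at this
    have k44 : ∀ x : Fin s, σ1.nat 44 x = if x = root then s else σ.nat 44 x := by
      intro x
      subst e1
      simp [Prog.result, NExp.eval, h49, hF.toCtx.subNodes, Fin.ext_iff]
    have R1 : Recorded h σ1 := by
      intro ε h' hs
      rw [k44, if_neg (hnr ε h' hs), hF1.nat 40 rfl, hF1.nat 41 rfl, hF1.nat 42 rfl,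
        hF1.nat 43 rfl, hF1.nat 31 rfl]
      exact hF.recorded ε h' hs
    have hrank : ∀ x : Fin s, σ1.nat 44 x = rank h x := by
      intro x
      rw [k44]
      split
      · rename_i hx
        rw [rank_of_mem_alive (by simp [hr, hx])]
      · rename_i hx
        obtain ⟨ε, h', hs, rfl⟩ := exists_of_not_mem (h := h) (x := x) (by simpa [hr] using hx)
        rw [hF.legal.rank_v hs, (hF.recorded ε h' hs).2.2.2.2.1]
    refine Run.seq ((undoProg_run c1 hF.legal R1 hr (by rw [hF1.nat 45 rfl, hF.count])
      (by rw [hF1.nat 49 rfl, h49])).conseq le_rfl fun σ2 h2 hF2 => ?_)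
    have c2 := c1.framed hF2
    refine Run.seq ((assignProg_run c2 h2).conseq le_rfl fun σ3 h3 hF3 => ?_)
    have c3 := c2.framed hF3
    refine (pathsProg_run (h := h) c3.toInp hF.legal ?_ ?_ (hnode ▸ h3) hroute).conseq le_rfl
      fun σ4 h4 hF4 => .inr ⟨?_, M, hM, h4, ?_⟩
    · unfold Recorded
      rw [hF3.nat 31 rfl, hF3.nat 40 rfl, hF3.nat 41 rfl, hF3.nat 42 rfl, hF3.nat 43 rfl,
        hF3.nat 44 rfl, hF2.nat 31 rfl, hF2.nat 40 rfl, hF2.nat 41 rfl, hF2.nat 42 rfl,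
        hF2.nat 43 rfl, hF2.nat 44 rfl]
      exact R1
    · rw [hF3.nat 44 rfl, hF2.nat 44 rfl]
      exact hrank
    · rw [hF4.nat 5 rfl, hF3.nat 5 rfl, hF2.nat 5 rfl]
      subst e1
      simp [Prog.result, NExp.eval]
    · rw [hF4.real 6 rfl, hF3.real 6 rfl, hF2.real 6 rfl, hcost, ← hz]
      subst e1
      simp [Prog.result, NExp.eval, RExp.eval, h49, hF.numSets, hbase]
  · simp only [BExp.holds_natLe, NExp.eval, h49, hF.numSets, hbase] at hb
    have ht : G root Finset.univ = ⊤ := by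
      rcases hval with hval | hval
      · exact hval.2
      · omega
    refine Run.of_straight rfl (by simp [Prog.bound, NExp.time]; omega)
      (.inl ⟨by simp [Prog.result, NExp.eval], hF.good.not_feasible hT.1 hF.legal hr ht⟩)

/-- The program that solves Min-VNEP on trees. -/
def _root_.VNEP.solveProg : Prog :=
  tablesProg ;; initProg ;; degreesProg ;;
  (.setVar 45 (.lit 0) ;; .setVar 46 (.lit 0) ;; .setVar 47 (.lit 0) ;; .setVar 49 (.lit 0)) ;;
  forwardLoop ;; answerProg

theorem solveProg_run (I : Inst τ r s) (hT : I.substrate.IsTree) :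
    Run solveProg I.input
      (300 * ((r + 1) * 3 ^ r) + (50 * (r + s + I.request.size + I.substrate.size + 1) +
        50 * (s + 1)) + ((s + 1) * (400 * ((2 ^ r + 1) * ((τ + 1) * (r + 1)))) +
      ((I.substrate.size + 1) * 80 + (20 +
      ((2 * s + 1) * (900 * ((2 ^ r + 1) * ((τ + 1) * ((r + 1) * (r + 1)))) + 500 * 3 ^ r + 400) +
      (100 + (100 * (s + 1) + ((s + 1) * (200 * (r + 1)) +
        (I.request.size + 1) * (300 * (s + 1)))))))))) I.Answered := by
  obtain ⟨x₀⟩ : Nonempty (Fin s) := hT.2.connected.nonempty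
  have hs : 0 < s := x₀.pos
  have i0 : I.Inp I.input := ⟨fun _ _ => rfl, fun _ _ => rfl⟩
  refine Run.seq ((tablesProg_run i0).conseq le_rfl fun σ1 c1 hF1 => ?_)
  refine Run.seq ((initProg_run c1).conseq le_rfl fun σ2 t2 hF2 => ?_)
  have c2 := c1.framed hF2
  refine Run.seq ((degreesProg_run c2.toInp ?_).conseq le_rfl fun σ3 d3 hF3 => ?_)
  · intro a ha j
    simp only [List.mem_cons, List.not_mem_nil, or_false] at ha
    rcases ha with rfl | rfl | rfl | rfl <;> rw [hF2.nat _ rfl, hF1.nat _ rfl] <;> rfl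
  have c3 := c2.framed hF3
  refine Run.seq ((Run.straight _ _ rfl).conseq (by simp [Prog.bound, NExp.time])
    fun σ4 e4 hF4 => ?_)
  have c4 := c3.framed hF4
  refine Run.seq ((forwardLoop_run hT ⟨I.nodeVal, c4, trivial, good_nil, ?_, ?_, ?_, ?_, ?_, ?_, ?_,
    ⟨⟨0, hs⟩, by simp [alive], ?_⟩, .inl ⟨hs, hs⟩, ?_⟩).conseq le_rfl ?_)
  · unfold Table
    rw [hF4.nat 30 rfl, hF4.real 10 rfl, hF3.nat 30 rfl, hF3.real 10 rfl]
    exact t2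
  · intro ε h' hs
    exact absurd hs.length_le (by simp)
  · have : I.substrate.edgesIn (alive ([] : List (Elim r s I.substrate.size))) = Finset.univ := by
      simp [DiGraph.edgesIn, alive]
    rw [this]
    obtain ⟨g1, g2, g3, g4⟩ := d3
    exact ⟨by rwa [hF4.nat 33 rfl], by rwa [hF4.nat 34 rfl], by rwa [hF4.nat 35 rfl],
      by rwa [hF4.nat 36 rfl]⟩
  · have : (alive ([] : List (Elim r s I.substrate.size)) : Set (Fin s)) = Set.univ :=
      Finset.coe_univ
    rw [this]
    exact (SimpleGraph.induceUnivIso _).connected_iff.2 hT.2.connected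
  · subst e4; simp [Prog.result, NExp.eval]
  · subst e4; simp [Prog.result, NExp.eval]
  · subst e4; simp [Prog.result, NExp.eval]
  · subst e4; simp [Prog.result, NExp.eval]
  · intro x _
    omega
  · rintro σ5 ⟨h, G, root, hF, hr, h49⟩ _
    exact answerProg_run hT hF hr h49

end Inst

/-! ### The running time -/

/-- The quantity `(r + 1) ^ 2 * (2 / 3) ^ r` is largest at `r = 4`, where it is `400 / 81 < 5`; from
there on `2 * (r + 2) ^ 2 ≤ 3 * (r + 1) ^ 2`. This is what absorbs the quadratic work per set into
`3 ^ r`. -/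
theorem sq_mul_two_pow_le (r : ℕ) : (r + 1) * (r + 1) * 2 ^ r ≤ 5 * 3 ^ r := by
  rcases lt_or_ge r 4 with hr | hr
  · interval_cases r <;> norm_num
  · induction r, hr using Nat.le_induction with
    | base => norm_num
    | succ r hr ih =>
      have h1 : (r + 1 + 1) * (r + 1 + 1) * 2 ≤ 3 * ((r + 1) * (r + 1)) := by nlinarith
      calc (r + 1 + 1) * (r + 1 + 1) * 2 ^ (r + 1)
          = (r + 1 + 1) * (r + 1 + 1) * 2 * 2 ^ r := by ring
        _ ≤ 3 * ((r + 1) * (r + 1)) * 2 ^ r := Nat.mul_le_mul_right _ h1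
        _ = 3 * ((r + 1) * (r + 1) * 2 ^ r) := by ring
        _ ≤ 3 * (5 * 3 ^ r) := Nat.mul_le_mul_left _ ih
        _ = 5 * 3 ^ (r + 1) := by ring

/-- The main loop dominates: `2 * s + 1 ≤ 3 * s` and `(2 ^ r + 1) * (r + 1) ^ 2 ≤ 10 * 3 ^ r` bound
it by `3 * (9000 + 500 + 400) = 29700` times `(τ + 1) * 3 ^ r * s`. The remaining terms fit into the
rest of `50000`. -/
theorem time_le {τ r s m n : ℕ} (hs : 0 < s) (hm : m ≤ r * r) (hn : n ≤ 2 * s) :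
    300 * ((r + 1) * 3 ^ r) + (50 * (r + s + m + n + 1) + 50 * (s + 1)) +
      ((s + 1) * (400 * ((2 ^ r + 1) * ((τ + 1) * (r + 1)))) +
      ((n + 1) * 80 + (20 +
      ((2 * s + 1) * (900 * ((2 ^ r + 1) * ((τ + 1) * ((r + 1) * (r + 1)))) + 500 * 3 ^ r + 400) +
      (100 + (100 * (s + 1) + ((s + 1) * (200 * (r + 1)) + (m + 1) * (300 * (s + 1))))))))) ≤
    50000 * (τ + 1) * (3 ^ r * (s + r ^ 2)) := by
  obtain ⟨W, hW⟩ : ∃ W, W = 3 ^ r := ⟨_, rfl⟩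
  obtain ⟨X, hX⟩ : ∃ X, X = (2 ^ r + 1) * ((r + 1) * (r + 1)) := ⟨_, rfl⟩
  obtain ⟨A, hA⟩ : ∃ A, A = τ + 1 := ⟨_, rfl⟩
  have hA1 : 1 ≤ A := by omega
  have hW1 : 1 ≤ W := hW ▸ Nat.one_le_pow _ _ (by norm_num)
  have h2 : 1 ≤ 2 ^ r := Nat.one_le_two_pow
  have hsq := sq_mul_two_pow_le r
  have hXW : X ≤ 10 * W := by
    rw [hX, hW]
    nlinarith [Nat.mul_le_mul_left ((r + 1) * (r + 1)) h2]
  have hrr : r ≤ r * r := Nat.le_mul_self r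
  have hrX : (2 ^ r + 1) * (r + 1) ≤ X := hX ▸ Nat.mul_le_mul_left _ (by nlinarith)
  have hrW : r * r + 1 ≤ 5 * W := by
    rw [hW]
    nlinarith [Nat.mul_le_mul_left ((r + 1) * (r + 1)) h2]
  obtain ⟨B, hB⟩ : ∃ B, B = W * (s + r ^ 2) := ⟨_, rfl⟩
  have hsB : W * s ≤ B := hB ▸ Nat.mul_le_mul_left _ (by omega)
  have hsr : s + r * r ≤ B := by
    rw [hB, pow_two]; exact Nat.le_mul_of_pos_left _ hW1
  have hBA : B ≤ A * B := Nat.le_mul_of_pos_left _ hA1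
  have hsBA : A * (W * s) ≤ A * B := Nat.mul_le_mul_left _ hsB
  -- The list of pairs costs `(r + 1) * 3 ^ r`, and `r + 1 ≤ s + r ^ 2` because `s` is positive.
  have t1 : (r + 1) * W ≤ B := by
    rw [hB, mul_comm, pow_two]; exact Nat.mul_le_mul_left _ (by omega)
  have t2 : (s + 1) * (400 * ((2 ^ r + 1) * (A * (r + 1)))) ≤ 8000 * (A * B) := by
    calc (s + 1) * (400 * ((2 ^ r + 1) * (A * (r + 1))))
        = (s + 1) * (400 * (A * ((2 ^ r + 1) * (r + 1)))) := by ring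
      _ ≤ (2 * s) * (400 * (A * (10 * W))) :=
        Nat.mul_le_mul (by omega)
          (Nat.mul_le_mul_left _ (Nat.mul_le_mul_left _ (hrX.trans hXW)))
      _ = 8000 * (A * (W * s)) := by ring
      _ ≤ 8000 * (A * B) := by omega
  have t3 : (2 * s + 1) * (900 * ((2 ^ r + 1) * (A * ((r + 1) * (r + 1)))) + 500 * W + 400) ≤
      30000 * (A * B) := by
    calc (2 * s + 1) * (900 * ((2 ^ r + 1) * (A * ((r + 1) * (r + 1)))) + 500 * W + 400)
        = (2 * s + 1) * (900 * (A * X) + 500 * W + 400) := by rw [hX]; ring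
      _ ≤ (3 * s) * (900 * (A * (10 * W)) + 500 * (A * W) + 400 * (A * W)) := by
        gcongr
        · omega
        · exact Nat.le_mul_of_pos_left _ hA1
        · exact Nat.le_mul_of_pos_right _ (Nat.mul_pos hA1 hW1)
      _ = 29700 * (A * (W * s)) := by ring
      _ ≤ 30000 * (A * B) := by omega
  have t4 : (s + 1) * (200 * (r + 1)) ≤ 2000 * B := by
    calc (s + 1) * (200 * (r + 1)) ≤ (2 * s) * (200 * (5 * W)) := by
          gcongr
          · omega
          · omega
      _ = 2000 * (W * s) := by ring
      _ ≤ 2000 * B := by omega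
  have t5 : (m + 1) * (300 * (s + 1)) ≤ 3000 * B := by
    calc (m + 1) * (300 * (s + 1)) ≤ (5 * W) * (300 * (2 * s)) := by
          gcongr
          · omega
          · omega
      _ = 3000 * (W * s) := by ring
      _ ≤ 3000 * B := by omega
  rw [← hA, ← hW, ← hB, mul_assoc 50000]
  omega

end VNEP

/-- One program solves Min-VNEP on all instances whose substrate is a tree, and takes at most
`C * (τ + 1) * (3 ^ r * (s + r ^ 2))` steps, with an absolute constant `C`. -/
theorem theorem1 :
    ∃ (P : VNEP.Prog) (C : ℕ), ∀ (τ r s : ℕ) (I : VNEP.Inst τ r s), I.substrate.IsTree →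
      ∃ (t : ℕ) (σ : VNEP.State), VNEP.Exec P I.input t σ ∧
        t ≤ C * (τ + 1) * (3 ^ r * (s + r ^ 2)) ∧ I.Answered σ := by
  refine ⟨VNEP.solveProg, 50000, fun τ r s I hT => ?_⟩
  obtain ⟨x₀⟩ : Nonempty (Fin s) := hT.2.connected.nonempty
  obtain ⟨t, σ, h1, h2, h3⟩ := I.solveProg_run hT
  exact ⟨t, σ, h1, h2.trans (VNEP.time_le x₀.pos I.size_request_le hT.size_le), h3⟩
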